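/- Let $d,k\in\mathbb N$ and $q\in(0,\infty)\cup\{\infty\}$ satisfy one of the following: (a) $k=2$, $q\ge 2$ and $3\le d\le 7$; (b) $k=2$, $q\ge 4$ and $d\ge 8$; (c) $k\ge 3$, $q\ge 2k$ and $d\ge 2$. Put $p=2k$. Let $\sigma$ be the standard surface measure on the unit sphere $\mathbb S^{d-1}\subset\mathbb R^d$, let $\omega_{d-1}=\sigma(\mathbb S^{d-1})$, and for $f\in L^1(\mathbb S^{d-1})$ let $$\widehat{f\sigma}(\xi)=\int_{\mathbb S^{d-1}}e^{-i\zeta\cdot\xi}f(\zeta)\,d\sigma(\zeta)\qquad(\xi\in\mathbb R^d),$$ with $\widehat\sigma=\widehat{1\sigma}$. Define $$C(d,p,q)=\sup_{0\ne f\in L^q(\mathbb S^{d-1})}\frac{\|\widehat{f\sigma}\|_{L^p(\mathbb R^d)}}{\|f\|_{L^q(\mathbb S^{d-1})}},$$ the supremum being taken over complex-valued functions. Then $C(d,p,q)$ is finite and $$C(d,p,q)=\omega_{d-1}^{-1/q}\,\|\widehat\sigma\|_{L^p(\mathbb R^d)}$$ (with $1/q=0$ if $q=\infty$). Moreover, a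 nonzero complex-valued $f\in L^q(\mathbb S^{d-1})$ attains the supremum if and only if there are $c\in\mathbb C\setminus\{0\}$ and $\xi\in\mathbb R^d$ such that $f(\zeta)=c\,e^{i\xi\cdot\zeta}$ for $\sigma$-almost every $\zeta\in\mathbb S^{d-1}$. -/

import Mathlib

open MeasureTheory
open scoped ENNReal

noncomputable section

namespace SphereRestriction

/-- Euclidean space `ℝ^d`. -/
abbrev Space (d : ℕ) : Type := EuclideanSpace ℝ (Fin d)

/-- The unit sphere `S^{d-1}` of `ℝ^d`. -/
abbrev Sphere (d : ℕ) : Type := Metric.sphere (0 : Space d) 1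

/-- The standard surface measure `σ` on `S^{d-1}`, i.e. the spherical part of Lebesgue measure in
polar coordinates. -/
def surfaceMeasure (d : ℕ) : Measure (Sphere d) :=
  (volume : Measure (Space d)).toSphere

/-- The total surface measure `ω_{d-1} = σ(S^{d-1})`. -/
def sphereArea (d : ℕ) : ℝ≥0∞ := surfaceMeasure d Set.univ

/-- The Fourier transform of the measure `f σ`,
`ξ ↦ ∫_{S^{d-1}} exp(-i ζ·ξ) f(ζ) dσ(ζ)`. -/
def extension (d : ℕ) (f : Sphere d → ℂ) (ξ : Space d) : ℂ :=
  ∫ ζ : Sphere d,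
    Complex.exp (-(Complex.I * ((inner ℝ (ζ : Space d) ξ : ℝ) : ℂ))) * f ζ ∂(surfaceMeasure d)

/-- `f` is a nonzero element of `L^q(S^{d-1})` (a complex-valued function representing it). -/
def IsNonzeroLp (d : ℕ) (q : ℝ≥0∞) (f : Sphere d → ℂ) : Prop :=
  MemLp f q (surfaceMeasure d) ∧ ¬ (f =ᵐ[surfaceMeasure d] 0)

/-- The sharp constant `C(d,p,q)`: the supremum over nonzero `f ∈ L^q(S^{d-1})` of
`‖(fσ)^‖_{L^p(ℝ^d)} / ‖f‖_{L^q(S^{d-1})}`, as an element of `[0,∞]`. -/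
def sharpConst (d : ℕ) (p q : ℝ≥0∞) : ℝ≥0∞ :=
  ⨆ (f : Sphere d → ℂ) (_ : IsNonzeroLp d q f),
    eLpNorm (extension d f) p volume / eLpNorm f q (surfaceMeasure d)

/-- `f` is a complex-valued extremizer: a nonzero element of `L^q(S^{d-1})` at which the supremum
defining the sharp constant is attained. -/
def IsExtremizer (d : ℕ) (p q : ℝ≥0∞) (f : Sphere d → ℂ) : Prop :=
  IsNonzeroLp d q f ∧
    eLpNorm (extension d f) p volume / eLpNorm f q (surfaceMeasure d) = sharpConst d p q

end SphereRestriction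

end

noncomputable section

namespace SphereRestriction

/-! Since p = 2k, the k-th power of the transform of fσ is the Fourier transform of the image of
f⊗...⊗f dσ^k under the sum map (ζ_1,...,ζ_k) ↦ ζ_1+...+ζ_k (`extension_pow`). When σ*...*σ has a
square integrable density w, Plancherel and Cauchy-Schwarz on the fibres of the sum map give
‖(fσ)^‖_{2k}^{2k} ≤ (2π)^d ∫ ∏|f(ζ_i)|² w(∑ζ_i) dσ^k. AM-GM replaces the product by the mean of the
|f(ζ_i)|^{2k}, and rotation invariance makes each one-point marginal of w(∑ζ_i) dσ^k a multiple of
σ. Every step is an equality for f = 1, so this is the sharp bound from L^{2k} to L^{2k}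
(`lintegral_extension_pow_le`). Equality for f forces |f| to be constant and ∏f(ζ_i) to be a
function of ∑ζ_i.

The functional equation is solved without any regularity of f (`ae_eq_pexp_of_prod_eq_comp`). A
function of the sum is orthogonal to every test function whose image under the sum map vanishes.
Such test functions are built from rotational derivatives of complex exponentials, which have mean
zero on the sphere. The resulting polynomial identities between moments of f say, by linear algebra,
that there is one vector τ such that f exp(τ·ζ) annihilates all rotational derivatives of
exponentials. Its Fourier transform is then radial, hence the function is constant, and f = c
exp(z·ζ) with z complex. Constant modulus makes z purely imaginary.

For k = 2 and 3 ≤ d ≤ 7 the exponent 2 replaces 4 on the sphere (`sharpAt_four_two`). Pairing f with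
its conjugate reflection bounds f by the even function g = √((|f(ζ)|²+|f(-ζ)|²)/2), which has the
same L² norm. The transform u of gσ is real and solves Δu = -u, so ∫u⁴ = 3∑∫(u ∂_j u)². As 2u ∂_j u
is the transform of -i x_j times the image of g⊗g, the fibrewise Cauchy-Schwarz bound now carries
the weight |x|²w(x), and this removes the singularity of w at the origin. In terms of t = ζ·η the
weight is a multiple of (1+t)^{1/2}(1-t)^{(d-3)/2}. The even part of this kernel has nonpositive
Taylor coefficients beyond the constant one when 3 ≤ d ≤ 7, and powers of t are positive definite on
the sphere, so among even g² of given mass the constants maximize the energy. In the equality case g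
is constant, then |f| is constant, and the L⁴ classification applies.

Hölder on the sphere carries a sharp inequality with its equality cases from one exponent q₀ to all
q ≥ q₀ (`SharpAt.conclusion`), because characters have constant modulus. -/

theorem eLpNorm_natCast_pow {α E : Type*} [MeasurableSpace α] [NormedAddCommGroup E] {μ : Measure α}
    {n : ℕ} (hn : n ≠ 0) (f : α → E) : eLpNorm f n μ ^ n = ∫⁻ x, ‖f x‖ₑ ^ n ∂μ := by
  rw [eLpNorm_eq_lintegral_rpow_enorm_toReal (by exact_mod_cast hn) (ENNReal.natCast_ne_top n),
    ← ENNReal.rpow_natCast, ← ENNReal.rpow_mul]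
  have : (n : ℝ) ≠ 0 := by exact_mod_cast hn
  simp [this]

theorem eLpNorm_two_sq {α E : Type*} [MeasurableSpace α] [NormedAddCommGroup E] {μ : Measure α}
    (f : α → E) : eLpNorm f 2 μ ^ 2 = ∫⁻ x, ‖f x‖ₑ ^ 2 ∂μ :=
  eLpNorm_natCast_pow (n := 2) two_ne_zero f

theorem memLp_natCast_iff {α E : Type*} [MeasurableSpace α] [NormedAddCommGroup E] {μ : Measure α}
    {n : ℕ} (hn : n ≠ 0) {f : α → E} (hf : AEStronglyMeasurable f μ) :
    MemLp f n μ ↔ ∫⁻ x, ‖f x‖ₑ ^ n ∂μ < ∞ := by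
  rw [← eLpNorm_natCast_pow hn, MemLp, and_iff_right hf, ENNReal.pow_lt_top_iff]
  simp [hn]

theorem memLp_two_iff {α E : Type*} [MeasurableSpace α] [NormedAddCommGroup E] {μ : Measure α}
    {f : α → E} (hf : AEStronglyMeasurable f μ) : MemLp f 2 μ ↔ ∫⁻ x, ‖f x‖ₑ ^ 2 ∂μ < ∞ :=
  memLp_natCast_iff (n := 2) two_ne_zero hf

/-! ### Plancherel for the pointwise Fourier integral. -/

section Plancherel

open scoped FourierTransform ContDiff

/-- The L² Fourier transform is an isometry by construction, so the point is that it agrees almost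
everywhere with the Fourier integral. Both are tested against smooth compactly supported functions,
where self-adjointness moves the transform onto the test function. -/
theorem lintegral_enorm_fourier_sq {V : Type*} [NormedAddCommGroup V] [InnerProductSpace ℝ V]
    [FiniteDimensional ℝ V] [MeasurableSpace V] [BorelSpace V] {h : V → ℂ}
    (h1 : Integrable h) (h2 : MemLp h 2) :
    ∫⁻ ξ, ‖𝓕 h ξ‖ₑ ^ 2 = ∫⁻ x, ‖h x‖ₑ ^ 2 := by
  set H : Lp ℂ 2 (volume : Measure V) := h2.toLp h with hH
  set G : Lp ℂ 2 (volume : Measure V) := 𝓕 H with hG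
  have hcont : Continuous (𝓕 h) := by
    have := VectorFourier.fourierIntegral_continuous (μ := (volume : Measure V))
      Real.continuous_fourierChar (L := innerₗ V) (by simpa using continuous_inner) h1
    exact this
  have key : 𝓕 h =ᵐ[volume] G := by
    refine ae_eq_of_integral_contDiff_smul_eq hcont.locallyIntegrable
      ((Lp.memLp G).locallyIntegrable (by norm_num)) ?_
    intro g g_smooth g_cpt
    have hg₁ : HasCompactSupport (Complex.ofRealCLM ∘ g) := g_cpt.comp_left rfl
    have hg₂ : ContDiff ℝ ∞ (Complex.ofRealCLM ∘ g) := by fun_prop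
    set φ : SchwartzMap V ℂ := hg₁.toSchwartzMap hg₂ with hφ
    have e1 : ∫ x, g x • 𝓕 h x = ∫ x, φ x * 𝓕 h x := by
      refine integral_congr_ae (.of_forall fun x => ?_)
      simp [hφ]
    have e2 : ∫ x, g x • G x = ∫ x, φ x * G x := by
      refine integral_congr_ae (.of_forall fun x => ?_)
      simp [hφ]
    have e3 : ∫ x, φ x * G x = ∫ x, 𝓕 φ x * H x := by
      have := congrArg (fun T => T φ) (Lp.fourier_toTemperedDistribution_eq H)
      simp only [TemperedDistribution.fourier_apply, Lp.toTemperedDistribution_apply,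
        smul_eq_mul] at this
      exact this.symm
    have e4 : ∫ x, 𝓕 φ x * H x = ∫ x, 𝓕 φ x * h x := by
      refine integral_congr_ae ?_
      filter_upwards [h2.coeFn_toLp] with x hx
      rw [hx]
    have e5 : ∫ x, φ x * 𝓕 h x = ∫ x, 𝓕 φ x * h x := by
      have := VectorFourier.integral_fourierIntegral_smul_eq_flip (μ := (volume : Measure V))
        (ν := (volume : Measure V)) Real.continuous_fourierChar (L := innerₗ V)
        (by simpa using continuous_inner) φ.integrable h1
      simp only [smul_eq_mul] at this
      rw [SchwartzMap.fourier_coe]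
      rw [flip_innerₗ] at this
      exact this.symm
    rw [e1, e2, e3, e4, e5]
  have n1 : ∫⁻ ξ, ‖𝓕 h ξ‖ₑ ^ 2 = eLpNorm G (2 : ℕ) volume ^ 2 := by
    rw [← eLpNorm_congr_ae key, eLpNorm_natCast_pow (n := 2) two_ne_zero] 
  have n2 : ∫⁻ ξ, ‖h ξ‖ₑ ^ 2 = eLpNorm H (2 : ℕ) volume ^ 2 := by
    rw [eLpNorm_congr_ae h2.coeFn_toLp, eLpNorm_natCast_pow (n := 2) two_ne_zero]
  have : ‖G‖ₑ = ‖H‖ₑ := by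
    have := Lp.norm_fourier_eq H
    rw [← ofReal_norm, ← ofReal_norm, this]
  rw [n1, n2, Nat.cast_ofNat, ← Lp.enorm_def, ← Lp.enorm_def, this]

end Plancherel

/-! ### Fourier transforms of image measures. -/

section Fourier

open scoped FourierTransform

variable {d : ℕ} {Ω : Type*} [MeasurableSpace Ω]

/-- The character `x ↦ exp(-i x·ξ)`. -/
def wave (x ξ : Space d) : ℂ := Complex.exp (-(Complex.I * ((inner ℝ x ξ : ℝ) : ℂ)))

/-- The Fourier transform of the push-forward of `F μ` under `s`. -/
def fourierPush (μ : Measure Ω) (s : Ω → Space d) (F : Ω → ℂ) (ξ : Space d) : ℂ :=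
  ∫ ω, wave (s ω) ξ * F ω ∂μ

theorem norm_wave (x ξ : Space d) : ‖wave x ξ‖ = 1 := by
  rw [wave, ← mul_neg, mul_comm, ← Complex.ofReal_neg]
  exact Complex.norm_exp_ofReal_mul_I _

@[fun_prop]
theorem continuous_wave {α : Type*} [TopologicalSpace α] {f g : α → Space d} (hf : Continuous f)
    (hg : Continuous g) : Continuous fun a => wave (f a) (g a) := by
  unfold wave
  fun_prop

@[fun_prop]
theorem measurable_wave {α : Type*} [MeasurableSpace α] {f g : α → Space d} (hf : Measurable f)
    (hg : Measurable g) : Measurable fun a => wave (f a) (g a) :=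
  Complex.measurable_exp.comp
    ((Complex.measurable_ofReal.comp (hf.inner hg)).const_mul Complex.I).neg

theorem wave_add (x y ξ : Space d) : wave (x + y) ξ = wave x ξ * wave y ξ := by
  simp only [wave, ← Complex.exp_add, inner_add_left]
  push_cast
  ring_nf

theorem conj_wave (x ξ : Space d) : starRingEnd ℂ (wave x ξ) = wave (-x) ξ := by
  simp [wave, ← Complex.exp_conj]

theorem wave_zero (ξ : Space d) : wave 0 ξ = 1 := by simp [wave]

theorem wave_sum {ι : Type*} (t : Finset ι) (x : ι → Space d) (ξ : Space d) :
    wave (∑ i ∈ t, x i) ξ = ∏ i ∈ t, wave (x i) ξ := by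
  classical
  induction t using Finset.induction_on with
  | empty => simp [wave_zero]
  | insert a t ha ih => rw [Finset.sum_insert ha, Finset.prod_insert ha, wave_add, ih]

theorem integrable_wave_mul {μ : Measure Ω} {s : Ω → Space d} (hs : Measurable s) {F : Ω → ℂ}
    (hF : Integrable F μ) (ξ : Space d) : Integrable (fun ω => wave (s ω) ξ * F ω) μ := by
  refine hF.bdd_mul (c := 1) (by fun_prop) ?_
  exact .of_forall fun ω => (norm_wave _ _).le

theorem continuous_fourierPush {μ : Measure Ω} {s : Ω → Space d} (hs : Measurable s) {F : Ω → ℂ}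
    (hF : Integrable F μ) : Continuous (fourierPush μ s F) := by
  refine continuous_of_dominated (bound := fun ω => ‖F ω‖)
    (fun ξ => (integrable_wave_mul hs hF ξ).aestronglyMeasurable) ?_ hF.norm ?_
  · exact fun ξ => .of_forall fun ω => by rw [norm_mul, norm_wave, one_mul]
  · refine .of_forall fun ω => ?_
    fun_prop

/-- The factor (2π)^d is the Jacobian of ξ ↦ 2πξ, which reconciles the phases exp(-ix·ξ) and
exp(-2πix·ξ). -/
theorem lintegral_enorm_fourierPush_volume_sq {h : Space d → ℂ}
    (h1 : Integrable h) (h2 : MemLp h 2) :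
    ∫⁻ ξ, ‖fourierPush volume id h ξ‖ₑ ^ 2 =
      ENNReal.ofReal (2 * Real.pi) ^ d * ∫⁻ x, ‖h x‖ₑ ^ 2 := by
  have e : ∀ ξ, fourierPush volume id h ((2 * Real.pi) • ξ) = 𝓕 h ξ := by
    intro ξ
    rw [Real.fourier_eq']
    refine integral_congr_ae (.of_forall fun x => ?_)
    simp only [wave, id, inner_smul_right, smul_eq_mul]
    congr 2
    push_cast
    ring
  rw [← lintegral_enorm_fourier_sq h1 h2]
  simp_rw [← e]
  have hpi : (2 * Real.pi) ≠ 0 := by positivity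
  have hm := Measure.map_addHaar_smul (volume : Measure (Space d)) hpi
  have hme : MeasurableEmbedding fun ξ : Space d => (2 * Real.pi) • ξ :=
    (Homeomorph.smulOfNeZero _ hpi).measurableEmbedding
  rw [← hme.lintegral_map (μ := volume) (fun ξ => ‖fourierPush volume id h ξ‖ₑ ^ 2)]
  rw [show (fun ξ : Space d => (2 * Real.pi) • ξ) = ((2 * Real.pi) • ·) from rfl, hm]
  rw [lintegral_smul_measure, smul_eq_mul, ← mul_assoc]
  simp only [finrank_euclideanSpace, Fintype.card_fin]
  rw [abs_of_pos (by positivity), ENNReal.ofReal_inv_of_pos (by positivity),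
    ENNReal.ofReal_pow (by positivity), ENNReal.mul_inv_cancel, one_mul]
  · positivity
  · finiteness

end Fourier

/-! ### Conditional expectation along a map whose image measure has an L² density. -/

section Projection

variable {d : ℕ} {Ω : Type*} [MeasurableSpace Ω] {μ : Measure Ω}
  {s : Ω → Space d} {w : Space d → ℝ≥0∞}

theorem ae_density_lt_top (hw2 : ∫⁻ x, w x ^ 2 ≠ ∞) (hw : Measurable w) :
    ∀ᵐ x, w x < ∞ := by
  filter_upwards [ae_lt_top (by fun_prop) hw2] with x hx
  by_contra h
  simp [not_lt_top_iff.1 h] at hx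

theorem ae_comp_of_ae (hs : Measurable s) (hmap : μ.map s = volume.withDensity w)
    {p : Space d → Prop} (hp : ∀ᵐ x, p x) : ∀ᵐ y ∂μ, p (s y) := by
  refine ae_of_ae_map hs.aemeasurable ?_
  rw [hmap]
  exact (withDensity_absolutelyContinuous _ _).ae_le hp

theorem ae_density_comp_ne_zero (hs : Measurable s) (hw : Measurable w)
    (hmap : μ.map s = volume.withDensity w) : ∀ᵐ y ∂μ, w (s y) ≠ 0 := by
  refine ae_of_ae_map (p := fun x => w x ≠ 0) hs.aemeasurable ?_
  rw [hmap, ae_withDensity_iff hw]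
  exact .of_forall fun x hx => hx

/-- With these weights, composition with s is an isometric embedding of L²(w² dx) into L²(w(s) μ);
its adjoint is the conditional expectation used next. -/
theorem measurePreserving_withDensity_comp (hs : Measurable s) (hw : Measurable w)
    (hmap : μ.map s = volume.withDensity w) :
    MeasurePreserving s (μ.withDensity fun y => w (s y)) (volume.withDensity fun x => w x ^ 2) := by
  refine ⟨hs, ?_⟩
  ext A hA
  have h1 : ∫⁻ a in s ⁻¹' A, w (s a) ∂μ = ∫⁻ x in A, w x ∂(μ.map s) :=
    (setLIntegral_map hA hw hs).symm
  rw [Measure.map_apply hs hA, withDensity_apply _ (hs hA), withDensity_apply _ hA, h1, hmap,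
    restrict_withDensity hA, lintegral_withDensity_eq_lintegral_mul _ hw hw]
  simp [sq]

set_option maxHeartbeats 400000 in
-- Take g to be the adjoint of composition with s applied to F, that is, the conditional expectation
-- of F given s. The image of F μ then has density w g, whose L² norm is the norm of g in L²(w² dx),
-- so Plancherel gives the first claim. The adjoint of an isometry is a contraction, and it
-- preserves the norm of F exactly when F lies in the range, that is, when F is a function of s.
theorem exists_projection [IsFiniteMeasure μ] (hs : Measurable s) (hw : Measurable w)
    (hmap : μ.map s = volume.withDensity w) (hw2 : ∫⁻ x, w x ^ 2 ≠ ∞) {R : ℝ}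
    (hR : ∀ y, ‖s y‖ ≤ R) {F : Ω → ℂ} (hF : MemLp F 2 (μ.withDensity fun y => w (s y))) :
    ∃ g : Lp ℂ 2 (volume.withDensity fun x => w x ^ 2),
      (∫⁻ ξ, ‖fourierPush μ s F ξ‖ₑ ^ 2 = ENNReal.ofReal (2 * Real.pi) ^ d * ‖g‖ₑ ^ 2) ∧
      ‖g‖ ≤ ‖hF.toLp F‖ ∧ (‖g‖ = ‖hF.toLp F‖ → ∀ᵐ y ∂μ, F y = g (s y)) ∧
      ((∃ G : Space d → ℂ, Measurable G ∧ ∀ y, F y = G (s y)) → ‖g‖ = ‖hF.toLp F‖) := by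
  have hwtop := ae_density_lt_top hw2 hw
  have hwstop := ae_comp_of_ae hs hmap hwtop
  have hws0 := ae_density_comp_ne_zero hs hw hmap
  have hws : Measurable fun y => w (s y) := hw.comp hs
  have hmp := measurePreserving_withDensity_comp hs hw hmap
  set T := Lp.compMeasurePreservingₗᵢ (E := ℂ) (p := 2) ℂ s hmp with hT
  set FL := hF.toLp F with hFL
  set g := T.toContinuousLinearMap.adjoint FL with hg
  have hinner : ∀ h, inner ℂ (T h) FL = inner ℂ h g := fun h => by
    rw [hg, ContinuousLinearMap.adjoint_inner_right]; rfl
  have hle : ‖g‖ ≤ ‖FL‖ := by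
    refine (T.toContinuousLinearMap.adjoint.le_opNorm FL).trans ?_
    refine mul_le_of_le_one_left (norm_nonneg _) ?_
    exact (ContinuousLinearMap.adjoint.norm_map T.toContinuousLinearMap).trans_le
      T.norm_toContinuousLinearMap_le
  have hTg : ∀ h : Lp ℂ 2 (volume.withDensity fun x => w x ^ 2),
      T h =ᵐ[μ.withDensity fun y => w (s y)] fun y => h (s y) := fun h =>
    Lp.coeFn_compMeasurePreserving h hmp
  have hFLae : FL =ᵐ[μ.withDensity fun y => w (s y)] F := hF.coeFn_toLp
  clear_value g FL T
  have hae : ∀ {p : Ω → Prop}, (∀ᵐ y ∂(μ.withDensity fun y => w (s y)), p y) → ∀ᵐ y ∂μ, p y := by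
    intro p hp
    rw [ae_withDensity_iff hws] at hp
    filter_upwards [hp, hws0] with y h1 h2 using h1 h2
  obtain ⟨W, hW⟩ : ∃ W : Space d → ℂ, W = fun x => ((w x).toReal : ℂ) * g x := ⟨_, rfl⟩
  have hgm : AEStronglyMeasurable W volume := by
    rw [hW]
    have : Measurable (g : Space d → ℂ) := (Lp.stronglyMeasurable g).measurable
    exact Measurable.aestronglyMeasurable (by fun_prop)
  have hWsq : ∫⁻ x, ‖W x‖ₑ ^ 2 = ‖g‖ₑ ^ 2 := by
    rw [Lp.enorm_def, eLpNorm_two_sq,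
      lintegral_withDensity_eq_lintegral_mul _ (hw.pow_const 2)
        ((Lp.stronglyMeasurable g).measurable.enorm.pow_const 2)]
    refine lintegral_congr_ae ?_
    filter_upwards [hwtop] with x hx
    simp only [hW, enorm_mul, Pi.mul_apply, mul_pow]
    congr 2
    rw [← ofReal_norm]
    simp [ENNReal.ofReal_toReal hx.ne]
  have hW2 : MemLp W 2 := by
    rw [memLp_two_iff hgm, hWsq]
    finiteness
  have hwR : ∀ᵐ x, R < ‖x‖ → w x = 0 := by
    have h0 : ∫⁻ x in {x : Space d | R < ‖x‖}, w x = 0 := by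
      have hm : MeasurableSet {x : Space d | R < ‖x‖} :=
        measurableSet_lt measurable_const measurable_norm
      rw [← withDensity_apply _ hm, ← hmap, Measure.map_apply hs hm]
      convert measure_empty (μ := μ)
      ext y
      simpa using hR y
    rw [setLIntegral_eq_zero_iff (measurableSet_lt measurable_const measurable_norm) hw] at h0
    filter_upwards [h0] with x hx using hx
  -- The density w vanishes almost everywhere outside the ball of radius R, so square integrability
  -- of W yields integrability.
  have hW1 : Integrable W := by
    have h1 : IntegrableOn W (Metric.closedBall 0 R) := by
      have : IsFiniteMeasure (volume.restrict (Metric.closedBall (0 : Space d) R)) :=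
        ⟨by simpa using measure_closedBall_lt_top⟩
      exact (hW2.restrict _).integrable (by norm_num)
    rw [← integrable_indicator_iff Metric.isClosed_closedBall.measurableSet] at h1
    refine h1.congr ?_
    filter_upwards [hwR] with x hx
    by_cases h : x ∈ Metric.closedBall (0 : Space d) R
    · rw [Set.indicator_of_mem h]
    · rw [Set.indicator_of_notMem h, hW]
      simp at h
      simp [hx h]
  have hfour : ∀ ξ, fourierPush μ s F ξ = fourierPush volume id W ξ := by
    intro ξ
    let A : Set (Space d) := {x | w x ≠ 0} ∩ Metric.closedBall 0 R
    have hAm : MeasurableSet A :=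
      (hw (measurableSet_singleton 0).compl).inter Metric.isClosed_closedBall.measurableSet
    -- The adjoint relation is tested on the conjugate character divided by w. Against F the weight
    -- w(s) cancels the division and leaves the transform of the image of F μ; against g the weight
    -- w² leaves one factor w, that is, the transform of w g. The cut-off to a ball puts h in L²(w²
    -- dx), since |h|²w² ≤ 1.
    obtain ⟨h, hh⟩ : ∃ h : Space d → ℂ,
        h = A.indicator fun x => starRingEnd ℂ (wave x ξ) * ((w x).toReal : ℂ)⁻¹ := ⟨_, rfl⟩
    have hhm : Measurable h := by
      rw [hh]
      refine Measurable.indicator ?_ hAm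
      exact (continuous_star.measurable.comp (by fun_prop)).mul (by fun_prop)
    have hh2 : MemLp h 2 (volume.withDensity fun x => w x ^ 2) := by
      rw [memLp_two_iff hhm.aestronglyMeasurable,
          lintegral_withDensity_eq_lintegral_mul _ (by fun_prop) (by fun_prop)]
      calc _ ≤ ∫⁻ x, (Metric.closedBall (0 : Space d) R).indicator 1 x := by
            refine lintegral_mono_ae ?_
            filter_upwards [hwtop] with x hx
            by_cases hxA : x ∈ A
            · rw [Set.indicator_of_mem hxA.2]
              simp only [hh, Pi.mul_apply, Set.indicator_of_mem hxA, enorm_mul, Pi.one_apply]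
              have e1 : ‖starRingEnd ℂ (wave x ξ)‖ₑ = 1 := by
                rw [conj_wave, ← ofReal_norm, norm_wave, ENNReal.ofReal_one]
              have e2 : ‖((w x).toReal : ℂ)⁻¹‖ₑ = (w x)⁻¹ := by
                rw [enorm_inv (by simpa [ENNReal.toReal_eq_zero_iff] using ⟨hxA.1, hx.ne⟩),
                  ← ofReal_norm]
                simp [ENNReal.ofReal_toReal hx.ne]
              rw [e1, e2, one_mul, ← mul_pow, ENNReal.mul_inv_cancel hxA.1 hx.ne, one_pow]
            · simp [hh, hxA]
        _ < ∞ := by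
            rw [lintegral_indicator_one Metric.isClosed_closedBall.measurableSet]
            exact measure_closedBall_lt_top
    have h0 := hinner (hh2.toLp h)
    rw [L2.inner_def, L2.inner_def] at h0
    have el : ∫ y, inner ℂ (T (hh2.toLp h) y) (FL y) ∂(μ.withDensity fun y => w (s y)) =
        fourierPush μ s F ξ := by
      have : ∀ᵐ y ∂(μ.withDensity fun y => w (s y)),
          inner ℂ (T (hh2.toLp h) y) (FL y) = starRingEnd ℂ (h (s y)) * F y := by
        filter_upwards [hTg (hh2.toLp h), hFLae,
          hmp.quasiMeasurePreserving.ae hh2.coeFn_toLp] with y h1 h2 h3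
        rw [h1, h2, h3, RCLike.inner_apply, mul_comm]
      rw [integral_congr_ae this, integral_withDensity_eq_integral_toReal_smul hws hwstop]
      refine integral_congr_ae ?_
      filter_upwards [hws0, hwstop] with y h1 h2
      have hyA : s y ∈ A := ⟨h1, by simpa using hR y⟩
      have h3 : ((w (s y)).toReal : ℂ) ≠ 0 := by
        simpa [ENNReal.toReal_eq_zero_iff] using ⟨h1, h2.ne⟩
      simp only [hh, Set.indicator_of_mem hyA, map_mul, Complex.conj_conj, map_inv₀,
        Complex.conj_ofReal, Complex.real_smul]
      field_simp
    have er : ∫ x, inner ℂ (hh2.toLp h x) (g x) ∂(volume.withDensity fun x => w x ^ 2) =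
        fourierPush volume id W ξ := by
      have : ∀ᵐ x ∂(volume.withDensity fun x => w x ^ 2),
          inner ℂ (hh2.toLp h x) (g x) = starRingEnd ℂ (h x) * g x := by
        filter_upwards [hh2.coeFn_toLp] with y h1
        rw [h1, RCLike.inner_apply, mul_comm]
      rw [integral_congr_ae this, integral_withDensity_eq_integral_toReal_smul (by fun_prop)
        (by filter_upwards [hwtop] with x hx using by finiteness)]
      refine integral_congr_ae ?_
      filter_upwards [hwtop, hwR] with x h2 h4
      by_cases hxA : x ∈ A
      · have h3 : ((w x).toReal : ℂ) ≠ 0 := by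
          simpa [ENNReal.toReal_eq_zero_iff] using ⟨hxA.1, h2.ne⟩
        simp only [hh, Set.indicator_of_mem hxA, map_mul, Complex.conj_conj, map_inv₀,
          Complex.conj_ofReal, Complex.real_smul, hW, ENNReal.toReal_pow, id]
        push_cast
        field_simp
      · have : w x = 0 := by
          by_contra h5
          exact hxA ⟨h5, by simpa using not_lt.1 fun h6 => h5 (h4 h6)⟩
        simp [hh, hxA, hW, this]
    rw [← el, ← er, h0]
  refine ⟨g, ?_, hle, fun heq => ?_, ?_⟩
  · simp_rw [hfour]
    rw [lintegral_enorm_fourierPush_volume_sq hW1 hW2, hWsq]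
  -- Expanding ‖FL - T g‖² with ⟨FL, T g⟩ = ‖g‖² gives ‖FL‖² - ‖g‖², which vanishes by hypothesis.
  · have : FL = T g := by
      refine sub_eq_zero.1 (norm_eq_zero.1 (pow_eq_zero_iff two_ne_zero |>.1 ?_))
      rw [@norm_sub_sq ℂ]
      have : inner ℂ FL (T g) = ((‖g‖ ^ 2 : ℝ) : ℂ) := by
        rw [← inner_conj_symm, hinner, inner_self_eq_norm_sq_to_K]
        simp
      rw [this, T.norm_map, heq]
      simp only [RCLike.re_to_complex, Complex.ofReal_re]
      ring
    refine hae ?_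
    filter_upwards [hFLae, hTg g] with y h1 h2
    rw [← h1, ← h2, this]
  · rintro ⟨G, hGm, hG⟩
    have hG2 : MemLp G 2 (volume.withDensity fun x => w x ^ 2) := by
      have e : F = G ∘ s := funext hG
      rw [e] at hF
      rwa [← hmp.map_eq, memLp_map_measure_iff hGm.aestronglyMeasurable hs.aemeasurable]
    have hTG : T (hG2.toLp G) = FL := by
      refine Lp.ext ?_
      filter_upwards [hFLae, hTg (hG2.toLp G),
        hmp.quasiMeasurePreserving.ae hG2.coeFn_toLp] with y h1 h2 h3
      rw [h1, h2, h3, hG]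
    refine le_antisymm hle ?_
    -- If F = T G then ‖F‖² = ⟨G, g⟩ ≤ ‖F‖ ‖g‖, which is the missing inequality.
    have h1 : ‖FL‖ ^ 2 = RCLike.re (inner ℂ (hG2.toLp G) g) := by
      rw [← hinner, hTG, inner_self_eq_norm_sq_to_K]
      norm_cast
    have h2 : ‖hG2.toLp G‖ = ‖FL‖ := by rw [← hTG, T.norm_map]
    have h3 : ‖FL‖ ^ 2 ≤ ‖FL‖ * ‖g‖ := by
      rw [h1, ← h2]
      exact (RCLike.re_le_norm _).trans (norm_inner_le_norm _ _)
    by_contra! h4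
    have h5 := mul_lt_mul_of_pos_left h4 ((norm_nonneg g).trans_lt h4)
    rw [← sq] at h5
    exact absurd h3 (not_le.2 h5)

end Projection

/-! ### The Plancherel inequality for image measures and its equality case. -/

section Projection

variable {d : ℕ} {Ω : Type*} [MeasurableSpace Ω] {μ : Measure Ω}
  {s : Ω → Space d} {w : Space d → ℝ≥0∞}

theorem memLp_two_withDensity_iff (hs : Measurable s) (hw : Measurable w)
    (hwtop : ∀ᵐ y ∂μ, w (s y) < ∞) {F : Ω → ℂ} (hF : AEStronglyMeasurable F μ) :
    MemLp F 2 (μ.withDensity fun y => w (s y)) ↔ ∫⁻ y, ‖F y‖ₑ ^ 2 * w (s y) ∂μ < ∞ := by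
  rw [memLp_two_iff (hF.mono_ac (withDensity_absolutelyContinuous _ _)),
    lintegral_withDensity_eq_lintegral_mul_non_measurable₀ _ 
      (f := fun y => w (s y)) (hw.comp hs).aemeasurable hwtop]
  simp [mul_comm]

theorem enorm_toLp_sq (hs : Measurable s) (hw : Measurable w)
    (hwtop : ∀ᵐ y ∂μ, w (s y) < ∞) {F : Ω → ℂ}
    (hF : MemLp F 2 (μ.withDensity fun y => w (s y))) :
    ‖hF.toLp F‖ₑ ^ 2 = ∫⁻ y, ‖F y‖ₑ ^ 2 * w (s y) ∂μ := by
  rw [Lp.enorm_def, eLpNorm_congr_ae hF.coeFn_toLp, eLpNorm_two_sq,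
    lintegral_withDensity_eq_lintegral_mul_non_measurable₀ _ 
      (f := fun y => w (s y)) (hw.comp hs).aemeasurable hwtop]
  simp [mul_comm]

theorem two_pi_pow_ne_zero (d : ℕ) : ENNReal.ofReal (2 * Real.pi) ^ d ≠ 0 := by
  have : 0 < ENNReal.ofReal (2 * Real.pi) := by simpa using Real.pi_pos
  positivity

theorem two_pi_pow_ne_top (d : ℕ) : ENNReal.ofReal (2 * Real.pi) ^ d ≠ ∞ := by finiteness

variable [IsFiniteMeasure μ]

/-- The push-forward of `F μ` under `s` has a square integrable density, of `L²` norm controlled by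
the norm of `F` in `L²(w(s) μ)`, where `w` is the density of the push-forward of `μ`. -/
theorem lintegral_fourierPush_sq_le (hs : Measurable s) (hw : Measurable w)
    (hmap : μ.map s = volume.withDensity w) (hw2 : ∫⁻ x, w x ^ 2 ≠ ∞) {R : ℝ}
    (hR : ∀ y, ‖s y‖ ≤ R) {F : Ω → ℂ} (hF : AEStronglyMeasurable F μ) :
    ∫⁻ ξ, ‖fourierPush μ s F ξ‖ₑ ^ 2 ≤
      ENNReal.ofReal (2 * Real.pi) ^ d * ∫⁻ y, ‖F y‖ₑ ^ 2 * w (s y) ∂μ := by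
  have hwstop := ae_comp_of_ae hs hmap (ae_density_lt_top hw2 hw)
  by_cases h : ∫⁻ y, ‖F y‖ₑ ^ 2 * w (s y) ∂μ < ∞
  · have h2 := (memLp_two_withDensity_iff hs hw hwstop hF).2 h
    obtain ⟨g, h3, h4, -, -⟩ := exists_projection hs hw hmap hw2 hR h2
    rw [h3, ← enorm_toLp_sq hs hw hwstop h2]
    gcongr
    rw [← ofReal_norm, ← ofReal_norm]
    gcongr
  · rw [not_lt_top_iff.1 h, ENNReal.mul_top (two_pi_pow_ne_zero d)]
    exact le_top

theorem exists_factor_of_lintegral_fourierPush_sq_eq (hs : Measurable s) (hw : Measurable w)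
    (hmap : μ.map s = volume.withDensity w) (hw2 : ∫⁻ x, w x ^ 2 ≠ ∞) {R : ℝ}
    (hR : ∀ y, ‖s y‖ ≤ R) {F : Ω → ℂ} (hF : AEStronglyMeasurable F μ)
    (hfin : ∫⁻ y, ‖F y‖ₑ ^ 2 * w (s y) ∂μ ≠ ∞)
    (heq : ENNReal.ofReal (2 * Real.pi) ^ d * ∫⁻ y, ‖F y‖ₑ ^ 2 * w (s y) ∂μ ≤
      ∫⁻ ξ, ‖fourierPush μ s F ξ‖ₑ ^ 2) :
    ∃ G : Space d → ℂ, Measurable G ∧ ∀ᵐ y ∂μ, F y = G (s y) := by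
  have hwstop := ae_comp_of_ae hs hmap (ae_density_lt_top hw2 hw)
  have h2 := (memLp_two_withDensity_iff hs hw hwstop hF).2 hfin.lt_top
  obtain ⟨g, h3, h4, h5, -⟩ := exists_projection hs hw hmap hw2 hR h2
  refine ⟨g, (Lp.stronglyMeasurable g).measurable, h5 (le_antisymm h4 ?_)⟩
  rw [h3, ← enorm_toLp_sq hs hw hwstop h2,
    ENNReal.mul_le_mul_iff_right (two_pi_pow_ne_zero d) (two_pi_pow_ne_top d),
    ← ofReal_norm, ← ofReal_norm, ← ENNReal.ofReal_pow (norm_nonneg _),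
    ← ENNReal.ofReal_pow (norm_nonneg _), ENNReal.ofReal_le_ofReal_iff (by positivity)] at heq
  exact le_of_sq_le_sq heq (norm_nonneg _)

/-- Functions of s are fixed by the projection, so nothing is lost. Constants, and later the
coordinates of the sum, enter the sharp constant this way. -/
theorem lintegral_fourierPush_comp_sq_eq (hs : Measurable s) (hw : Measurable w)
    (hmap : μ.map s = volume.withDensity w) (hw2 : ∫⁻ x, w x ^ 2 ≠ ∞) {R : ℝ}
    (hR : ∀ y, ‖s y‖ ≤ R) {G : Space d → ℂ} (hG : Measurable G)
    (hfin : ∫⁻ y, ‖G (s y)‖ₑ ^ 2 * w (s y) ∂μ ≠ ∞) :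
    ∫⁻ ξ, ‖fourierPush μ s (fun y => G (s y)) ξ‖ₑ ^ 2 =
      ENNReal.ofReal (2 * Real.pi) ^ d * ∫⁻ y, ‖G (s y)‖ₑ ^ 2 * w (s y) ∂μ := by
  have hwstop := ae_comp_of_ae hs hmap (ae_density_lt_top hw2 hw)
  have h2 := (memLp_two_withDensity_iff (F := fun y => G (s y)) hs hw hwstop
    (hG.comp hs).aestronglyMeasurable).2 hfin.lt_top
  obtain ⟨g, h3, h4, -, h5⟩ := exists_projection hs hw hmap hw2 hR h2
  rw [h3, ← enorm_toLp_sq (F := fun y => G (s y)) hs hw hwstop h2, ← ofReal_norm, ← ofReal_norm,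
    h5 ⟨G, hG, fun y => rfl⟩]

end Projection

/-! ### Functions whose image measure vanishes. -/

section Vanishing

variable {d : ℕ} {Ω : Type*} [MeasurableSpace Ω] {μ : Measure Ω} {s : Ω → Space d}

theorem fourierPush_conj (a : Ω → ℂ) (ξ : Space d) :
    fourierPush μ s (fun y => starRingEnd ℂ (a y)) ξ =
      starRingEnd ℂ (fourierPush μ s a (-ξ)) := by
  rw [fourierPush, fourierPush, ← integral_conj]
  congr with y
  simp [wave, ← Complex.exp_conj]

/-- The images of the positive and negative parts of a are finite measures with the same
characteristic function, hence equal, and G may be integrated against either. -/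
theorem integral_comp_mul_eq_zero_real (hs : Measurable s) {a : Ω → ℝ}
    (ha : Integrable a μ) (h0 : ∀ ξ, fourierPush μ s (fun y => (a y : ℂ)) ξ = 0)
    {G : Space d → ℂ} (hG : Measurable G) (hGa : Integrable (fun y => G (s y) * a y) μ) :
    ∫ y, G (s y) * a y ∂μ = 0 := by
  have hpos : ∀ {b : Ω → ℝ}, Integrable b μ → IsFiniteMeasure
      ((μ.withDensity fun y => ENNReal.ofReal (b y)).map s) := by
    intro b hb
    have := isFiniteMeasure_withDensity_ofReal hb.2
    infer_instance
  have hint : ∀ {b : Ω → ℝ}, Integrable b μ → ∀ {H : Space d → ℂ}, Measurable H →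
      ∫ x, H x ∂((μ.withDensity fun y => ENNReal.ofReal (b y)).map s) =
        ∫ y, H (s y) * (max (b y) 0 : ℝ) ∂μ := by
    intro b hb H hH
    rw [integral_map hs.aemeasurable hH.aestronglyMeasurable,
      integral_withDensity_eq_integral_toReal_smul₀ hb.1.aemeasurable.ennreal_ofReal (by simp)]
    congr with y
    rw [ENNReal.toReal_ofReal', Complex.real_smul, mul_comm]
  have i1 := hpos ha
  have i2 := hpos ha.neg
  have hb : ∀ {H : Space d → ℂ}, Measurable H → Integrable (fun y => H (s y) * a y) μ →
      ∫ y, H (s y) * a y ∂μ = ∫ y, H (s y) * (max (a y) 0 : ℝ) ∂μ -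
        ∫ y, H (s y) * (max (-a y) 0 : ℝ) ∂μ := by
    intro H hH hHa
    have hb : ∀ b : Ω → ℝ, (∀ y, |b y| ≤ |a y|) → AEStronglyMeasurable b μ →
        Integrable (fun y => H (s y) * (b y : ℂ)) μ := by
      intro b h1 h2
      refine hHa.mono ((hH.comp hs).aestronglyMeasurable.mul
        (Complex.continuous_ofReal.comp_aestronglyMeasurable h2)) (.of_forall fun y => ?_)
      simp only [norm_mul, Complex.norm_real]
      gcongr
      exact h1 y
    rw [← integral_sub]
    · congr with y
      rw [← mul_sub, ← Complex.ofReal_sub]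
      congr 2
      rcases le_total (a y) 0 with h | h <;> simp [h]
    · refine hb (fun y => max (a y) 0) (fun y => ?_) (ha.1.aemeasurable.max aemeasurable_const).aestronglyMeasurable
      rcases le_total (a y) 0 with h | h <;> simp [h]
    · refine hb (fun y => max (-a y) 0) (fun y => ?_)
        (ha.1.aemeasurable.neg.max aemeasurable_const).aestronglyMeasurable
      rcases le_total (a y) 0 with h | h <;> simp [h]
  have key : (μ.withDensity fun y => ENNReal.ofReal (a y)).map s =
      (μ.withDensity fun y => ENNReal.ofReal ((-a) y)).map s := by
    refine Measure.ext_of_charFun (funext fun t => ?_)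
    have hm : Measurable fun x : Space d => wave x (-t) := by fun_prop
    have e : ∀ x : Space d, Complex.exp ((inner ℝ x t : ℝ) * Complex.I) = wave x (-t) := by
      intro x; simp [wave, mul_comm]
    simp only [charFun_apply, e]
    rw [hint ha hm, hint ha.neg hm, ← sub_eq_zero]
    have h1 := hb (H := fun x => wave x (-t)) hm (integrable_wave_mul hs ha.ofReal _)
    simp only [Pi.neg_apply]
    rw [← h1]
    exact h0 (-t)
  rw [hb hG hGa, ← hint ha hG, sub_eq_zero, key, hint ha.neg hG]
  rfl

/-- If the push-forward of `a μ` under `s` vanishes, then `a` is orthogonal to functions of `s`. -/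
theorem integral_comp_mul_eq_zero (hs : Measurable s) {a : Ω → ℂ}
    (ha : Integrable a μ) (h0 : ∀ ξ, fourierPush μ s a ξ = 0)
    {G : Space d → ℂ} (hG : Measurable G) (hGa : Integrable (fun y => G (s y) * a y) μ) :
    ∫ y, G (s y) * a y ∂μ = 0 := by
  have hc : Integrable (fun y => starRingEnd ℂ (a y)) μ :=
    (Complex.conjCLE.toContinuousLinearMap.integrable_comp ha)
  have hc0 : ∀ ξ, fourierPush μ s (fun y => starRingEnd ℂ (a y)) ξ = 0 := fun ξ => by
    rw [fourierPush_conj, h0, map_zero]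
  -- Real and imaginary parts are c a plus its conjugate, for c = 1/2 and c = -i/2. The transform of
  -- the conjugate also vanishes, being the conjugate of the transform of a at -ξ.
  have hlin : ∀ (c : ℂ) (b : Ω → ℝ),
      (∀ y, (b y : ℂ) = c * a y + starRingEnd ℂ (c * a y)) →
      ∀ ξ, fourierPush μ s (fun y => (b y : ℂ)) ξ = 0 := by
    intro c b hb ξ
    have e : (fun y => wave (s y) ξ * (b y : ℂ)) = fun y => c * (wave (s y) ξ * a y) +
        starRingEnd ℂ c * (wave (s y) ξ * starRingEnd ℂ (a y)) := by
      ext y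
      rw [hb, map_mul]
      ring
    rw [fourierPush, e, integral_add ((integrable_wave_mul hs ha ξ).const_mul _)
      ((integrable_wave_mul hs hc ξ).const_mul _), integral_const_mul, integral_const_mul]
    have h1 := h0 ξ
    have h2 := hc0 ξ
    unfold fourierPush at h1 h2
    rw [h1, h2]
    simp
  have hdom : ∀ b : Ω → ℝ, (∀ y, |b y| ≤ ‖a y‖) → AEStronglyMeasurable b μ →
      Integrable (fun y => G (s y) * (b y : ℂ)) μ := by
    intro b h1 h2
    refine hGa.mono ((hG.comp hs).aestronglyMeasurable.mul
      (Complex.continuous_ofReal.comp_aestronglyMeasurable h2)) (.of_forall fun y => ?_)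
    simp only [norm_mul, Complex.norm_real]
    gcongr
    exact h1 y
  have hre1 := hdom (fun y => (a y).re) (fun y => Complex.abs_re_le_norm _) ha.re.1
  have him1 := hdom (fun y => (a y).im) (fun y => Complex.abs_im_le_norm _) ha.im.1
  have hre := integral_comp_mul_eq_zero_real hs ha.re
    (hlin (1 / 2) _ fun y => by
      apply Complex.ext
      · simp; ring
      · simp) hG hre1
  have him := integral_comp_mul_eq_zero_real hs ha.im
    (hlin (-(Complex.I * (1 / 2))) _ fun y => by
      apply Complex.ext
      · simp; ring
      · simp) hG him1
  have e : (fun y => G (s y) * a y) =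
      fun y => G (s y) * ((a y).re : ℂ) + Complex.I * (G (s y) * ((a y).im : ℂ)) := by
    ext y
    conv_lhs => rw [← Complex.re_add_im (a y)]
    ring
  rw [e, integral_add hre1 (him1.const_mul _), integral_const_mul]
  erw [hre, him]
  simp

/-- When s is an embedding every measurable set is a preimage under s, so the orthogonality to
functions of s covers all indicators. -/
theorem ae_eq_zero_of_fourierPush_eq_zero [IsFiniteMeasure μ] (hs : MeasurableEmbedding s)
    {f : Ω → ℂ} (hf : Integrable f μ) (h0 : ∀ ξ, fourierPush μ s f ξ = 0) : f =ᵐ[μ] 0 := by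
  refine hf.ae_eq_zero_of_forall_setIntegral_eq_zero fun A hA _ => ?_
  have hm : Measurable ((s '' A).indicator (1 : Space d → ℂ)) :=
    measurable_one.indicator (hs.measurableSet_image.2 hA)
  have e : (fun y => (s '' A).indicator (1 : Space d → ℂ) (s y) * f y) = A.indicator f := by
    ext y
    by_cases hy : y ∈ A
    · simp [hy, hs.injective.mem_set_image]
    · simp [hy, hs.injective.mem_set_image]
  have := integral_comp_mul_eq_zero hs.measurable hf h0 hm (by rw [e]; exact hf.indicator hA)
  rwa [e, integral_indicator hA] at this

end Vanishing

/-! ### Pointwise domination increases the L² norm of the transform. -/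

section Domination

variable {d : ℕ} {Ω : Type*} [MeasurableSpace Ω] {μ : Measure Ω} {s : Ω → Space d}

theorem integrable_exp_neg_mul_sq_norm {ε : ℝ} (hε : 0 < ε) :
    Integrable fun ξ : Space d => Real.exp (-ε * ‖ξ‖ ^ 2) := by
  have := GaussianFourier.integrable_cexp_neg_mul_sq_norm_add (V := Space d) (b := ε)
    (by simpa using hε) 0 0
  have := this.norm
  simpa [Complex.norm_exp, ← Complex.ofReal_pow] using this

theorem integral_wave_mul_exp {ε : ℝ} (hε : 0 < ε) (x : Space d) :
    ∫ ξ, wave x ξ * (Real.exp (-ε * ‖ξ‖ ^ 2) : ℝ) =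
      (((Real.pi / ε) ^ ((d : ℝ) / 2) * Real.exp (-‖x‖ ^ 2 / (4 * ε)) : ℝ) : ℂ) := by
  have := GaussianFourier.integral_cexp_neg_mul_sq_norm_add (V := Space d) (b := ε)
    (by simpa using hε) (-Complex.I) x
  convert this using 1
  · congr with ξ
    rw [wave, Complex.ofReal_exp, ← Complex.exp_add]
    push_cast
    ring_nf
  · push_cast
    rw [Complex.ofReal_cpow (by positivity)]
    simp

/-- Fubini and the Fourier transform of a Gaussian turn the damped L² norm into a quadratic form
with a positive kernel. The damping is what permits this without assuming the transform to be square
integrable. -/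
theorem integral_norm_sq_mul_exp [SFinite μ] (hs : Measurable s) {F : Ω → ℂ} (hF : Integrable F μ) {ε : ℝ}
    (hε : 0 < ε) :
    ((∫ ξ, ‖fourierPush μ s F ξ‖ ^ 2 * Real.exp (-ε * ‖ξ‖ ^ 2) : ℝ) : ℂ) =
      ∫ p : Ω × Ω, F p.1 * starRingEnd ℂ (F p.2) *
        (((Real.pi / ε) ^ ((d : ℝ) / 2) * Real.exp (-‖s p.1 - s p.2‖ ^ 2 / (4 * ε)) : ℝ) : ℂ)
        ∂(μ.prod μ) := by
  have hc : Integrable (fun y => starRingEnd ℂ (F y)) μ :=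
    (Complex.conjCLE.toContinuousLinearMap.integrable_comp hF)
  have h1 : ∀ ξ, ((‖fourierPush μ s F ξ‖ ^ 2 * Real.exp (-ε * ‖ξ‖ ^ 2) : ℝ) : ℂ) =
      ∫ p : Ω × Ω, F p.1 * starRingEnd ℂ (F p.2) *
        (wave (s p.1 - s p.2) ξ * (Real.exp (-ε * ‖ξ‖ ^ 2) : ℝ)) ∂(μ.prod μ) := by
    intro ξ
    rw [Complex.ofReal_mul, Complex.ofReal_pow, ← Complex.mul_conj', fourierPush, ← integral_conj,
      ← integral_prod_mul, ← integral_mul_const]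
    congr with p
    rw [map_mul, conj_wave, sub_eq_add_neg, wave_add]
    ring
  rw [← integral_complex_ofReal]
  simp_rw [h1]
  rw [integral_integral_swap]
  · congr with p
    rw [integral_const_mul, integral_wave_mul_exp hε]
  · have i1 : Integrable (fun q : Space d × (Ω × Ω) =>
        ((Real.exp (-ε * ‖q.1‖ ^ 2) : ℝ) : ℂ) * (F q.2.1 * starRingEnd ℂ (F q.2.2)))
        (volume.prod (μ.prod μ)) :=
      (integrable_exp_neg_mul_sq_norm hε).ofReal.mul_prod (hF.mul_prod hc)
    have i2 := i1.bdd_mul (f := fun q : Space d × (Ω × Ω) => wave (s q.2.1 - s q.2.2) q.1)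
      (c := 1) (Measurable.aestronglyMeasurable (by fun_prop))
      (.of_forall fun q => (norm_wave _ _).le)
    refine i2.congr (.of_forall fun q => ?_)
    simp only [Function.uncurry]
    ring

theorem integrable_norm_sq_mul_exp (hs : Measurable s) {F : Ω → ℂ} (hF : Integrable F μ) {ε : ℝ}
    (hε : 0 < ε) :
    Integrable fun ξ => ‖fourierPush μ s F ξ‖ ^ 2 * Real.exp (-ε * ‖ξ‖ ^ 2) := by
  refine (integrable_exp_neg_mul_sq_norm hε).bdd_mul (c := (∫ y, ‖F y‖ ∂μ) ^ 2)
    ((continuous_fourierPush hs hF).norm.pow 2).aestronglyMeasurable (.of_forall fun ξ => ?_)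
  rw [norm_pow, norm_norm]
  gcongr
  refine (norm_integral_le_integral_norm _).trans (le_of_eq ?_)
  congr with y
  rw [norm_mul, norm_wave, one_mul]

/-- Because the Gaussian kernel is positive, the modulus of F(p₁) times the conjugate of F(p₂) may
be replaced by H(p₁)H(p₂). The damping is then removed with Fatou on the left, while on the right it
is at most 1. -/
theorem lintegral_fourierPush_sq_le_of_norm_le [SFinite μ] (hs : Measurable s) {F : Ω → ℂ} {H : Ω → ℝ}
    (hF : Integrable F μ) (hH : Integrable H μ) (hle : ∀ᵐ y ∂μ, ‖F y‖ ≤ H y) :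
    ∫⁻ ξ, ‖fourierPush μ s F ξ‖ₑ ^ 2 ≤ ∫⁻ ξ, ‖fourierPush μ s (fun y => (H y : ℂ)) ξ‖ₑ ^ 2 := by
  have hHc : Integrable (fun y => (H y : ℂ)) μ := hH.ofReal
  have hreal : ∀ ε : ℝ, 0 < ε → ∫ ξ, ‖fourierPush μ s F ξ‖ ^ 2 * Real.exp (-ε * ‖ξ‖ ^ 2) ≤
      ∫ ξ, ‖fourierPush μ s (fun y => (H y : ℂ)) ξ‖ ^ 2 * Real.exp (-ε * ‖ξ‖ ^ 2) := by
    intro ε hε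
    have e1 := integral_norm_sq_mul_exp hs hF hε
    have e2 := integral_norm_sq_mul_exp hs hHc hε
    set K : Ω × Ω → ℝ := fun p =>
      (Real.pi / ε) ^ ((d : ℝ) / 2) * Real.exp (-‖s p.1 - s p.2‖ ^ 2 / (4 * ε)) with hK
    have hKm : Measurable K := by fun_prop
    have hK0 : ∀ p, 0 ≤ K p := fun p => by positivity
    have hKb : ∀ p, ‖K p‖ ≤ (Real.pi / ε) ^ ((d : ℝ) / 2) := fun p => by
      rw [Real.norm_of_nonneg (hK0 p)]
      refine mul_le_of_le_one_right (by positivity) (Real.exp_le_one_iff.2 ?_)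
      rw [neg_div]
      exact neg_nonpos.2 (by positivity)
    have e3 : ∫ ξ, ‖fourierPush μ s (fun y => (H y : ℂ)) ξ‖ ^ 2 * Real.exp (-ε * ‖ξ‖ ^ 2) =
        ∫ p : Ω × Ω, H p.1 * H p.2 * K p ∂(μ.prod μ) := by
      apply Complex.ofReal_injective
      rw [e2, ← integral_complex_ofReal]
      congr with p
      rw [Complex.conj_ofReal]
      push_cast [hK]
      rfl
    have hHi : Integrable (fun p : Ω × Ω => H p.1 * H p.2 * K p) (μ.prod μ) :=
      (hH.mul_prod hH).mul_bdd hKm.aestronglyMeasurable (.of_forall hKb)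
    rw [e3]
    refine (le_abs_self _).trans ?_
    rw [← Real.norm_eq_abs, ← Complex.norm_real, e1]
    refine norm_integral_le_of_norm_le hHi ?_
    filter_upwards [Measure.quasiMeasurePreserving_fst.ae hle,
      Measure.quasiMeasurePreserving_snd.ae hle] with p h1 h2
    rw [norm_mul, norm_mul, RCLike.norm_conj, Complex.norm_real, Real.norm_of_nonneg (hK0 p)]
    have := hK0 p
    have := (norm_nonneg _).trans h1
    gcongr
  have hlin : ∀ ε : ℝ, 0 < ε → ∀ {G : Ω → ℂ}, Integrable G μ →
      ∫⁻ ξ, ‖fourierPush μ s G ξ‖ₑ ^ 2 * ENNReal.ofReal (Real.exp (-ε * ‖ξ‖ ^ 2)) =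
        ENNReal.ofReal (∫ ξ, ‖fourierPush μ s G ξ‖ ^ 2 * Real.exp (-ε * ‖ξ‖ ^ 2)) := by
    intro ε hε G hG
    rw [ofReal_integral_eq_lintegral_ofReal (integrable_norm_sq_mul_exp hs hG hε)
      (.of_forall fun ξ => by positivity)]
    congr with ξ
    rw [ENNReal.ofReal_mul (by positivity), ENNReal.ofReal_pow (norm_nonneg _), ofReal_norm]
  have hlim : ∀ ξ, Filter.Tendsto (fun n : ℕ => ‖fourierPush μ s F ξ‖ₑ ^ 2 *
      ENNReal.ofReal (Real.exp (-(1 / ((n : ℝ) + 1)) * ‖ξ‖ ^ 2))) Filter.atTop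
      (nhds (‖fourierPush μ s F ξ‖ₑ ^ 2)) := by
    intro ξ
    have h1 : Filter.Tendsto (fun n : ℕ => ENNReal.ofReal
        (Real.exp (-(1 / ((n : ℝ) + 1)) * ‖ξ‖ ^ 2))) Filter.atTop (nhds 1) := by
      have h := tendsto_one_div_add_atTop_nhds_zero_nat (𝕜 := ℝ)
      have h2 : Continuous fun t : ℝ => ENNReal.ofReal (Real.exp (-t * ‖ξ‖ ^ 2)) :=
        ENNReal.continuous_ofReal.comp (by fun_prop)
      have h3 := (h2.tendsto 0).comp h
      simp only [neg_zero, zero_mul, Real.exp_zero, ENNReal.ofReal_one] at h3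
      exact h3
    simpa using ENNReal.Tendsto.const_mul h1 (Or.inl one_ne_zero)
  calc ∫⁻ ξ, ‖fourierPush μ s F ξ‖ₑ ^ 2
      = ∫⁻ ξ, Filter.liminf (fun n : ℕ => ‖fourierPush μ s F ξ‖ₑ ^ 2 *
        ENNReal.ofReal (Real.exp (-(1 / ((n : ℝ) + 1)) * ‖ξ‖ ^ 2))) Filter.atTop := by
        congr with ξ
        exact (hlim ξ).liminf_eq.symm
    _ ≤ Filter.liminf (fun n : ℕ => ∫⁻ ξ, ‖fourierPush μ s F ξ‖ₑ ^ 2 *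
        ENNReal.ofReal (Real.exp (-(1 / ((n : ℝ) + 1)) * ‖ξ‖ ^ 2))) Filter.atTop := by
        refine lintegral_liminf_le fun n => ?_
        have := (continuous_fourierPush hs hF).measurable
        fun_prop
    _ ≤ Filter.liminf (fun n : ℕ => ∫⁻ ξ, ‖fourierPush μ s (fun y => (H y : ℂ)) ξ‖ₑ ^ 2)
        Filter.atTop := by
        refine Filter.liminf_le_liminf (.of_forall fun n => ?_)
        have hn : 0 < 1 / ((n : ℝ) + 1) := by positivity
        rw [hlin _ hn hF]
        refine (ENNReal.ofReal_le_ofReal (hreal _ hn)).trans ?_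
        rw [← hlin _ hn hHc]
        refine lintegral_mono fun ξ => mul_le_of_le_one_right zero_le ?_
        rw [ENNReal.ofReal_le_one, Real.exp_le_one_iff, neg_mul]
        exact neg_nonpos.2 (by positivity)
    _ = _ := by simp

end Domination

/-! ### Rotations of the sphere and integration by parts. -/

section Geometry

open scoped Pointwise

variable {d : ℕ}

instance : IsFiniteMeasure (surfaceMeasure d) := by
  unfold surfaceMeasure; infer_instance

/-- The action of a linear isometry on the unit sphere. -/
def sphereMap (L : Space d ≃ₗᵢ[ℝ] Space d) (ζ : Sphere d) : Sphere d :=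
  ⟨L ζ, by simp⟩

@[simp]
theorem coe_sphereMap (L : Space d ≃ₗᵢ[ℝ] Space d) (ζ : Sphere d) :
    (sphereMap L ζ : Space d) = L ζ := rfl

theorem norm_coe_sphere (ζ : Sphere d) : ‖(ζ : Space d)‖ = 1 := by simp

theorem continuous_sphereMap (L : Space d ≃ₗᵢ[ℝ] Space d) : Continuous (sphereMap L) :=
  (L.continuous.comp continuous_subtype_val).subtype_mk _

theorem measurableEmbedding_sphereMap (L : Space d ≃ₗᵢ[ℝ] Space d) :
    MeasurableEmbedding (sphereMap L) :=
  Homeomorph.measurableEmbedding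
    { toFun := sphereMap L
      invFun := sphereMap L.symm
      left_inv := fun ζ => by ext1; simp
      right_inv := fun ζ => by ext1; simp
      continuous_toFun := continuous_sphereMap L
      continuous_invFun := continuous_sphereMap L.symm }

/-- The surface measure of A is a multiple of the volume of the cone over A, and a linear isometry
carries cones to cones and preserves volume. -/
theorem measurePreserving_sphereMap (L : Space d ≃ₗᵢ[ℝ] Space d) :
    MeasurePreserving (sphereMap L) (surfaceMeasure d) (surfaceMeasure d) := by
  refine ⟨(continuous_sphereMap L).measurable, ?_⟩
  ext A hA
  have hm := (continuous_sphereMap L).measurable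
  rw [Measure.map_apply hm hA, surfaceMeasure, Measure.toSphere_apply' _ (hm hA),
    Measure.toSphere_apply' _ hA]
  congr 1
  have e : Set.Ioo (0 : ℝ) 1 • (Subtype.val '' (sphereMap L ⁻¹' A)) =
      L ⁻¹' (Set.Ioo (0 : ℝ) 1 • (Subtype.val '' A)) := by
    ext x
    simp only [Set.mem_smul, Set.mem_image, Set.mem_preimage]
    constructor
    · rintro ⟨r, hr, y, ⟨ζ, hζ, rfl⟩, rfl⟩
      exact ⟨r, hr, _, ⟨sphereMap L ζ, hζ, rfl⟩, by simp⟩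
    · rintro ⟨r, hr, y, ⟨ζ, hζ, rfl⟩, h⟩
      refine ⟨r, hr, _, ⟨sphereMap L.symm ζ, ?_, rfl⟩, ?_⟩
      · convert hζ
        ext1
        simp
      · rw [coe_sphereMap, ← map_smul, h]
        simp
  rw [e]
  exact L.measurePreserving.measure_preimage_emb L.toHomeomorph.measurableEmbedding _

theorem surfaceMeasure_hyperplane {v : Space d} (hv : v ≠ 0) :
    surfaceMeasure d {ζ | inner ℝ v (ζ : Space d) = 0} = 0 := by
  have hm : MeasurableSet {ζ : Sphere d | inner ℝ v (ζ : Space d) = 0} :=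
    (measurable_const.inner measurable_subtype_coe) (measurableSet_singleton 0)
  rw [surfaceMeasure, Measure.toSphere_apply' _ hm]
  have : volume (Set.Ioo (0 : ℝ) 1 •
      (Subtype.val '' {ζ : Sphere d | inner ℝ v (ζ : Space d) = 0})) = 0 := by
    refine measure_mono_null (t := ((LinearMap.ker (innerₗ (Space d) v) : Submodule ℝ (Space d)) :
      Set (Space d))) ?_ ?_
    · rintro x ⟨r, hr, y, ⟨ζ, hζ, rfl⟩, rfl⟩
      have : inner ℝ v (ζ : Space d) = 0 := hζ
      simp [this]
    · refine Measure.addHaar_submodule _ _ fun h => hv ?_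
      have : v ∈ LinearMap.ker (innerₗ (Space d) v) := h ▸ Submodule.mem_top
      simpa using this
  rw [this, mul_zero]

/-- The infinitesimal rotation `x ↦ ⟪u, x⟫ v - ⟪v, x⟫ u`. -/
def infRot (u v : Space d) : Space d →L[ℝ] Space d :=
  (innerSL ℝ u).smulRight v - (innerSL ℝ v).smulRight u

theorem infRot_apply (u v x : Space d) : infRot u v x = inner ℝ u x • v - inner ℝ v x • u := by
  simp [infRot]

theorem inner_infRot_self (u v x : Space d) : inner ℝ x (infRot u v x) = 0 := by
  rw [infRot_apply, inner_sub_right, inner_smul_right, inner_smul_right, real_inner_comm x u,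
    real_inner_comm x v]
  ring

theorem hasDerivAt_exp_smul_apply (A : Space d →L[ℝ] Space d) (x : Space d) (t : ℝ) :
    HasDerivAt (fun t : ℝ => NormedSpace.exp (t • A) x) (A (NormedSpace.exp (t • A) x)) t := by
  have h := hasDerivAt_exp_smul_const' (𝕂 := ℝ) A t
  exact h.clm_apply (hasDerivAt_const t x) |>.congr_deriv (by simp)

theorem exp_zero_smul_apply (A : Space d →L[ℝ] Space d) (x : Space d) :
    NormedSpace.exp ((0 : ℝ) • A) x = x := by
  rw [show (0 : ℝ) • A = 0 from ContinuousLinearMap.ext fun y => zero_smul ℝ (A y),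
    NormedSpace.exp_zero]
  rfl

/-- The derivative of ‖x(t)‖² along the flow is 2⟨x(t), A x(t)⟩ = 0. -/
theorem norm_exp_smul_apply {A : Space d →L[ℝ] Space d} (hA : ∀ x, inner ℝ x (A x) = 0)
    (x : Space d) (t : ℝ) : ‖NormedSpace.exp (t • A) x‖ = ‖x‖ := by
  have hd : ∀ t, HasDerivAt (fun t : ℝ => ‖NormedSpace.exp (t • A) x‖ ^ 2) 0 t := by
    intro t
    have h := (hasDerivAt_exp_smul_apply A x t).norm_sq
    simpa [hA] using h
  have hc := is_const_of_deriv_eq_zero (fun t => (hd t).differentiableAt)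
    (fun t => (hd t).deriv) t 0
  simp only [exp_zero_smul_apply] at hc
  exact (sq_eq_sq₀ (norm_nonneg _) (norm_nonneg _)).1 hc

/-- The rotation generated by a skew map. -/
def rotExp {A : Space d →L[ℝ] Space d} (hA : ∀ x, inner ℝ x (A x) = 0) (t : ℝ) :
    Space d ≃ₗᵢ[ℝ] Space d :=
  LinearIsometry.toLinearIsometryEquiv
    ⟨(NormedSpace.exp (t • A) : Space d →L[ℝ] Space d).toLinearMap,
      fun x => norm_exp_smul_apply hA x t⟩ rfl

/-- Integration by parts on the sphere. -/
theorem integral_fderiv_skew {A : Space d →L[ℝ] Space d} (hA : ∀ x, inner ℝ x (A x) = 0)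
    {E : Type*} [NormedAddCommGroup E] [NormedSpace ℝ E] {φ : Space d → E} (hφ : ContDiff ℝ 1 φ) :
    ∫ ζ : Sphere d, fderiv ℝ φ ζ (A ζ) ∂(surfaceMeasure d) = 0 := by
  have hcont : Continuous (fderiv ℝ φ) := hφ.continuous_fderiv one_ne_zero
  have hc2 : Continuous fun x => fderiv ℝ φ x (A x) := hcont.clm_apply A.continuous
  obtain ⟨C, hC⟩ := (isCompact_sphere (0 : Space d) 1).exists_bound_of_continuousOn hc2.continuousOn
  -- By rotation invariance the integral of φ along the flow does not depend on t; its derivative at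
  -- t = 0 is the integral in question.
  have hconst : ∀ t : ℝ, ∫ ζ : Sphere d, φ (NormedSpace.exp (t • A) (ζ : Space d))
      ∂(surfaceMeasure d) = ∫ ζ : Sphere d, φ ζ ∂(surfaceMeasure d) := by
    intro t
    have hmp := measurePreserving_sphereMap (rotExp hA t)
    exact hmp.integral_comp (measurableEmbedding_sphereMap _) fun ζ : Sphere d => φ ζ
  have hd : HasDerivAt (fun t : ℝ => ∫ ζ : Sphere d, φ (NormedSpace.exp (t • A) (ζ : Space d))
      ∂(surfaceMeasure d)) (∫ ζ : Sphere d, fderiv ℝ φ (NormedSpace.exp ((0 : ℝ) • A) (ζ : Space d))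
        (A (NormedSpace.exp ((0 : ℝ) • A) (ζ : Space d))) ∂(surfaceMeasure d)) 0 := by
    have hmeas : ∀ t : ℝ, Continuous fun ζ : Sphere d => φ (NormedSpace.exp (t • A) (ζ : Space d)) :=
      fun t => hφ.continuous.comp
        ((NormedSpace.exp (t • A) : Space d →L[ℝ] Space d).continuous.comp continuous_subtype_val)
    refine (hasDerivAt_integral_of_dominated_loc_of_deriv_le (s := Set.univ)
      (bound := fun _ => C)
      (F' := fun t ζ => fderiv ℝ φ (NormedSpace.exp (t • A) (ζ : Space d))
        (A (NormedSpace.exp (t • A) (ζ : Space d)))) Filter.univ_mem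
      (.of_forall fun t => (hmeas t).aestronglyMeasurable) ?_ ?_ ?_ (integrable_const _) ?_).2
    · exact (hmeas 0).integrable_of_hasCompactSupport (HasCompactSupport.of_compactSpace _)
    · refine Continuous.aestronglyMeasurable (hc2.comp
        ((NormedSpace.exp ((0 : ℝ) • A) : Space d →L[ℝ] Space d).continuous.comp
          continuous_subtype_val))
    · refine .of_forall fun ζ t _ => hC _ ?_
      rw [mem_sphere_zero_iff_norm, norm_exp_smul_apply hA, norm_coe_sphere]
    · refine .of_forall fun ζ t _ => ?_
      exact ((hφ.differentiable one_ne_zero).differentiableAt.hasFDerivAt).comp_hasDerivAt t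
        (hasDerivAt_exp_smul_apply A ζ t)
  simp_rw [hconst] at hd
  have := hd.unique (hasDerivAt_const _ _)
  simpa only [exp_zero_smul_apply] using this

end Geometry

/-! ### Complex exponentials on the sphere and moments of a coordinate. -/

section TestFunctions

variable {d : ℕ}

/-- The standard basis vectors. -/
abbrev bvec (i : Fin d) : Space d := EuclideanSpace.single i (1 : ℝ)

theorem inner_bvec (i : Fin d) (x : Space d) : inner ℝ (bvec i) x = x i := by
  simp [EuclideanSpace.inner_single_left]

/-- The linear form `x ↦ ∑ z_i x_i` with complex coefficients. -/
def cform (z : Fin d → ℂ) : Space d →L[ℝ] ℂ :=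
  ∑ i, z i • (Complex.ofRealCLM.comp (EuclideanSpace.proj i))

theorem cform_apply (z : Fin d → ℂ) (x : Space d) : cform z x = ∑ i, z i * (x i : ℂ) := by
  simp [cform]

theorem cform_bvec (z : Fin d → ℂ) (j : Fin d) : cform z (bvec j) = z j := by
  rw [cform_apply, Finset.sum_eq_single j]
  · simp
  · intro i _ hi
    simp [hi]
  · simp

/-- The exponential `x ↦ exp (∑ z_i x_i)` with complex frequency. -/
def pexp (z : Fin d → ℂ) (x : Space d) : ℂ := Complex.exp (cform z x)

theorem hasFDerivAt_pexp (z : Fin d → ℂ) (x : Space d) :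
    HasFDerivAt (pexp z) (pexp z x • cform z) x :=
  (cform z).hasFDerivAt.cexp

theorem contDiff_pexp (z : Fin d → ℂ) {n} : ContDiff ℝ n (pexp z) :=
  (cform z).contDiff.cexp

theorem continuous_pexp (z : Fin d → ℂ) : Continuous (pexp z) := (contDiff_pexp z (n := 0)).continuous

theorem cform_add (z z' : Fin d → ℂ) (x : Space d) : cform (z + z') x = cform z x + cform z' x := by
  simp [cform_apply, add_mul, Finset.sum_add_distrib]

theorem pexp_add (z z' : Fin d → ℂ) (x : Space d) : pexp (z + z') x = pexp z x * pexp z' x := by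
  rw [pexp, cform_add, Complex.exp_add]; rfl

/-- The frequency `-iξ`. -/
def waveFreq (ξ : Space d) : Fin d → ℂ := fun i => -(Complex.I * (ξ i : ℂ))

theorem pexp_waveFreq (ξ x : Space d) : pexp (waveFreq ξ) x = wave x ξ := by
  rw [pexp, wave, cform_apply, PiLp.inner_apply]
  congr 1
  simp only [waveFreq, RCLike.inner_apply, conj_trivial]
  push_cast
  rw [Finset.mul_sum, ← Finset.sum_neg_distrib]
  refine Finset.sum_congr rfl fun i _ => ?_
  ring

theorem cform_infRot (z : Fin d → ℂ) (j k : Fin d) (x : Space d) :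
    cform z (infRot (bvec j) (bvec k) x) = (x j : ℂ) * z k - (x k : ℂ) * z j := by
  rw [infRot_apply, map_sub, map_smul, map_smul, cform_bvec, cform_bvec, inner_bvec, inner_bvec,
    Complex.real_smul, Complex.real_smul]

theorem integral_infRot_pexp (z : Fin d → ℂ) (j k : Fin d) :
    ∫ ζ : Sphere d, (((ζ : Space d) j : ℂ) * z k - ((ζ : Space d) k : ℂ) * z j) * pexp z ζ
      ∂(surfaceMeasure d) = 0 := by
  rw [← integral_fderiv_skew (inner_infRot_self (bvec j) (bvec k)) (contDiff_pexp z)]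
  congr with ζ
  rw [(hasFDerivAt_pexp z _).fderiv, smul_apply, cform_infRot, smul_eq_mul,
    mul_comm]

theorem integrable_of_continuous_sphere {E : Type*} [NormedAddCommGroup E] {φ : Sphere d → E}
    (hφ : Continuous φ) : Integrable φ (surfaceMeasure d) :=
  hφ.integrable_of_hasCompactSupport (HasCompactSupport.of_compactSpace _)

/-- The recursion satisfied by the moments of a coordinate of a point of the sphere. -/
theorem integral_inner_pow_succ (η : Sphere d) (n : ℕ) :
    ((d : ℝ) - 1 + n) * ∫ ζ : Sphere d, (inner ℝ (η : Space d) (ζ : Space d)) ^ (n + 1)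
      ∂(surfaceMeasure d) =
    n * ∫ ζ : Sphere d, (inner ℝ (η : Space d) (ζ : Space d)) ^ (n - 1) ∂(surfaceMeasure d) := by
  have hderiv : ∀ (k : Fin d) (x : Space d),
      HasFDerivAt (fun x : Space d => x k * (inner ℝ (η : Space d) x) ^ n)
        (x k • ((n • (inner ℝ (η : Space d) x) ^ (n - 1)) • innerSL ℝ (η : Space d)) +
          ((inner ℝ (η : Space d) x) ^ n) • (EuclideanSpace.proj k : Space d →L[ℝ] ℝ)) x := by
    intro k x
    have h1 : HasFDerivAt (fun x : Space d => x k) (EuclideanSpace.proj k : Space d →L[ℝ] ℝ) x :=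
      (EuclideanSpace.proj k : Space d →L[ℝ] ℝ).hasFDerivAt
    have h2 : HasFDerivAt (fun x : Space d => inner ℝ (η : Space d) x) (innerSL ℝ (η : Space d)) x :=
      (innerSL ℝ (η : Space d)).hasFDerivAt
    exact h1.mul (h2.pow n)
  -- Integration by parts is applied to x_k⟨η,x⟩^n with the rotation field in the plane of η and
  -- e_k. With t = ⟨η,ζ⟩ and both points on the unit sphere, the sum over k of the integrands is
  -- (d-1+n)t^{n+1} - n t^{n-1}.
  have hk : ∀ k : Fin d, ∫ ζ : Sphere d, ((ζ : Space d) k *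
      (n * (inner ℝ (η : Space d) (ζ : Space d)) ^ (n - 1) *
        (inner ℝ (η : Space d) (ζ : Space d) * (η : Space d) k - (ζ : Space d) k)) +
      (inner ℝ (η : Space d) (ζ : Space d)) ^ n * (inner ℝ (η : Space d) (ζ : Space d) -
        (ζ : Space d) k * (η : Space d) k)) ∂(surfaceMeasure d) = 0 := by
    intro k
    have hsm : ContDiff ℝ 1 fun x : Space d => x k * (inner ℝ (η : Space d) x) ^ n :=
      (EuclideanSpace.proj k : Space d →L[ℝ] ℝ).contDiff.mul
        ((innerSL ℝ (η : Space d)).contDiff.pow n)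
    rw [← integral_fderiv_skew (inner_infRot_self (η : Space d) (bvec k)) hsm]
    congr with ζ
    rw [(hderiv k ζ).fderiv, infRot_apply, inner_bvec]
    have h1 : inner ℝ (η : Space d) (inner ℝ (η : Space d) (ζ : Space d) • bvec k -
        (ζ : Space d) k • (η : Space d)) =
        inner ℝ (η : Space d) (ζ : Space d) * (η : Space d) k - (ζ : Space d) k := by
      rw [inner_sub_right, inner_smul_right, inner_smul_right, real_inner_self_eq_norm_sq,
        norm_coe_sphere, real_inner_comm (bvec k) (η : Space d), inner_bvec]
      ring
    simp only [add_apply, smul_apply, innerSL_apply_apply,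
      h1, smul_eq_mul, nsmul_eq_mul]
    have h2 : (EuclideanSpace.proj k : Space d →L[ℝ] ℝ)
        (inner ℝ (η : Space d) (ζ : Space d) • bvec k - (ζ : Space d) k • (η : Space d)) =
        inner ℝ (η : Space d) (ζ : Space d) - (ζ : Space d) k * (η : Space d) k := by
      simp
    rw [h2]
  have hsum := Finset.sum_eq_zero fun k (_ : k ∈ Finset.univ) => hk k
  rw [← integral_finsetSum _ fun k _ => integrable_of_continuous_sphere (by fun_prop)] at hsum
  rw [← integral_const_mul, ← integral_const_mul, ← sub_eq_zero, ← integral_sub, ← hsum]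
  · congr with ζ
    have e1 : ∑ k, (ζ : Space d) k * (η : Space d) k = inner ℝ (η : Space d) (ζ : Space d) := by
      simp [PiLp.inner_apply]
    have e2 : ∑ k, (ζ : Space d) k * (ζ : Space d) k = 1 := by
      have := real_inner_self_eq_norm_sq (ζ : Space d)
      rw [norm_coe_sphere, PiLp.inner_apply] at this
      simpa only [RCLike.inner_apply, conj_trivial, one_pow] using this
    set t := inner ℝ (η : Space d) (ζ : Space d) with ht
    have e3 : ∀ k, (ζ : Space d) k * (n * t ^ (n - 1) * (t * (η : Space d) k - (ζ : Space d) k)) +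
        t ^ n * (t - (ζ : Space d) k * (η : Space d) k) =
        n * t ^ (n - 1) * t * ((ζ : Space d) k * (η : Space d) k) -
        n * t ^ (n - 1) * ((ζ : Space d) k * (ζ : Space d) k) + t ^ (n + 1) -
        t ^ n * ((ζ : Space d) k * (η : Space d) k) := fun k => by ring
    simp_rw [e3]
    rw [Finset.sum_sub_distrib, Finset.sum_add_distrib, Finset.sum_sub_distrib, ← Finset.mul_sum,
      ← Finset.mul_sum, ← Finset.mul_sum, e1, e2]
    simp only [Finset.sum_const, Finset.card_univ, Fintype.card_fin, nsmul_eq_mul]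
    -- For n = 0 the truncated exponent n - 1 is harmless because its coefficient n vanishes.
    rcases n with _ | n
    · simp; ring
    · simp only [Nat.add_sub_cancel]
      ring
  · exact integrable_of_continuous_sphere (by fun_prop)
  · exact integrable_of_continuous_sphere (by fun_prop)

end TestFunctions

/-! ### Rotation invariant measures are determined by radial moments. -/

section RadialUniqueness

variable {d : ℕ}

theorem exists_isometry_apply_eq {x y : Space d} (h : ‖x‖ = ‖y‖) :
    ∃ L : Space d ≃ₗᵢ[ℝ] Space d, L x = y :=
  ⟨_, Submodule.reflection_sub h⟩

theorem hasSum_integral_exp {Ω : Type*} [MeasurableSpace Ω] {μ : Measure Ω} [IsFiniteMeasure μ]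
    {X : Ω → ℝ} (hX : Measurable X) {M : ℝ} (hM : ∀ᵐ y ∂μ, |X y| ≤ M) (t : ℝ) :
    HasSum (fun n : ℕ => (t * Complex.I) ^ n / n.factorial * ((∫ y, X y ^ n ∂μ : ℝ) : ℂ))
      (∫ y, Complex.exp (t * X y * Complex.I) ∂μ) := by
  have hb : ∀ n : ℕ, ∀ᵐ y ∂μ, ‖((t * X y * Complex.I) ^ n / n.factorial : ℂ)‖ ≤
      (|t| * M) ^ n / n.factorial := by
    intro n
    filter_upwards [hM] with y hy
    simp only [norm_div, norm_pow, norm_mul, Complex.norm_real, Complex.norm_I, mul_one,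
      Real.norm_eq_abs, Complex.norm_natCast]
    gcongr
  have hmeas : ∀ n : ℕ, Measurable fun y => ((t * X y * Complex.I) ^ n / n.factorial : ℂ) := by
    intro n
    fun_prop
  have hint : ∀ n : ℕ, Integrable (fun y => ((t * X y * Complex.I) ^ n / n.factorial : ℂ)) μ :=
    fun n => (integrable_const ((|t| * M) ^ n / n.factorial)).mono' (hmeas n).aestronglyMeasurable
      (hb n)
  have hs : Summable fun n : ℕ => ∫ y, ‖((t * X y * Complex.I) ^ n / n.factorial : ℂ)‖ ∂μ := by
    refine Summable.of_nonneg_of_le (fun n => integral_nonneg fun y => norm_nonneg _) (fun n => ?_)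
      ((Real.summable_pow_div_factorial (|t| * M)).mul_right (μ.real Set.univ))
    refine (integral_mono_ae (hint n).norm (integrable_const _) (hb n)).trans (le_of_eq ?_)
    simp [mul_comm]
  have := hasSum_integral_of_summable_integral_norm hint hs
  have e1 : (fun n : ℕ => (t * Complex.I) ^ n / n.factorial * ((∫ y, X y ^ n ∂μ : ℝ) : ℂ)) =
      fun n : ℕ => ∫ y, ((t * X y * Complex.I) ^ n / n.factorial : ℂ) ∂μ := by
    ext n
    rw [← integral_complex_ofReal, ← integral_const_mul]
    congr with y
    push_cast
    ring
  have e2 : (fun y => Complex.exp (t * X y * Complex.I)) =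
      fun y => ∑' n : ℕ, ((t * X y * Complex.I) ^ n / n.factorial : ℂ) := by
    ext y
    rw [Complex.exp_eq_exp_ℂ, NormedSpace.exp_eq_tsum_div]
  rw [e1, e2]
  exact this

/-- For bounded variables the exponential series may be integrated term by term, so the moments
determine the characteristic function. -/
theorem map_eq_of_moments {Ω Ω' : Type*} [MeasurableSpace Ω] [MeasurableSpace Ω'] {μ : Measure Ω}
    {ν : Measure Ω'} [IsFiniteMeasure μ] [IsFiniteMeasure ν] {X : Ω → ℝ} {Y : Ω' → ℝ}
    (hX : Measurable X) (hY : Measurable Y) {M : ℝ} (hXM : ∀ᵐ y ∂μ, |X y| ≤ M)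
    (hYM : ∀ᵐ y ∂ν, |Y y| ≤ M) (h : ∀ n : ℕ, ∫ y, X y ^ n ∂μ = ∫ y, Y y ^ n ∂ν) :
    μ.map X = ν.map Y := by
  refine Measure.ext_of_charFun (funext fun t => ?_)
  rw [charFun_apply_real, charFun_apply_real, integral_map hX.aemeasurable (by fun_prop),
    integral_map hY.aemeasurable (by fun_prop)]
  have h1 := hasSum_integral_exp hX hXM t
  simp_rw [h] at h1
  exact h1.unique (hasSum_integral_exp hY hYM t)

theorem charFun_map_isometry {μ : Measure (Space d)} (hμ : ∀ L : Space d ≃ₗᵢ[ℝ] Space d,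
    μ.map L = μ) (L : Space d ≃ₗᵢ[ℝ] Space d) (t : Space d) :
    charFun μ (L t) = charFun μ t := by
  conv_lhs => rw [← hμ L]
  rw [charFun_apply, charFun_apply, integral_map L.continuous.measurable.aemeasurable (by fun_prop)]
  simp

/-- The average over the sphere of the characters of frequency `r`. -/
def sphereAvg (r : ℝ) (x : Space d) : ℂ :=
  ∫ u : Sphere d, Complex.exp (((inner ℝ x (r • (u : Space d)) : ℝ) : ℂ) * Complex.I)
    ∂(surfaceMeasure d)

theorem norm_cexp_mul_I_le (t : ℝ) : ‖Complex.exp ((t : ℂ) * Complex.I)‖ ≤ 1 :=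
  (Complex.norm_exp_ofReal_mul_I t).le

theorem continuous_sphereAvg (r : ℝ) : Continuous (sphereAvg (d := d) r) := by
  refine continuous_of_dominated (bound := fun _ => 1) (fun x => ?_) (fun x => ?_)
    (integrable_const _) ?_
  · exact Continuous.aestronglyMeasurable (by fun_prop)
  · exact .of_forall fun u => norm_cexp_mul_I_le _
  · exact .of_forall fun u => by fun_prop

theorem sphereAvg_eq_of_norm_eq (r : ℝ) {x y : Space d} (h : ‖x‖ = ‖y‖) :
    sphereAvg r x = sphereAvg r y := by
  obtain ⟨L, rfl⟩ := exists_isometry_apply_eq h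
  have := (measurePreserving_sphereMap L).integral_comp (measurableEmbedding_sphereMap L)
    fun u : Sphere d => Complex.exp (((inner ℝ (L x) (r • (u : Space d)) : ℝ) : ℂ) * Complex.I)
  rw [sphereAvg, sphereAvg, ← this]
  simp [inner_smul_right]

/-- The characteristic function of an invariant measure depends on ‖t‖ only, so it can be averaged
over directions. After Fubini the integrand is a function of ‖x‖ alone (`sphereAvg_eq_of_norm_eq`).
-/
theorem charFun_eq_sphereAvg {μ : Measure (Space d)} [IsFiniteMeasure μ]
    (hμ : ∀ L : Space d ≃ₗᵢ[ℝ] Space d, μ.map L = μ) (t : Space d) :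
    (surfaceMeasure d).real Set.univ * charFun μ t = ∫ x, sphereAvg ‖t‖ x ∂μ := by
  have h1 : ∀ u : Sphere d, charFun μ (‖t‖ • (u : Space d)) = charFun μ t := by
    intro u
    obtain ⟨L, hL⟩ := exists_isometry_apply_eq (x := t) (y := ‖t‖ • (u : Space d))
      (by simp [norm_smul])
    rw [← hL, charFun_map_isometry hμ]
  have h2 : ∫ u : Sphere d, charFun μ (‖t‖ • (u : Space d)) ∂(surfaceMeasure d) =
      (surfaceMeasure d).real Set.univ * charFun μ t := by
    simp [h1]
  rw [← h2]
  simp only [charFun_apply, sphereAvg]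
  rw [integral_integral_swap]
  refine (integrable_const (1 : ℝ)).mono' ?_ (.of_forall fun p => norm_cexp_mul_I_le _)
  refine Measurable.aestronglyMeasurable ?_
  simp only [Function.uncurry_def]
  have : Measurable fun p : Sphere d × Space d => inner ℝ p.2 (‖t‖ • (p.1 : Space d)) := by
    have h3 : Measurable fun p : Sphere d × Space d => (p.1 : Space d) :=
      measurable_subtype_coe.comp measurable_fst
    exact measurable_snd.inner (h3.const_smul ‖t‖)
  fun_prop

theorem surfaceMeasure_univ_ne_zero (hd : d ≠ 0) : surfaceMeasure d Set.univ ≠ 0 := by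
  have : Nonempty (Fin d) := ⟨⟨0, Nat.pos_of_ne_zero hd⟩⟩
  have : Nontrivial (Space d) := inferInstance
  rw [Measure.measure_univ_ne_zero]
  exact Measure.toSphere_ne_zero _

/-- Two rotation invariant finite measures with bounded support whose radial moments agree
coincide. -/
theorem measure_ext_of_radial_moments (hd : d ≠ 0) {μ ν : Measure (Space d)} [IsFiniteMeasure μ]
    [IsFiniteMeasure ν] (hμ : ∀ L : Space d ≃ₗᵢ[ℝ] Space d, μ.map L = μ)
    (hν : ∀ L : Space d ≃ₗᵢ[ℝ] Space d, ν.map L = ν)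
    (hμ2 : ∀ᵐ x ∂μ, ‖x‖ ≤ 2) (hν2 : ∀ᵐ x ∂ν, ‖x‖ ≤ 2)
    (h : ∀ n : ℕ, ∫ x, (‖x‖ ^ 2 / 2 - 1) ^ n ∂μ = ∫ x, (‖x‖ ^ 2 / 2 - 1) ^ n ∂ν) : μ = ν := by
  have hm : Measurable fun x : Space d => ‖x‖ ^ 2 / 2 - 1 := by fun_prop
  have hb : ∀ x : Space d, ‖x‖ ≤ 2 → |‖x‖ ^ 2 / 2 - 1| ≤ 1 := by
    intro x hx
    rw [abs_le]
    constructor <;> nlinarith [norm_nonneg x]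
  have hmap := map_eq_of_moments hm hm (hμ2.mono hb) (hν2.mono hb) h
  refine Measure.ext_of_charFun (funext fun t => ?_)
  have h0 : ((surfaceMeasure d).real Set.univ : ℂ) ≠ 0 := by
    have := surfaceMeasure_univ_ne_zero hd
    exact Complex.ofReal_ne_zero.2 (ENNReal.toReal_ne_zero.2 ⟨this, measure_ne_top _ _⟩)
  refine mul_left_cancel₀ h0 ?_
  rw [charFun_eq_sphereAvg hμ, charFun_eq_sphereAvg hν]
  set e : Space d := bvec ⟨0, Nat.pos_of_ne_zero hd⟩ with he
  -- The averaged character is a continuous function of τ = ‖x‖²/2 - 1, a variable with values in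
  -- [-1,1] on the ball of radius 2, whose law the moments determine. This variable is chosen
  -- because τ = ⟨ζ,η⟩ when x = ζ + η with unit vectors ζ and η.
  have hG : ∀ x : Space d, sphereAvg ‖t‖ x =
      sphereAvg ‖t‖ (Real.sqrt (2 * (‖x‖ ^ 2 / 2 - 1) + 2) • e) := by
    intro x
    refine sphereAvg_eq_of_norm_eq _ ?_
    rw [show 2 * (‖x‖ ^ 2 / 2 - 1) + 2 = ‖x‖ ^ 2 by ring, Real.sqrt_sq (norm_nonneg x), norm_smul,
      he, PiLp.norm_single, norm_norm, norm_one, mul_one]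
  have hGm : Continuous fun τ : ℝ => sphereAvg ‖t‖ (Real.sqrt (2 * τ + 2) • e) :=
    (continuous_sphereAvg ‖t‖).comp (by fun_prop)
  rw [integral_congr_ae (μ := μ) (.of_forall hG), integral_congr_ae (μ := ν) (.of_forall hG)]
  rw [← integral_map (φ := fun x : Space d => ‖x‖ ^ 2 / 2 - 1) hm.aemeasurable
    hGm.aestronglyMeasurable, hmap, integral_map hm.aemeasurable hGm.aestronglyMeasurable]

end RadialUniqueness

/-! ### The explicit radial density r⁻¹(4-r²)^{(d-3)/2} and its moments. -/

section Profile

/-- The radial profile of the density of `σ ∗ σ`. -/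
def profile (d : ℕ) (r : ℝ) : ℝ :=
  if r < 2 then r⁻¹ * (4 - r ^ 2) ^ (((d : ℝ) - 3) / 2) else 0

theorem measurable_profile (d : ℕ) : Measurable (profile d) := by
  unfold profile
  exact Measurable.ite measurableSet_Iio (by fun_prop) measurable_const

theorem profile_nonneg {d : ℕ} {r : ℝ} (hr : 0 ≤ r) : 0 ≤ profile d r := by
  unfold profile
  split_ifs with h
  · have : 0 ≤ 4 - r ^ 2 := by nlinarith
    positivity
  · exact le_rfl

theorem four_sub_sq_rpow {r : ℝ} (h0 : 0 ≤ r) (h2 : r ≤ 2) (a : ℝ) :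
    (4 - r ^ 2) ^ a = (2 + r) ^ a * (2 - r) ^ a := by
  rw [← Real.mul_rpow (by linarith) (by linarith)]
  ring_nf

theorem intervalIntegrable_two_sub_rpow {a : ℝ} (ha : -1 < a) (l : ℝ) :
    IntervalIntegrable (fun r : ℝ => (2 - r) ^ a) volume l 2 := by
  have h := (intervalIntegral.intervalIntegrable_rpow' (a := 2 - l) (b := 0) ha).comp_sub_left 2
  simpa using h

/-- The weight `r^{d-2} (4-r²)^{(d-3)/2}`. -/
def radialWeight (d : ℕ) (r : ℝ) : ℝ := r ^ (d - 2) * (4 - r ^ 2) ^ (((d : ℝ) - 3) / 2)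

/-- For d = 2 the weight blows up at r = 2. The singular factor is (2-r)^{(d-3)/2}, of exponent at
least -1/2, and the remaining factors are continuous on [0,2]. -/
theorem intervalIntegrable_radialWeight_mul {d : ℕ} (hd : 2 ≤ d) {g : ℝ → ℝ} (hg : Continuous g) :
    IntervalIntegrable (fun r => g r * radialWeight d r) volume 0 2 := by
  have hd' : (2 : ℝ) ≤ d := by exact_mod_cast hd
  have h := (intervalIntegrable_two_sub_rpow (a := ((d : ℝ) - 3) / 2) (by linarith) 0).continuousOn_mul
    (g := fun r => g r * (r ^ (d - 2) * (2 + r) ^ (((d : ℝ) - 3) / 2))) ?_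
  · refine h.congr fun r hr => ?_
    rw [Set.uIoc_of_le zero_le_two] at hr
    simp only [radialWeight]
    rw [four_sub_sq_rpow hr.1.le hr.2]
    ring
  · refine hg.continuousOn.mul ((continuousOn_id.pow _).mul ?_)
    refine ContinuousOn.rpow_const (by fun_prop) fun r hr => Or.inl ?_
    rw [Set.uIcc_of_le zero_le_two] at hr
    linarith [hr.1]

/-- Integrate over [0,2] the derivative of τ^n r^{d-1}(4-r²)^{(d-1)/2}, where τ = r²/2 - 1; the
function vanishes at both ends, and r²(4-r²) = 4(1-τ²). The recursion obtained is the one satisfied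
by the moments of ⟨η,ζ⟩ on the sphere. -/
theorem radialWeight_recursion {d : ℕ} (hd : 2 ≤ d) (n : ℕ) :
    ((d : ℝ) - 1 + n) * ∫ r in (0 : ℝ)..2, (r ^ 2 / 2 - 1) ^ (n + 1) * radialWeight d r =
      n * ∫ r in (0 : ℝ)..2, (r ^ 2 / 2 - 1) ^ (n - 1) * radialWeight d r := by
  have hd' : (2 : ℝ) ≤ d := by exact_mod_cast hd
  have hderiv : ∀ r ∈ Set.Ioo (0 : ℝ) 2, HasDerivAt
      (fun r : ℝ => (r ^ 2 / 2 - 1) ^ n * (r ^ (d - 1) * (4 - r ^ 2) ^ (((d : ℝ) - 1) / 2)))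
      (4 * ((n * (r ^ 2 / 2 - 1) ^ (n - 1) * (1 - (r ^ 2 / 2 - 1) ^ 2) -
        ((d : ℝ) - 1) * (r ^ 2 / 2 - 1) ^ (n + 1)) * radialWeight d r)) r := by
    intro r hr
    have hpos : 0 < 4 - r ^ 2 := by nlinarith [hr.1, hr.2]
    have h1 : HasDerivAt (fun r : ℝ => r ^ 2 / 2 - 1) r r := by
      have := ((hasDerivAt_pow 2 r).div_const 2).sub_const 1
      simpa using this
    have h2 : HasDerivAt (fun r : ℝ => 4 - r ^ 2) (-(2 * r)) r := by
      simpa using (hasDerivAt_pow 2 r).const_sub 4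
    have h3 := h2.rpow_const (p := ((d : ℝ) - 1) / 2) (Or.inl hpos.ne')
    refine ((h1.pow n).mul ((hasDerivAt_pow (d - 1) r).mul h3)).congr_deriv ?_
    obtain ⟨m, rfl⟩ : ∃ m, d = m + 2 := ⟨d - 2, by omega⟩
    have e1 : (4 - r ^ 2) ^ (((m + 2 : ℕ) : ℝ) / 2 - 1 / 2) =
        (4 - r ^ 2) ^ ((((m + 2 : ℕ) : ℝ) - 3) / 2) * (4 - r ^ 2) := by
      rw [← Real.rpow_add_one hpos.ne']
      ring_nf
    have e2 : (((m + 2 : ℕ) : ℝ) - 1) / 2 = ((m + 2 : ℕ) : ℝ) / 2 - 1 / 2 := by ring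
    have e3 : (((m + 2 : ℕ) : ℝ) - 1) / 2 - 1 = (((m + 2 : ℕ) : ℝ) - 3) / 2 := by ring
    simp only [Pi.mul_apply, Pi.pow_apply]
    rw [e3, e2, e1]
    simp only [radialWeight, show m + 2 - 1 = m + 1 from rfl, show m + 2 - 2 = m from rfl,
      show m + 1 - 1 = m from rfl]
    push_cast
    rcases n with _ | n
    · simp
      ring
    · simp only [Nat.add_sub_cancel]
      push_cast
      ring
  have hint : IntervalIntegrable (fun r : ℝ => 4 * ((n * (r ^ 2 / 2 - 1) ^ (n - 1) *
      (1 - (r ^ 2 / 2 - 1) ^ 2) - ((d : ℝ) - 1) * (r ^ 2 / 2 - 1) ^ (n + 1)) * radialWeight d r))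
      volume 0 2 :=
    (intervalIntegrable_radialWeight_mul hd (by fun_prop)).const_mul 4
  have hftc := intervalIntegral.integral_eq_sub_of_hasDerivAt_of_le zero_le_two ?_ hderiv hint
  · have hd1 : d - 1 ≠ 0 := by omega
    have hd2 : ((d : ℝ) - 1) / 2 ≠ 0 := by
      have : 0 < ((d : ℝ) - 1) / 2 := by linarith
      exact this.ne'
    norm_num [hd1, hd2] at hftc
    have e : ∀ r : ℝ, (n * (r ^ 2 / 2 - 1) ^ (n - 1) * (1 - (r ^ 2 / 2 - 1) ^ 2) -
        ((d : ℝ) - 1) * (r ^ 2 / 2 - 1) ^ (n + 1)) * radialWeight d r =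
        n * ((r ^ 2 / 2 - 1) ^ (n - 1) * radialWeight d r) -
        ((d : ℝ) - 1 + n) * ((r ^ 2 / 2 - 1) ^ (n + 1) * radialWeight d r) := by
      intro r
      rcases n with _ | n
      · simp; ring
      · simp only [Nat.add_sub_cancel]; ring
    simp_rw [e] at hftc
    rw [intervalIntegral.integral_sub, intervalIntegral.integral_const_mul,
      intervalIntegral.integral_const_mul] at hftc
    · linarith
    · exact (intervalIntegrable_radialWeight_mul hd (by fun_prop)).const_mul _
    · exact (intervalIntegrable_radialWeight_mul hd (by fun_prop)).const_mul _
  · refine ContinuousOn.mul (by fun_prop) (ContinuousOn.mul (by fun_prop) ?_)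
    exact ContinuousOn.rpow_const (by fun_prop) fun r _ => Or.inr (by linarith)

theorem pow_mul_profile {d : ℕ} (hd : 2 ≤ d) {r : ℝ} (h0 : 0 < r) (h2 : r < 2) :
    r ^ (d - 1) * profile d r = radialWeight d r := by
  obtain ⟨m, rfl⟩ : ∃ m, d = m + 2 := ⟨d - 2, by omega⟩
  simp only [profile, h2, if_true, radialWeight, show m + 2 - 1 = m + 1 from rfl,
    show m + 2 - 2 = m from rfl, pow_succ]
  field_simp

variable {d : ℕ}

instance nontrivial_space [NeZero d] : Nontrivial (Space d) :=
  have : Nonempty (Fin d) := ⟨0⟩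
  inferInstance

/-- The radial density, up to a constant, of `σ ∗ σ`. -/
def radialDensity (d : ℕ) (x : Space d) : ℝ≥0∞ := ENNReal.ofReal (profile d ‖x‖)

theorem measurable_radialDensity (d : ℕ) : Measurable (radialDensity d) :=
  ((measurable_profile d).comp measurable_norm).ennreal_ofReal

theorem integrableOn_Ioi_mul_profile (hd : 2 ≤ d) {g : ℝ → ℝ} (hg : Continuous g) :
    IntegrableOn (fun y : ℝ => y ^ (d - 1) • (g y * profile d y)) (Set.Ioi 0) := by
  have h1 := intervalIntegrable_radialWeight_mul hd hg
  rw [intervalIntegrable_iff_integrableOn_Ioo_of_le zero_le_two] at h1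
  have h2 : IntegrableOn (fun y : ℝ => y ^ (d - 1) • (g y * profile d y)) (Set.Ioo 0 2) := by
    refine h1.congr_fun (fun y hy => ?_) measurableSet_Ioo
    simp only [smul_eq_mul]
    rw [← pow_mul_profile hd hy.1 hy.2]
    ring
  refine h2.of_forall_sdiff_eq_zero measurableSet_Ioi fun y hy => ?_
  have : ¬ y < 2 := fun h => hy.2 ⟨hy.1, h⟩
  simp [profile, this]

theorem integrable_mul_profile (hd : 2 ≤ d) {g : ℝ → ℝ} (hg : Continuous g) :
    Integrable fun x : Space d => g ‖x‖ * profile d ‖x‖ := by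
  have : NeZero d := ⟨by omega⟩
  rw [integrable_fun_norm_addHaar (volume : Measure (Space d)) (f := fun r => g r * profile d r)]
  simpa using integrableOn_Ioi_mul_profile hd hg

theorem integral_mul_profile (hd : 2 ≤ d) (g : ℝ → ℝ) :
    ∫ x : Space d, g ‖x‖ * profile d ‖x‖ =
      (d * volume.real (Metric.ball (0 : Space d) 1)) *
        ∫ r in (0 : ℝ)..2, g r * radialWeight d r := by
  have : NeZero d := ⟨by omega⟩
  rw [integral_fun_norm_addHaar (volume : Measure (Space d)) (fun r => g r * profile d r)]
  simp only [finrank_euclideanSpace, Fintype.card_fin, nsmul_eq_mul, smul_eq_mul, mul_assoc]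
  congr 2
  have h : ∫ y in Set.Ioi (0 : ℝ), y ^ (d - 1) * (g y * profile d y) =
      ∫ y in Set.Ioo (0 : ℝ) 2, y ^ (d - 1) * (g y * profile d y) := by
    refine setIntegral_eq_of_subset_of_forall_sdiff_eq_zero measurableSet_Ioi
      Set.Ioo_subset_Ioi_self fun y hy => ?_
    have : ¬ y < 2 := fun h => hy.2 ⟨hy.1, h⟩
    simp [profile, this]
  rw [intervalIntegral.integral_of_le zero_le_two, integral_Ioc_eq_integral_Ioo, h]
  refine setIntegral_congr_fun measurableSet_Ioo fun y hy => ?_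
  rw [← pow_mul_profile hd hy.1 hy.2]
  ring

theorem isFiniteMeasure_radialDensity (hd : 2 ≤ d) :
    IsFiniteMeasure (volume.withDensity (radialDensity d)) :=
  isFiniteMeasure_withDensity_ofReal
    (by simpa using (integrable_mul_profile (d := d) hd (g := fun _ => 1) continuous_const).2)

theorem integral_radialDensity (hd : 2 ≤ d) (g : ℝ → ℝ) :
    ∫ x : Space d, g ‖x‖ ∂(volume.withDensity (radialDensity d)) =
      (d * volume.real (Metric.ball (0 : Space d) 1)) *
        ∫ r in (0 : ℝ)..2, g r * radialWeight d r := by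
  rw [← integral_mul_profile hd, integral_withDensity_eq_integral_toReal_smul
    (measurable_radialDensity d) (.of_forall fun x => ENNReal.ofReal_lt_top)]
  congr with x
  rw [radialDensity, ENNReal.toReal_ofReal (profile_nonneg (norm_nonneg x)), smul_eq_mul, mul_comm]

theorem radialDensity_norm_le (d : ℕ) :
    ∀ᵐ x ∂(volume.withDensity (radialDensity d)), ‖x‖ ≤ 2 := by
  rw [ae_withDensity_iff (measurable_radialDensity d)]
  refine .of_forall fun x hx => ?_
  by_contra! h
  exact hx (by simp [radialDensity, profile, h.not_gt])

theorem radialDensity_map_isometry (L : Space d ≃ₗᵢ[ℝ] Space d) :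
    (volume.withDensity (radialDensity d)).map L = volume.withDensity (radialDensity d) := by
  ext A hA
  have hL : Measurable L := L.continuous.measurable
  rw [Measure.map_apply hL hA, withDensity_apply _ (hL hA), withDensity_apply _ hA]
  have h1 : ∀ x, radialDensity d x = radialDensity d (L x) := fun x => by simp [radialDensity]
  rw [setLIntegral_congr_fun (hL hA) fun x _ => h1 x]
  rw [← setLIntegral_map hA (measurable_radialDensity d) hL, L.measurePreserving.map_eq]

end Profile

/-! ### Sums of independent points of the sphere and the density of σ ∗ σ. -/

section Sums

variable {d k : ℕ}

/-- The product surface measure on `k`-tuples of points of the sphere. -/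
abbrev sphPi (d k : ℕ) : Measure (Fin k → Sphere d) := Measure.pi fun _ => surfaceMeasure d

/-- The sum of a tuple of points of the sphere. -/
def vsum (ζ : Fin k → Sphere d) : Space d := ∑ i, (ζ i : Space d)

@[fun_prop]
theorem continuous_vsum : Continuous (vsum (d := d) (k := k)) := by
  unfold vsum
  fun_prop

@[fun_prop]
theorem measurable_vsum : Measurable (vsum (d := d) (k := k)) := by
  unfold vsum
  exact Finset.measurable_sum _ fun i _ => measurable_subtype_coe.comp (measurable_pi_apply i)

theorem norm_vsum_le (ζ : Fin k → Sphere d) : ‖vsum ζ‖ ≤ k := by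
  refine (norm_sum_le _ _).trans ?_
  simp

theorem measurePreserving_sphPi (L : Space d ≃ₗᵢ[ℝ] Space d) :
    MeasurePreserving (fun (ζ : Fin k → Sphere d) i => sphereMap L (ζ i)) (sphPi d k) (sphPi d k) :=
  measurePreserving_pi _ _ fun _ => measurePreserving_sphereMap L

theorem vsum_sphereMap (L : Space d ≃ₗᵢ[ℝ] Space d) (ζ : Fin k → Sphere d) :
    vsum (fun i => sphereMap L (ζ i)) = L (vsum ζ) := by
  simp [vsum]

theorem map_vsum_isometry (L : Space d ≃ₗᵢ[ℝ] Space d) :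
    ((sphPi d k).map vsum).map L = (sphPi d k).map vsum := by
  rw [Measure.map_map L.continuous.measurable measurable_vsum]
  conv_rhs => rw [← (measurePreserving_sphPi L).map_eq, Measure.map_map measurable_vsum
    (measurePreserving_sphPi L).measurable]
  congr 1
  ext1 ζ
  exact (vsum_sphereMap L ζ).symm

theorem vsum_cons (η : Sphere d) (ζ : Fin k → Sphere d) :
    vsum (Fin.cons η ζ : Fin (k + 1) → Sphere d) = η + vsum ζ := by
  simp [vsum, Fin.sum_univ_succ]

theorem measurePreserving_finCons (d k : ℕ) :
    MeasurePreserving (fun p : Sphere d × (Fin k → Sphere d) =>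
      (Fin.cons p.1 p.2 : Fin (k + 1) → Sphere d)) ((surfaceMeasure d).prod (sphPi d k))
      (sphPi d (k + 1)) := by
  have h := (measurePreserving_piFinSuccAbove (fun _ : Fin (k + 1) => surfaceMeasure d) 0).symm
  convert h using 1
  ext1 p
  exact (Fin.insertNth_zero' p.1 p.2).symm

theorem lintegral_sphPi_succ {g : (Fin (k + 1) → Sphere d) → ℝ≥0∞} (hg : Measurable g) :
    ∫⁻ ζ, g ζ ∂(sphPi d (k + 1)) =
      ∫⁻ η, ∫⁻ ζ, g (Fin.cons η ζ) ∂(sphPi d k) ∂(surfaceMeasure d) := by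
  rw [← (measurePreserving_finCons d k).lintegral_comp hg]
  exact lintegral_prod _ (hg.comp (measurePreserving_finCons d k).measurable).aemeasurable

theorem sphPi_ae_succ {p : (Fin (k + 1) → Sphere d) → Prop}
    (hp : ∀ᵐ ζ ∂(sphPi d (k + 1)), p ζ) :
    ∀ᵐ η ∂(surfaceMeasure d), ∀ᵐ ζ ∂(sphPi d k), p (Fin.cons η ζ) := by
  exact Measure.ae_ae_of_ae_prod ((measurePreserving_finCons d k).quasiMeasurePreserving.ae hp)

/-- For unit vectors ‖η+ζ‖²/2 - 1 = ⟨η,ζ⟩, so the radial moments of σ ∗ σ are moments of an inner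
product. -/
theorem integral_norm_vsum_two (n : ℕ) :
    ∫ x, (‖x‖ ^ 2 / 2 - 1) ^ n ∂((sphPi d 2).map vsum) =
      ∫ η : Sphere d, ∫ ζ : Sphere d, (inner ℝ (η : Space d) (ζ : Space d)) ^ n
        ∂(surfaceMeasure d) ∂(surfaceMeasure d) := by
  rw [integral_map measurable_vsum.aemeasurable (by fun_prop)]
  have h := measurePreserving_piFinTwo (fun _ : Fin 2 => surfaceMeasure d)
  have e : ∀ ζ : Fin 2 → Sphere d, (‖vsum ζ‖ ^ 2 / 2 - 1) ^ n =
      (fun p : Sphere d × Sphere d => (inner ℝ (p.1 : Space d) (p.2 : Space d)) ^ n)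
        (MeasurableEquiv.piFinTwo (fun _ => Sphere d) ζ) := by
    intro ζ
    simp only [vsum, Fin.sum_univ_two, MeasurableEquiv.piFinTwo_apply]
    rw [norm_add_sq_real, norm_coe_sphere, norm_coe_sphere]
    ring
  rw [integral_congr_ae (.of_forall e)]
  refine (h.integral_comp (MeasurableEquiv.measurableEmbedding _)
    (fun p : Sphere d × Sphere d => (inner ℝ (p.1 : Space d) (p.2 : Space d)) ^ n)).trans ?_
  exact integral_prod _ ((show Continuous fun p : Sphere d × Sphere d =>
    (inner ℝ (p.1 : Space d) (p.2 : Space d)) ^ n by fun_prop).integrable_of_hasCompactSupport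
      (HasCompactSupport.of_compactSpace _))

/-- The recursion has step two, and at n = 0 it forces the first moment to vanish. Hence the zeroth
moment determines the whole sequence. -/
theorem proportional_of_recursion {a b : ℕ → ℝ} {t : ℝ} (ht : 0 < t)
    (ha : ∀ n : ℕ, (t + n) * a (n + 1) = n * a (n - 1))
    (hb : ∀ n : ℕ, (t + n) * b (n + 1) = n * b (n - 1)) (n : ℕ) : a n * b 0 = b n * a 0 := by
  induction n using Nat.strong_induction_on with
  | _ n ih =>
    rcases n with _ | _ | n
    · ring
    · have h1 := ha 0
      have h2 := hb 0
      simp only [Nat.cast_zero, add_zero, zero_mul, zero_add, mul_eq_zero, ht.ne', false_or] at h1 h2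
      simp [h1, h2]
    · have h1 := ha (n + 1)
      have h2 := hb (n + 1)
      have h3 := ih n (by omega)
      simp only [Nat.add_sub_cancel] at h1 h2
      have h4 : t + ((n + 1 : ℕ) : ℝ) ≠ 0 := by positivity
      refine mul_left_cancel₀ h4 ?_
      rw [← mul_assoc, ← mul_assoc, h1, h2, mul_assoc, mul_assoc, h3]

theorem radialWeight_integral_pos (hd : 2 ≤ d) : 0 < ∫ r in (0 : ℝ)..2, radialWeight d r := by
  refine intervalIntegral.intervalIntegral_pos_of_pos_on ?_ (fun r hr => ?_) zero_lt_two
  · simpa using intervalIntegrable_radialWeight_mul hd (g := fun _ => 1) continuous_const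
  · have h0 := hr.1
    have : 0 < 4 - r ^ 2 := by nlinarith [hr.1, hr.2]
    unfold radialWeight
    positivity

/-- The density of `σ ∗ σ`. -/
theorem exists_map_vsum_two_eq (hd : 2 ≤ d) : ∃ c : ℝ≥0∞, c ≠ ∞ ∧
    (sphPi d 2).map vsum = volume.withDensity fun x => c * radialDensity d x := by
  have hd' : (2 : ℝ) ≤ d := by exact_mod_cast hd
  have : NeZero d := ⟨by omega⟩
  have hfin := isFiniteMeasure_radialDensity hd
  set D := volume.withDensity (radialDensity d) with hD
  set a : ℕ → ℝ := fun n => ∫ x, (‖x‖ ^ 2 / 2 - 1) ^ n ∂((sphPi d 2).map vsum) with ha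
  set b : ℕ → ℝ := fun n => ∫ x, (‖x‖ ^ 2 / 2 - 1) ^ n ∂D with hb
  have hball : 0 < d * volume.real (Metric.ball (0 : Space d) 1) := by
    have h1 : 0 < volume.real (Metric.ball (0 : Space d) 1) :=
      ENNReal.toReal_pos (Metric.measure_ball_pos _ _ one_pos).ne' measure_ball_lt_top.ne
    positivity
  have hbn : ∀ n, b n = (d * volume.real (Metric.ball (0 : Space d) 1)) *
      ∫ r in (0 : ℝ)..2, (r ^ 2 / 2 - 1) ^ n * radialWeight d r := fun n =>
    integral_radialDensity hd fun r => (r ^ 2 / 2 - 1) ^ n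
  have hb0 : 0 < b 0 := by
    rw [hbn]
    have := radialWeight_integral_pos hd
    simp only [pow_zero, one_mul]
    positivity
  have hbr : ∀ n : ℕ, ((d : ℝ) - 1 + n) * b (n + 1) = n * b (n - 1) := by
    intro n
    rw [hbn, hbn, mul_left_comm, radialWeight_recursion hd]
    ring
  have har : ∀ n : ℕ, ((d : ℝ) - 1 + n) * a (n + 1) = n * a (n - 1) := by
    intro n
    simp only [ha, integral_norm_vsum_two]
    rw [← integral_const_mul, ← integral_const_mul]
    congr with η
    exact integral_inner_pow_succ η n
  have hab := proportional_of_recursion (by linarith) har hbr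
  have ha0 : 0 ≤ a 0 := by simp [ha]
  -- Both moment sequences satisfy the recursion with parameter d - 1 > 0, so they are proportional.
  -- The constant is the ratio of the total masses; its value plays no role later.
  refine ⟨ENNReal.ofReal (a 0 / b 0), ENNReal.ofReal_ne_top, ?_⟩
  have hsm : (volume.withDensity fun x => ENNReal.ofReal (a 0 / b 0) * radialDensity d x) =
      ENNReal.ofReal (a 0 / b 0) • D := by
    rw [hD, ← withDensity_smul _ (measurable_radialDensity d)]
    rfl
  rw [hsm]
  have hfin2 : IsFiniteMeasure (ENNReal.ofReal (a 0 / b 0) • D) :=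
    Measure.smul_finite D ENNReal.ofReal_ne_top
  refine measure_ext_of_radial_moments (NeZero.ne d) map_vsum_isometry (fun L => ?_) ?_ ?_
    fun n => ?_
  · rw [Measure.map_smul, radialDensity_map_isometry]
  · rw [ae_map_iff measurable_vsum.aemeasurable (measurableSet_le measurable_norm measurable_const)]
    exact .of_forall fun ζ => by simpa using norm_vsum_le ζ
  · exact Measure.ae_smul_measure (radialDensity_norm_le d) _
  · rw [integral_smul_measure, ENNReal.toReal_ofReal (by positivity), smul_eq_mul]
    have := hab n
    change a n = _ * b n
    field_simp
    linarith

/-- The push-forward of the product surface measure under summation has an `L²` density. -/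
def HasL2Density (d k : ℕ) : Prop :=
  ∃ w : Space d → ℝ≥0∞, Measurable w ∧ (sphPi d k).map vsum = volume.withDensity w ∧
    ∫⁻ x, w x ^ 2 ≠ ∞

theorem sq_lintegral_le {α : Type*} [MeasurableSpace α] (μ : Measure α) {f : α → ℝ≥0∞}
    (hf : AEMeasurable f μ) : (∫⁻ x, f x ∂μ) ^ 2 ≤ μ Set.univ * ∫⁻ x, f x ^ 2 ∂μ := by
  have h := ENNReal.lintegral_mul_le_Lp_mul_Lq μ Real.HolderConjugate.two_two hf
    (aemeasurable_const (b := 1))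
  simp only [Pi.mul_apply, mul_one, ENNReal.one_rpow, lintegral_const, one_mul] at h
  calc (∫⁻ x, f x ∂μ) ^ 2 ≤ ((∫⁻ x, f x ^ (2 : ℝ) ∂μ) ^ (1 / 2 : ℝ) *
        μ Set.univ ^ (1 / 2 : ℝ)) ^ 2 := by gcongr
    _ = _ := by
      rw [mul_pow, ← ENNReal.rpow_natCast, ← ENNReal.rpow_mul, ← ENNReal.rpow_natCast,
        ← ENNReal.rpow_mul]
      norm_num [mul_comm]

theorem map_vsum_succ {w : Space d → ℝ≥0∞} (hw : Measurable w)
    (hmap : (sphPi d k).map vsum = volume.withDensity w) :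
    (sphPi d (k + 1)).map vsum =
      volume.withDensity fun x => ∫⁻ η : Sphere d, w (x - η) ∂(surfaceMeasure d) := by
  have hm : Measurable fun p : Space d × Sphere d => w (p.1 - p.2) :=
    hw.comp (measurable_fst.sub (measurable_subtype_coe.comp measurable_snd))
  refine Measure.ext_of_lintegral _ fun g hg => ?_
  rw [lintegral_map hg measurable_vsum, lintegral_sphPi_succ
      (show Measurable fun ζ => g (vsum ζ) from hg.comp measurable_vsum),
    lintegral_withDensity_eq_lintegral_mul _ hm.lintegral_prod_right' hg]
  simp only [Pi.mul_apply, vsum_cons]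
  have h1 : ∀ η : Sphere d, ∫⁻ ζ, g (η + vsum ζ) ∂(sphPi d k) =
      ∫⁻ x, w (x - η) * g x := by
    intro η
    have hgη : Measurable fun x : Space d => g (η + x) := hg.comp (measurable_const.add measurable_id)
    rw [← lintegral_map (f := fun x : Space d => g (η + x)) hgη measurable_vsum, hmap,
      lintegral_withDensity_eq_lintegral_mul _ hw hgη,
      ← lintegral_add_left_eq_self (fun x => w (x - η) * g x) (η : Space d)]
    simp
  simp_rw [h1]
  rw [lintegral_lintegral_swap]
  · congr with x
    exact lintegral_mul_const _ (hw.comp (measurable_const.sub measurable_subtype_coe))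
  · refine Measurable.aemeasurable ?_
    exact (hw.comp (measurable_snd.sub (measurable_subtype_coe.comp measurable_fst))).mul
      (hg.comp measurable_snd)

/-- Adding a further point convolves the density with the finite measure σ, which preserves L² by
Cauchy-Schwarz. -/
theorem HasL2Density.succ (h : HasL2Density d k) : HasL2Density d (k + 1) := by
  obtain ⟨w, hw, hmap, hw2⟩ := h
  have hm : Measurable fun p : Space d × Sphere d => w (p.1 - p.2) :=
    hw.comp (measurable_fst.sub (measurable_subtype_coe.comp measurable_snd))
  refine ⟨_, hm.lintegral_prod_right', map_vsum_succ hw hmap, ?_⟩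
  refine ne_top_of_le_ne_top (b := surfaceMeasure d Set.univ *
    (surfaceMeasure d Set.univ * ∫⁻ x, w x ^ 2)) (by finiteness) ?_
  calc ∫⁻ x, (∫⁻ η : Sphere d, w (x - η) ∂(surfaceMeasure d)) ^ 2
      ≤ ∫⁻ x, surfaceMeasure d Set.univ *
          ∫⁻ η : Sphere d, w (x - η) ^ 2 ∂(surfaceMeasure d) := by
        refine lintegral_mono fun x => sq_lintegral_le _ ?_
        exact (hw.comp (measurable_const.sub measurable_subtype_coe)).aemeasurable
    _ = surfaceMeasure d Set.univ * ∫⁻ η : Sphere d, 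
          ∫⁻ x : Space d, w (x - η) ^ 2 ∂volume ∂(surfaceMeasure d) := by
        rw [lintegral_const_mul' _ _ (measure_ne_top _ _), lintegral_lintegral_swap]
        exact (hm.pow_const 2).aemeasurable
    _ = _ := by
        simp_rw [lintegral_sub_right_eq_self (fun x => w x ^ 2)]
        rw [lintegral_const, mul_comm (∫⁻ x, w x ^ 2)]

/-- In polar coordinates the integrand is r^{d-3}(4-r²)^{d-3}, bounded for d ≥ 3. For d = 2 it is
not integrable, which is why the plane requires three points. -/
theorem lintegral_radialDensity_sq_ne_top (hd : 3 ≤ d) : ∫⁻ x, radialDensity d x ^ 2 ≠ ∞ := by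
  have : NeZero d := ⟨by omega⟩
  have hint : Integrable (fun x : Space d => profile d ‖x‖ ^ 2) := by
    rw [integrable_fun_norm_addHaar (volume : Measure (Space d)) (f := fun r => profile d r ^ 2)]
    simp only [finrank_euclideanSpace, Fintype.card_fin, smul_eq_mul]
    have h1 : IntegrableOn (fun y : ℝ => y ^ (d - 3) * (4 - y ^ 2) ^ (d - 3)) (Set.Ioo 0 2) :=
      ((Continuous.integrableOn_Icc (by fun_prop)).mono_set Set.Ioo_subset_Icc_self)
    have h2 : IntegrableOn (fun y : ℝ => y ^ (d - 1) * profile d y ^ 2) (Set.Ioo 0 2) := by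
      refine h1.congr_fun (fun y hy => ?_) measurableSet_Ioo
      have hpos : 0 < 4 - y ^ 2 := by nlinarith [hy.1, hy.2]
      have hy0 : y ≠ 0 := hy.1.ne'
      obtain ⟨m, rfl⟩ : ∃ m, d = m + 3 := ⟨d - 3, by omega⟩
      simp only [profile, hy.2, if_true, mul_pow, show m + 3 - 3 = m from rfl,
        show m + 3 - 1 = m + 2 from rfl]
      rw [← Real.rpow_natCast ((4 - y ^ 2) ^ _) 2, ← Real.rpow_mul hpos.le]
      have : (((m + 3 : ℕ) : ℝ) - 3) / 2 * ((2 : ℕ) : ℝ) = m := by push_cast; ring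
      rw [this, Real.rpow_natCast, pow_add]
      field_simp
    refine h2.of_forall_sdiff_eq_zero measurableSet_Ioi fun y hy => ?_
    have : ¬ y < 2 := fun h => hy.2 ⟨hy.1, h⟩
    simp [profile, this]
  have := hint.lintegral_lt_top
  refine (lt_of_eq_of_lt ?_ this).ne
  congr with x
  rw [radialDensity, ENNReal.ofReal_pow (profile_nonneg (norm_nonneg x))]

theorem hasL2Density_two (hd : 3 ≤ d) : HasL2Density d 2 := by
  obtain ⟨c, hc, hmap⟩ := exists_map_vsum_two_eq (d := d) (by omega)
  refine ⟨_, (measurable_radialDensity d).const_mul c, hmap, ?_⟩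
  simp_rw [mul_pow]
  rw [lintegral_const_mul' _ _ (by finiteness)]
  exact ENNReal.mul_ne_top (by finiteness) (lintegral_radialDensity_sq_ne_top hd)

end Sums

/-! ### Three points on the circle have a square integrable density. -/

section Densities

variable {d k : ℕ}

theorem lintegral_sphPi_two {g : Sphere d → Sphere d → ℝ≥0∞}
    (hg : Measurable fun p : Sphere d × Sphere d => g p.1 p.2) :
    ∫⁻ ζ, g (ζ 0) (ζ 1) ∂(sphPi d 2) =
      ∫⁻ η, ∫⁻ ζ, g η ζ ∂(surfaceMeasure d) ∂(surfaceMeasure d) := by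
  have h := measurePreserving_piFinTwo (fun _ : Fin 2 => surfaceMeasure d)
  refine (h.lintegral_comp hg).trans ?_
  exact lintegral_prod _ hg.aemeasurable

theorem coe_sphereMap_neg (ζ : Sphere d) :
    (sphereMap (LinearIsometryEquiv.neg ℝ) ζ : Space d) = -(ζ : Space d) := by
  rw [coe_sphereMap]
  rfl

theorem lintegral_surfaceMeasure_neg {g : Space d → ℝ≥0∞} (hg : Measurable g) :
    ∫⁻ ζ : Sphere d, g (-(ζ : Space d)) ∂(surfaceMeasure d) =
      ∫⁻ ζ : Sphere d, g (ζ : Space d) ∂(surfaceMeasure d) := by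
  rw [← (measurePreserving_sphereMap (LinearIsometryEquiv.neg ℝ)).lintegral_comp
    (show Measurable fun ζ : Sphere d => g (ζ : Space d) from hg.comp measurable_subtype_coe)]
  simp_rw [coe_sphereMap_neg]

/-- Expanding the square leaves the autocorrelation of w at η - θ. By the antipodal symmetry of σ
this difference has the same law as η + θ, which has density w, so a third factor w appears. -/
theorem lintegral_density_three_sq {w : Space d → ℝ≥0∞} (hw : Measurable w)
    (hmap : (sphPi d 2).map vsum = volume.withDensity w) :
    ∫⁻ x, (∫⁻ η : Sphere d, w (x - η) ∂(surfaceMeasure d)) ^ 2 =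
      ∫⁻ z : Space d, ∫⁻ x : Space d, w z * (w x * w (x + z)) := by
  have hF : Measurable fun z : Space d => ∫⁻ x : Space d, w x * w (x + z) :=
    Measurable.lintegral_prod_right' (f := fun p : Space d × Space d => w p.2 * w (p.2 + p.1))
      ((hw.comp measurable_snd).mul (hw.comp (measurable_snd.add measurable_fst)))
  have hwx : ∀ x : Space d, Measurable fun η : Sphere d => w (x - η) := fun x =>
    hw.comp (measurable_const.sub measurable_subtype_coe)
  have hwη : ∀ η : Space d, Measurable fun x : Space d => w (x - η) := fun x =>
    hw.comp (measurable_id.sub measurable_const)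
  have hm : Measurable fun p : Space d × Sphere d => w (p.1 - p.2) :=
    hw.comp (measurable_fst.sub (measurable_subtype_coe.comp measurable_snd))
  calc ∫⁻ x, (∫⁻ η : Sphere d, w (x - η) ∂(surfaceMeasure d)) ^ 2
      = ∫⁻ x : Space d, ∫⁻ η : Sphere d, ∫⁻ θ : Sphere d, w (x - η) * w (x - θ)
          ∂(surfaceMeasure d) ∂(surfaceMeasure d) := by
        congr with x
        rw [sq, ← lintegral_mul_const _ (hwx x)]
        congr with η
        exact (lintegral_const_mul _ (hwx x)).symm
    _ = ∫⁻ η : Sphere d, ∫⁻ x : Space d, ∫⁻ θ : Sphere d, w (x - η) * w (x - θ)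
          ∂(surfaceMeasure d) ∂volume ∂(surfaceMeasure d) := by
        refine lintegral_lintegral_swap (Measurable.aemeasurable ?_)
        refine Measurable.lintegral_prod_right'
          (f := fun p : (Space d × Sphere d) × Sphere d => w (p.1.1 - p.1.2) * w (p.1.1 - p.2)) ?_
        exact (hm.comp measurable_fst).mul
          (hm.comp ((measurable_fst.comp measurable_fst).prodMk measurable_snd))
    _ = ∫⁻ η : Sphere d, ∫⁻ θ : Sphere d, ∫⁻ x : Space d, w (x - η) * w (x - θ)
          ∂volume ∂(surfaceMeasure d) ∂(surfaceMeasure d) := by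
        congr with η
        refine lintegral_lintegral_swap (Measurable.aemeasurable ?_)
        exact ((hwη η).comp measurable_fst).mul hm
    _ = ∫⁻ η : Sphere d, ∫⁻ θ : Sphere d, (∫⁻ x : Space d, w x * w (x + ((η : Space d) + -θ)))
          ∂(surfaceMeasure d) ∂(surfaceMeasure d) := by
        congr with η
        congr with θ
        rw [← lintegral_add_right_eq_self _ (η : Space d)]
        congr with x
        congr 2 <;> abel
    _ = ∫⁻ η : Sphere d, ∫⁻ θ : Sphere d, (∫⁻ x : Space d, w x * w (x + ((η : Space d) + θ)))
          ∂(surfaceMeasure d) ∂(surfaceMeasure d) := by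
        congr with η
        exact lintegral_surfaceMeasure_neg
          (g := fun θ => ∫⁻ x : Space d, w x * w (x + ((η : Space d) + θ)))
          (hF.comp (measurable_const.add measurable_id))
    _ = ∫⁻ ζ, (∫⁻ x : Space d, w x * w (x + vsum ζ)) ∂(sphPi d 2) := by
        rw [← lintegral_sphPi_two (g := fun η θ : Sphere d =>
          ∫⁻ x : Space d, w x * w (x + ((η : Space d) + θ)))]
        · simp [vsum]
        · exact hF.comp ((measurable_subtype_coe.comp measurable_fst).add
            (measurable_subtype_coe.comp measurable_snd))
    _ = ∫⁻ z, ∫⁻ x : Space d, w x * w (x + z) ∂volume ∂((sphPi d 2).map vsum) :=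
        (lintegral_map hF measurable_vsum).symm
    _ = _ := by
        rw [hmap, lintegral_withDensity_eq_lintegral_mul _ hw hF]
        congr with z
        refine (lintegral_const_mul _ ?_).symm
        exact hw.mul (hw.comp (measurable_id.add measurable_const))

theorem mul_mul_le_of_sq_le {x y z : ℝ≥0∞} (h : z ≤ x) (h' : z ≤ y) :
    x * y * z ≤ (x * y) ^ (3 / 2 : ℝ) := by
  have hz : z ≤ (x * y) ^ (1 / 2 : ℝ) := by
    calc z = (z * z) ^ (1 / 2 : ℝ) := by
          rw [← sq, ← ENNReal.rpow_natCast, ← ENNReal.rpow_mul]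
          norm_num
      _ ≤ _ := by gcongr
  calc x * y * z ≤ (x * y) * (x * y) ^ (1 / 2 : ℝ) := by gcongr
    _ = (x * y) ^ (1 : ℝ) * (x * y) ^ (1 / 2 : ℝ) := by rw [ENNReal.rpow_one]
    _ = _ := by
      rw [← ENNReal.rpow_add_of_nonneg _ _ (by norm_num) (by norm_num)]
      norm_num

/-- The smallest of three numbers is at most the geometric mean of the other two, so the product is
at most the 3/2 power of the product of the two largest. This elementary bound takes the place of
Young's convolution inequality. -/
theorem mul_mul_le_sum_rpow (x y z : ℝ≥0∞) : x * (y * z) ≤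
    (y * z) ^ (3 / 2 : ℝ) + ((x * z) ^ (3 / 2 : ℝ) + (x * y) ^ (3 / 2 : ℝ)) := by
  rcases le_total x y with h1 | h1 <;> rcases le_total y z with h2 | h2 <;>
    rcases le_total x z with h3 | h3
  · exact (mul_comm x _ ▸ mul_mul_le_of_sq_le h1 h3).trans le_self_add
  · exact (mul_comm x _ ▸ mul_mul_le_of_sq_le h1 (h1.trans h2)).trans le_self_add
  · exact (mul_comm x _ ▸ mul_mul_le_of_sq_le h1 h3).trans le_self_add
  · exact (mul_assoc x y z ▸ mul_mul_le_of_sq_le h3 h2).trans (le_add_self.trans le_add_self)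
  · refine le_trans ?_ (le_self_add.trans le_add_self)
    rw [mul_left_comm, mul_comm y]
    exact mul_mul_le_of_sq_le h1 h2
  · refine le_trans ?_ (le_self_add.trans le_add_self)
    rw [mul_left_comm, mul_comm y]
    exact mul_mul_le_of_sq_le h1 h2
  · exact (mul_assoc x y z ▸ mul_mul_le_of_sq_le (h2.trans h1) h2).trans
      (le_add_self.trans le_add_self)
  · exact (mul_assoc x y z ▸ mul_mul_le_of_sq_le h3 h2).trans (le_add_self.trans le_add_self)

/-- Any two of z, x, x + z are coordinates on the double space related to (z, x) by a measure
preserving change of variables, so each of the three terms factors into the square of one integral.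
-/
theorem lintegral_mul_mul_translate_le {w : Space d → ℝ≥0∞} (hw : Measurable w) :
    ∫⁻ z : Space d, ∫⁻ x : Space d, w z * (w x * w (x + z)) ≤
      3 * (∫⁻ x, w x ^ (3 / 2 : ℝ)) ^ 2 := by
  have hv : Measurable fun x => w x ^ (3 / 2 : ℝ) := hw.pow_const _
  obtain ⟨v, hvw⟩ : ∃ v : Space d → ℝ≥0∞, v = fun x => w x ^ (3 / 2 : ℝ) := ⟨_, rfl⟩
  rw [← hvw] at hv ⊢
  have e : ∀ x y, (w x * w y) ^ (3 / 2 : ℝ) = v x * v y := fun x y => by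
    rw [ENNReal.mul_rpow_of_nonneg _ _ (by norm_num), hvw]
  have hm1 : Measurable fun p : Space d × Space d => v p.2 := hv.comp measurable_snd
  have hm2 : Measurable fun p : Space d × Space d => v p.1 := hv.comp measurable_fst
  have hm3 : Measurable fun p : Space d × Space d => v (p.2 + p.1) :=
    hv.comp (measurable_snd.add measurable_fst)
  have hx : ∀ z : Space d, Measurable fun x : Space d => v (x + z) := fun z =>
    hv.comp (measurable_id.add measurable_const)
  have I2 : ∫⁻ z : Space d, ∫⁻ x : Space d, v z * v (x + z) = (∫⁻ x, v x) ^ 2 := by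
    simp_rw [lintegral_const_mul _ (hx _), lintegral_add_right_eq_self v]
    rw [lintegral_mul_const _ hv, sq]
  have I3 : ∫⁻ z : Space d, ∫⁻ x : Space d, v z * v x = (∫⁻ x, v x) ^ 2 := by
    simp_rw [lintegral_const_mul _ hv]
    rw [lintegral_mul_const _ hv, sq]
  have I1 : ∫⁻ z : Space d, ∫⁻ x : Space d, v x * v (x + z) = (∫⁻ x, v x) ^ 2 := by
    rw [lintegral_lintegral_swap (hm1.mul hm3).aemeasurable]
    refine Eq.trans ?_ I2
    congr with x
    congr with z
    rw [add_comm x z]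
  calc ∫⁻ z : Space d, ∫⁻ x : Space d, w z * (w x * w (x + z))
      ≤ ∫⁻ z : Space d, ∫⁻ x : Space d, (v x * v (x + z) + (v z * v (x + z) + v z * v x)) := by
        gcongr with z x
        refine (mul_mul_le_sum_rpow _ _ _).trans ?_
        rw [e, e, e]
    _ = ∫⁻ p : Space d × Space d, (v p.2 * v (p.2 + p.1) + (v p.1 * v (p.2 + p.1) + v p.1 * v p.2))
          ∂(volume.prod volume) := by
        refine (lintegral_prod (fun p : Space d × Space d => v p.2 * v (p.2 + p.1) +
          (v p.1 * v (p.2 + p.1) + v p.1 * v p.2)) (Measurable.aemeasurable ?_)).symm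
        fun_prop
    _ = ∫⁻ p : Space d × Space d, v p.2 * v (p.2 + p.1) ∂(volume.prod volume) +
          (∫⁻ p : Space d × Space d, v p.1 * v (p.2 + p.1) ∂(volume.prod volume) +
          ∫⁻ p : Space d × Space d, v p.1 * v p.2 ∂(volume.prod volume)) := by
        rw [lintegral_add_left (by fun_prop), lintegral_add_left (by fun_prop)]
    _ = 3 * (∫⁻ x, v x) ^ 2 := by
        rw [lintegral_prod _ (by fun_prop), lintegral_prod _ (by fun_prop),
          lintegral_prod _ (by fun_prop), I1, I2, I3]
        ring

/-- In polar coordinates the integrand is r^{-1/2}(4-r²)^{-3/4}, with integrable singularities at 0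
and at 2. -/
theorem lintegral_radialDensity_rpow_ne_top :
    ∫⁻ x, radialDensity 2 x ^ (3 / 2 : ℝ) ≠ ∞ := by
  have hint : Integrable (fun x : Space 2 => profile 2 ‖x‖ ^ (3 / 2 : ℝ)) := by
    rw [integrable_fun_norm_addHaar (volume : Measure (Space 2))
      (f := fun r => profile 2 r ^ (3 / 2 : ℝ))]
    simp only [finrank_euclideanSpace, Fintype.card_fin, smul_eq_mul]
    -- The sum is a majorant of the product: on each side of y = 1 one of the two singular factors
    -- is at most 1.
    have h1 : IntegrableOn (fun y : ℝ => y ^ (-(1 / 2) : ℝ) + (2 - y) ^ (-(3 / 4) : ℝ))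
        (Set.Ioo 0 2) := by
      rw [← intervalIntegrable_iff_integrableOn_Ioo_of_le zero_le_two]
      exact (intervalIntegral.intervalIntegrable_rpow' (by norm_num)).add
        (intervalIntegrable_two_sub_rpow (by norm_num) 0)
    have h2 : IntegrableOn (fun y : ℝ => y ^ (2 - 1) * profile 2 y ^ (3 / 2 : ℝ))
        (Set.Ioo 0 2) := by
      refine h1.mono' ?_ ?_
      · exact ((measurable_id.pow_const _).mul
          ((measurable_profile 2).pow_const _)).aestronglyMeasurable
      · refine (ae_restrict_iff' measurableSet_Ioo).2 (.of_forall fun y hy => ?_)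
        have hy0 : 0 < y := hy.1
        have hy2 : 0 < 2 - y := by linarith [hy.2]
        have hp : profile 2 y = y⁻¹ * ((2 + y) ^ (-(1 / 2) : ℝ) * (2 - y) ^ (-(1 / 2) : ℝ)) := by
          rw [profile, if_pos hy.2, four_sub_sq_rpow hy0.le hy.2.le]
          norm_num
        have e : y ^ (2 - 1) * profile 2 y ^ (3 / 2 : ℝ) =
            y ^ (-(1 / 2) : ℝ) * ((2 + y) ^ (-(3 / 4) : ℝ) * (2 - y) ^ (-(3 / 4) : ℝ)) := by
          rw [hp, Real.mul_rpow (by positivity) (by positivity),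
            Real.mul_rpow (by positivity) (by positivity), ← Real.rpow_mul (by positivity),
            ← Real.rpow_mul (by positivity), ← Real.rpow_neg_one y, ← Real.rpow_mul hy0.le,
            ← mul_assoc]
          nth_rw 1 [← Real.rpow_natCast y]
          rw [← Real.rpow_add hy0]
          norm_num
        rw [Real.norm_of_nonneg (by rw [e]; positivity), e]
        have ha : (2 + y) ^ (-(3 / 4) : ℝ) ≤ 1 :=
          Real.rpow_le_one_of_one_le_of_nonpos (by linarith) (by norm_num)
        have hb0 : 0 < (2 - y) ^ (-(3 / 4) : ℝ) := by positivity
        have hc0 : 0 < y ^ (-(1 / 2) : ℝ) := by positivity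
        have hab : (2 + y) ^ (-(3 / 4) : ℝ) * (2 - y) ^ (-(3 / 4) : ℝ) ≤ (2 - y) ^ (-(3 / 4) : ℝ) :=
          mul_le_of_le_one_left hb0.le ha
        rcases le_total y 1 with h | h
        · have : (2 - y) ^ (-(3 / 4) : ℝ) ≤ 1 :=
            Real.rpow_le_one_of_one_le_of_nonpos (by linarith) (by norm_num)
          nlinarith
        · have : y ^ (-(1 / 2) : ℝ) ≤ 1 :=
            Real.rpow_le_one_of_one_le_of_nonpos h (by norm_num)
          nlinarith
    refine h2.of_forall_sdiff_eq_zero measurableSet_Ioi fun y hy => ?_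
    have : ¬ y < 2 := fun h => hy.2 ⟨hy.1, h⟩
    simp [profile, this]
  have := hint.lintegral_lt_top
  refine (lt_of_eq_of_lt ?_ this).ne
  congr with x
  rw [radialDensity, ENNReal.ofReal_rpow_of_nonneg (profile_nonneg (norm_nonneg x)) (by norm_num)]

theorem hasL2Density_three_of_rpow (hd : 2 ≤ d)
    (hr : ∫⁻ x, radialDensity d x ^ (3 / 2 : ℝ) ≠ ∞) : HasL2Density d 3 := by
  obtain ⟨c, hc, hmap⟩ := exists_map_vsum_two_eq hd
  obtain ⟨w, hwc⟩ : ∃ w, w = fun x => c * radialDensity d x := ⟨_, rfl⟩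
  have hw : Measurable w := hwc ▸ (measurable_radialDensity d).const_mul c
  rw [← hwc] at hmap
  have hm : Measurable fun p : Space d × Sphere d => w (p.1 - p.2) :=
    hw.comp (measurable_fst.sub (measurable_subtype_coe.comp measurable_snd))
  refine ⟨_, hm.lintegral_prod_right', map_vsum_succ hw hmap, ?_⟩
  refine ne_top_of_le_ne_top ?_ ((lintegral_density_three_sq hw hmap).trans_le
    (lintegral_mul_mul_translate_le hw))
  refine ENNReal.mul_ne_top (by norm_num) (ENNReal.pow_ne_top ?_)
  simp_rw [hwc, ENNReal.mul_rpow_of_nonneg _ _ (show (0 : ℝ) ≤ 3 / 2 by norm_num)]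
  rw [lintegral_const_mul _ ((measurable_radialDensity d).pow_const _)]
  exact ENNReal.mul_ne_top (ENNReal.rpow_ne_top_of_nonneg (by norm_num) hc) hr

theorem hasL2Density (h : 3 ≤ d ∧ 2 ≤ k ∨ d = 2 ∧ 3 ≤ k) : HasL2Density d k := by
  rcases h with ⟨hd, hk⟩ | ⟨rfl, hk⟩
  · induction k, hk using Nat.le_induction with
    | base => exact hasL2Density_two hd
    | succ k _ ih => exact ih.succ
  · induction k, hk using Nat.le_induction with
    | base => exact hasL2Density_three_of_rpow le_rfl lintegral_radialDensity_rpow_ne_top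
    | succ k _ ih => exact ih.succ

end Densities

/-! ### The k-th power as a k-linear object, AM-GM and one-point marginals. -/

section Multilinear

variable {d k : ℕ}

/-- By Fubini the power of an integral is an integral over k-tuples, and the characters multiply to
the character at the sum. Every L^{2k} norm thereby becomes an L² norm. -/
theorem extension_pow (f : Sphere d → ℂ) (ξ : Space d) :
    extension d f ξ ^ k = fourierPush (sphPi d k) vsum (fun ζ => ∏ i, f (ζ i)) ξ := by
  have h := integral_fintype_prod_eq_pow (ι := Fin k) (μ := surfaceMeasure d)
    (fun ζ : Sphere d => wave ζ ξ * f ζ)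
  rw [Fintype.card_fin] at h
  refine h.symm.trans ?_
  refine integral_congr_ae (.of_forall fun ζ => ?_)
  simp only [vsum, wave_sum, Finset.prod_mul_distrib]

/-- AM-GM with equal weights 1/k for the numbers a_i^{2k}, together with its equality case. -/
theorem prod_sq_le_sum_pow (hk : k ≠ 0) {a : Fin k → ℝ} (ha : ∀ i, 0 ≤ a i) :
    k * ∏ i, a i ^ 2 ≤ ∑ i, a i ^ (2 * k) ∧
      (∑ i, a i ^ (2 * k) ≤ k * ∏ i, a i ^ 2 → ∀ i j, a i = a j) := by
  have hk0 : (k : ℝ) ≠ 0 := by exact_mod_cast hk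
  have hkp : (0 : ℝ) < k := by positivity
  have hw : ∑ i : Fin k, (k : ℝ)⁻¹ = 1 := by simp [hk0]
  have hpow : ∀ i, (a i ^ (2 * k)) ^ ((k : ℝ)⁻¹) = a i ^ 2 := fun i => by
    rw [pow_mul, ← Real.rpow_natCast (a i ^ 2) k, ← Real.rpow_mul (sq_nonneg _),
      mul_inv_cancel₀ hk0, Real.rpow_one]
  have h1 := Real.geom_mean_le_arith_mean_weighted Finset.univ (fun _ : Fin k => (k : ℝ)⁻¹)
    (fun i => a i ^ (2 * k)) (fun i _ => by positivity) hw (fun i _ => by have := ha i; positivity)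
  simp only [hpow, ← Finset.mul_sum] at h1
  refine ⟨?_, fun h i j => ?_⟩
  · calc k * ∏ i, a i ^ 2 ≤ k * ((k : ℝ)⁻¹ * ∑ i, a i ^ (2 * k)) := by gcongr
      _ = _ := by rw [← mul_assoc, mul_inv_cancel₀ hk0, one_mul]
  · have h2 := Real.geom_mean_eq_arith_mean_weighted_iff_of_pos Finset.univ
      (fun _ : Fin k => (k : ℝ)⁻¹) (fun i => a i ^ (2 * k)) (fun i _ => by positivity) hw
      (fun i _ => by have := ha i; positivity)
    simp only [hpow, ← Finset.mul_sum] at h2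
    have h3 := h2.1 (le_antisymm h1 (by
      rw [inv_mul_le_iff₀ hkp]
      exact h))
    have h4 := h3 i (Finset.mem_univ _) j (Finset.mem_univ _)
    exact (pow_left_inj₀ (ha i) (ha j) (by omega)).1 h4

theorem prod_enorm_sq_le_sum_pow (hk : k ≠ 0) (a : Fin k → ℂ) :
    k * ∏ i, ‖a i‖ₑ ^ 2 ≤ ∑ i, ‖a i‖ₑ ^ (2 * k) ∧
      (∑ i, ‖a i‖ₑ ^ (2 * k) ≤ k * ∏ i, ‖a i‖ₑ ^ 2 → ∀ i j, ‖a i‖ = ‖a j‖) := by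
  have h := prod_sq_le_sum_pow hk (a := fun i => ‖a i‖) fun i => norm_nonneg _
  have e1 : (k : ℝ≥0∞) * ∏ i, ‖a i‖ₑ ^ 2 = ENNReal.ofReal (k * ∏ i, ‖a i‖ ^ 2) := by
    rw [ENNReal.ofReal_mul (by positivity), ENNReal.ofReal_prod_of_nonneg fun i _ => by positivity]
    simp_rw [ENNReal.ofReal_pow (norm_nonneg _), ofReal_norm, ENNReal.ofReal_natCast]
  have e2 : ∑ i, ‖a i‖ₑ ^ (2 * k) = ENNReal.ofReal (∑ i, ‖a i‖ ^ (2 * k)) := by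
    rw [ENNReal.ofReal_sum_of_nonneg fun i _ => by positivity]
    simp_rw [ENNReal.ofReal_pow (norm_nonneg _), ofReal_norm]
  rw [e1, e2, ENNReal.ofReal_le_ofReal_iff (by positivity),
    ENNReal.ofReal_le_ofReal_iff (by positivity)]
  exact h

/-- A finite rotation invariant measure on the sphere is a multiple of the surface measure. -/
theorem eq_smul_surfaceMeasure (hd : d ≠ 0) {ν : Measure (Sphere d)} [IsFiniteMeasure ν]
    (hν : ∀ L : Space d ≃ₗᵢ[ℝ] Space d, ν.map (sphereMap L) = ν) :
    ν = (ν Set.univ / surfaceMeasure d Set.univ) • surfaceMeasure d := by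
  have h0 := surfaceMeasure_univ_ne_zero hd
  have hcoe : MeasurableEmbedding ((↑) : Sphere d → Space d) :=
    .subtype_coe Metric.isClosed_sphere.measurableSet
  have hc : ν Set.univ / surfaceMeasure d Set.univ ≠ ∞ :=
    ENNReal.div_ne_top (measure_ne_top _ _) h0
  have hfin := Measure.smul_finite (surfaceMeasure d) hc
  have hmapinv : ∀ {ρ : Measure (Sphere d)} (L : Space d ≃ₗᵢ[ℝ] Space d),
      ρ.map (sphereMap L) = ρ → (ρ.map ((↑) : Sphere d → Space d)).map L = ρ.map (↑) := by
    intro ρ L h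
    rw [Measure.map_map L.continuous.measurable hcoe.measurable]
    conv_rhs => rw [← h, Measure.map_map hcoe.measurable (continuous_sphereMap L).measurable]
    congr 1
  have hae : ∀ (ρ : Measure (Sphere d)), ∀ᵐ x ∂(ρ.map ((↑) : Sphere d → Space d)), ‖x‖ = 1 := by
    intro ρ
    rw [hcoe.ae_map_iff]
    exact .of_forall norm_coe_sphere
  -- On the unit sphere τ is constantly -1/2, so all radial moments are multiples of the total mass
  -- and only the masses have to be matched.
  have hint : ∀ (ρ : Measure (Sphere d)) (n : ℕ),
      ∫ x, (‖x‖ ^ 2 / 2 - 1) ^ n ∂(ρ.map ((↑) : Sphere d → Space d)) =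
        ρ.real Set.univ * (1 / 2 - 1) ^ n := by
    intro ρ n
    rw [hcoe.integral_map]
    simp
  have key := measure_ext_of_radial_moments hd (μ := ν.map ((↑) : Sphere d → Space d))
    (ν := ((ν Set.univ / surfaceMeasure d Set.univ) • surfaceMeasure d).map (↑))
    (fun L => hmapinv L (hν L))
    (fun L => hmapinv L (by rw [Measure.map_smul, (measurePreserving_sphereMap L).map_eq]))
    ((hae _).mono fun x hx => by rw [hx]; norm_num)
    ((hae _).mono fun x hx => by rw [hx]; norm_num)
    (fun n => by
      rw [hint, hint]
      congr 1
      simp only [Measure.real, Measure.smul_apply, smul_eq_mul]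
      rw [ENNReal.div_mul_cancel h0 (measure_ne_top _ _)])
  have := congrArg (Measure.comap ((↑) : Sphere d → Space d)) key
  rwa [hcoe.comap_map, hcoe.comap_map] at this

/-- The measure w(∑ζ) dσ^k is rotation invariant, hence so is its image under one coordinate, which
must then be a multiple of σ. -/
theorem lintegral_marginal (hd : d ≠ 0) {w : Space d → ℝ≥0∞} (hw : Measurable w)
    (hmap : (sphPi d k).map vsum = volume.withDensity w) (hw2 : ∫⁻ x, w x ^ 2 ≠ ∞)
    {g : Sphere d → ℝ≥0∞} (hg : AEMeasurable g (surfaceMeasure d)) (i : Fin k) :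
    ∫⁻ ζ, g (ζ i) * w (vsum ζ) ∂(sphPi d k) =
      (∫⁻ ζ, w (vsum ζ) ∂(sphPi d k)) / surfaceMeasure d Set.univ *
        ∫⁻ ζ, g ζ ∂(surfaceMeasure d) := by
  have hws : Measurable fun ζ : Fin k → Sphere d => w (vsum ζ) := hw.comp measurable_vsum
  have hwfin : ∫⁻ ζ, w (vsum ζ) ∂(sphPi d k) ≠ ∞ := by
    rw [← lintegral_map hw measurable_vsum, hmap, lintegral_withDensity_eq_lintegral_mul _ hw hw]
    simpa [sq] using hw2
  obtain ⟨ρ, hρ⟩ : ∃ ρ, ρ = (sphPi d k).withDensity fun ζ => w (vsum ζ) := ⟨_, rfl⟩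
  have hρfin : IsFiniteMeasure ρ := by
    rw [hρ]
    exact isFiniteMeasure_withDensity hwfin
  have hev : Measurable fun ζ : Fin k → Sphere d => ζ i := measurable_pi_apply i
  have hlin : ∀ {h : Sphere d → ℝ≥0∞}, Measurable h →
      ∫⁻ η, h η ∂(ρ.map fun ζ => ζ i) = ∫⁻ ζ, h (ζ i) * w (vsum ζ) ∂(sphPi d k) := by
    intro h hh
    rw [lintegral_map hh hev, hρ, lintegral_withDensity_eq_lintegral_mul _ hws
      (show Measurable fun ζ : Fin k → Sphere d => h (ζ i) from hh.comp hev)]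
    simp [mul_comm]
  -- As the density of an invariant measure, w is invariant only almost everywhere; this suffices
  -- after composing with the sum map.
  have hwL : ∀ L : Space d ≃ₗᵢ[ℝ] Space d, ∀ᵐ ζ ∂(sphPi d k), w (L (vsum ζ)) = w (vsum ζ) := by
    intro L
    refine ae_comp_of_ae (p := fun x => w (L x) = w x) measurable_vsum hmap ?_
    have hL : Measurable L := L.continuous.measurable
    have e : volume.withDensity (fun x => w (L x)) = volume.withDensity w := by
      have h1 := map_vsum_isometry (d := d) (k := k) L.symm
      rw [hmap] at h1
      rw [← h1]
      ext A hA
      have hLs : Measurable L.symm := L.symm.continuous.measurable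
      rw [Measure.map_apply hLs hA, withDensity_apply _ hA, withDensity_apply _ (hLs hA)]
      have := L.measurePreserving.setLIntegral_comp_preimage (s := L.symm ⁻¹' A) (hLs hA) hw
      rw [← this]
      congr 2
      ext x
      simp
    have hwi : ∫⁻ x, w x ≠ ∞ := by
      have := congrArg (fun m => m Set.univ) hmap
      simp only [withDensity_apply _ MeasurableSet.univ, Measure.restrict_univ] at this
      rw [← this]
      exact measure_ne_top _ _
    have hLw : ∫⁻ x, w (L x) ≠ ∞ := by
      rwa [L.measurePreserving.lintegral_comp hw]
    exact (withDensity_eq_iff (hw.comp hL).aemeasurable hw.aemeasurable hLw).1 e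
  have hinv : ∀ L : Space d ≃ₗᵢ[ℝ] Space d,
      (ρ.map fun ζ => ζ i).map (sphereMap L) = ρ.map fun ζ => ζ i := by
    intro L
    have hLm : Measurable (sphereMap L) := (continuous_sphereMap L).measurable
    refine Measure.ext_of_lintegral _ fun h hh => ?_
    rw [lintegral_map hh hLm, hlin
      (show Measurable fun η => h (sphereMap L η) from hh.comp hLm), hlin hh,
      ← (measurePreserving_sphPi L).lintegral_comp
        (show Measurable fun ζ : Fin k → Sphere d => h (ζ i) * w (vsum ζ) from
          (hh.comp hev).mul hws)]
    refine lintegral_congr_ae ((hwL L).mono fun ζ hζ => ?_)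
    simp [vsum_sphereMap, hζ]
  have key := eq_smul_surfaceMeasure hd hinv
  have htot : (ρ.map fun ζ => ζ i) Set.univ = ∫⁻ ζ, w (vsum ζ) ∂(sphPi d k) := by
    have := hlin (h := fun _ => 1) measurable_const
    simpa using this
  rw [htot] at key
  have hlin' : ∫⁻ ζ, g (ζ i) * w (vsum ζ) ∂(sphPi d k) =
      ∫⁻ ζ, hg.mk g (ζ i) * w (vsum ζ) ∂(sphPi d k) := by
    refine lintegral_congr_ae ?_
    filter_upwards [(Measure.quasiMeasurePreserving_eval (fun _ : Fin k => surfaceMeasure d)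
      i).ae hg.ae_eq_mk] with ζ hζ
    rw [Function.eval] at hζ
    rw [hζ]
  rw [hlin', ← hlin hg.measurable_mk, key, lintegral_smul_measure, smul_eq_mul,
    lintegral_congr_ae hg.ae_eq_mk]

theorem aestronglyMeasurable_prod_eval {f : Sphere d → ℂ}
    (hf : AEStronglyMeasurable f (surfaceMeasure d)) :
    AEStronglyMeasurable (fun ζ : Fin k → Sphere d => ∏ i, f (ζ i)) (sphPi d k) :=
  Finset.aestronglyMeasurable_fun_prod _ fun i _ =>
    hf.comp_quasiMeasurePreserving (Measure.quasiMeasurePreserving_eval _ i)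

/-- Freeze one generic first point and compare every other point with it. -/
theorem exists_norm_eq_of_ae (hd : d ≠ 0) (hk : 2 ≤ k) {f : Sphere d → ℂ}
    (h : ∀ᵐ ζ ∂(sphPi d k), ∀ i j, ‖f (ζ i)‖ = ‖f (ζ j)‖) :
    ∃ c, ∀ᵐ ζ ∂(surfaceMeasure d), ‖f ζ‖ = c := by
  obtain ⟨m, rfl⟩ : ∃ m, k = m + 1 + 1 := ⟨k - 2, by omega⟩
  have : NeZero (surfaceMeasure d) :=
    ⟨fun h => surfaceMeasure_univ_ne_zero hd (by simp [h])⟩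
  have : NeZero (sphPi d m) := ⟨fun h => by
    have h1 : sphPi d m Set.univ = 0 := by simp [h]
    rw [sphPi, Measure.pi_univ, Finset.prod_const] at h1
    exact surfaceMeasure_univ_ne_zero hd (eq_zero_of_pow_eq_zero h1)⟩
  obtain ⟨η, hη⟩ := (sphPi_ae_succ h).exists
  refine ⟨‖f η‖, (sphPi_ae_succ hη).mono fun θ hθ => ?_⟩
  obtain ⟨ζ, hζ⟩ := hθ.exists
  exact hζ (Fin.succ 0) 0

end Multilinear

/-! ### The sharp inequality from L^{2k} to L^{2k} and its equality case. -/

section SharpEven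

variable {d k : ℕ}

theorem enorm_extension_pow (f : Sphere d → ℂ) (ξ : Space d) :
    ‖extension d f ξ‖ₑ ^ (2 * k) =
      ‖fourierPush (sphPi d k) vsum (fun ζ => ∏ i, f (ζ i)) ξ‖ₑ ^ 2 := by
  rw [← extension_pow, enorm_pow, ← pow_mul, mul_comm]

theorem enorm_prod_sq (a : Fin k → ℂ) : ‖∏ i, a i‖ₑ ^ 2 = ∏ i, ‖a i‖ₑ ^ 2 := by
  rw [Finset.prod_pow]
  congr 1
  induction (Finset.univ : Finset (Fin k)) using Finset.cons_induction with
  | empty => simp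
  | cons i s hi ih => rw [Finset.prod_cons, Finset.prod_cons, enorm_mul, ih]

theorem lintegral_sum_marginal (hd : d ≠ 0) {w : Space d → ℝ≥0∞} (hw : Measurable w)
    (hmap : (sphPi d k).map vsum = volume.withDensity w) (hw2 : ∫⁻ x, w x ^ 2 ≠ ∞)
    {f : Sphere d → ℂ} (hf : AEStronglyMeasurable f (surfaceMeasure d)) :
    surfaceMeasure d Set.univ *
        ∫⁻ ζ, (∑ i, ‖f (ζ i)‖ₑ ^ (2 * k)) * w (vsum ζ) ∂(sphPi d k) =
      k * ((∫⁻ ζ, w (vsum ζ) ∂(sphPi d k)) * ∫⁻ ζ, ‖f ζ‖ₑ ^ (2 * k) ∂(surfaceMeasure d)) := by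
  have hg : AEMeasurable (fun ζ => ‖f ζ‖ₑ ^ (2 * k)) (surfaceMeasure d) := hf.enorm.pow_const _
  have hm : ∀ i : Fin k, AEMeasurable (fun ζ : Fin k → Sphere d => ‖f (ζ i)‖ₑ ^ (2 * k) * w (vsum ζ))
      (sphPi d k) := fun i =>
    ((hf.comp_quasiMeasurePreserving
      (Measure.quasiMeasurePreserving_eval _ i)).enorm.pow_const _).mul
      (hw.comp measurable_vsum).aemeasurable
  simp_rw [Finset.sum_mul]
  rw [lintegral_finsetSum' _ fun i _ => hm i]
  simp_rw [lintegral_marginal hd hw hmap hw2 hg]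
  rw [Finset.sum_const, Finset.card_univ, Fintype.card_fin, nsmul_eq_mul, mul_left_comm,
    ← mul_assoc (surfaceMeasure d Set.univ),
    ENNReal.mul_div_cancel (surfaceMeasure_univ_ne_zero hd) (measure_ne_top _ _)]

theorem lintegral_extension_one_pow {w : Space d → ℝ≥0∞} (hw : Measurable w)
    (hmap : (sphPi d k).map vsum = volume.withDensity w) (hw2 : ∫⁻ x, w x ^ 2 ≠ ∞) :
    ∫⁻ ζ, w (vsum ζ) ∂(sphPi d k) ≠ ∞ ∧
    ∫⁻ ξ, ‖extension d (fun _ => 1) ξ‖ₑ ^ (2 * k) =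
      ENNReal.ofReal (2 * Real.pi) ^ d * ∫⁻ ζ, w (vsum ζ) ∂(sphPi d k) := by
  have hwfin : ∫⁻ ζ, w (vsum ζ) ∂(sphPi d k) ≠ ∞ := by
    rw [← lintegral_map hw measurable_vsum, hmap, lintegral_withDensity_eq_lintegral_mul _ hw hw]
    simpa [sq] using hw2
  refine ⟨hwfin, ?_⟩
  have h := lintegral_fourierPush_comp_sq_eq measurable_vsum hw hmap hw2 norm_vsum_le
    (G := fun _ => 1) measurable_const (by simpa using hwfin)
  simp_rw [enorm_extension_pow, Finset.prod_const_one]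
  simpa using h

theorem lintegral_extension_one_pow_ne_top (h : HasL2Density d k) :
    ∫⁻ ξ, ‖extension d (fun _ => 1) ξ‖ₑ ^ (2 * k) ≠ ∞ := by
  obtain ⟨w, hw, hmap, hw2⟩ := h
  obtain ⟨h1, h2⟩ := lintegral_extension_one_pow hw hmap hw2
  rw [h2]
  finiteness

/-- The sharp inequality `‖(fσ)^‖_{2k} ≤ C ‖f‖_{2k}`. -/
theorem lintegral_extension_pow_le (hd : d ≠ 0) (hk : k ≠ 0) (h : HasL2Density d k)
    {f : Sphere d → ℂ} (hf : AEStronglyMeasurable f (surfaceMeasure d)) :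
    surfaceMeasure d Set.univ * ∫⁻ ξ, ‖extension d f ξ‖ₑ ^ (2 * k) ≤
      (∫⁻ ξ, ‖extension d (fun _ => 1) ξ‖ₑ ^ (2 * k)) *
        ∫⁻ ζ, ‖f ζ‖ₑ ^ (2 * k) ∂(surfaceMeasure d) := by
  obtain ⟨w, hw, hmap, hw2⟩ := h
  have hk0 : (k : ℝ≥0∞) ≠ 0 := by exact_mod_cast hk
  have h1 := lintegral_fourierPush_sq_le measurable_vsum hw hmap hw2 norm_vsum_le
    (aestronglyMeasurable_prod_eval (k := k) hf)
  have h3 : (k : ℝ≥0∞) * ∫⁻ ζ, ‖∏ i, f (ζ i)‖ₑ ^ 2 * w (vsum ζ) ∂(sphPi d k) ≤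
      ∫⁻ ζ, (∑ i, ‖f (ζ i)‖ₑ ^ (2 * k)) * w (vsum ζ) ∂(sphPi d k) := by
    rw [← lintegral_const_mul' _ _ (ENNReal.natCast_ne_top k)]
    refine lintegral_mono fun ζ => ?_
    rw [← mul_assoc, enorm_prod_sq]
    gcongr
    exact (prod_enorm_sq_le_sum_pow hk _).1
  -- Multiplying by k clears the denominator of the arithmetic mean.
  rw [← ENNReal.mul_le_mul_iff_right hk0 (ENNReal.natCast_ne_top k)]
  rw [(lintegral_extension_one_pow hw hmap hw2).2]
  simp_rw [enorm_extension_pow]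
  calc (k : ℝ≥0∞) * (surfaceMeasure d Set.univ *
        ∫⁻ ξ, ‖fourierPush (sphPi d k) vsum (fun ζ => ∏ i, f (ζ i)) ξ‖ₑ ^ 2)
      ≤ k * (surfaceMeasure d Set.univ * (ENNReal.ofReal (2 * Real.pi) ^ d *
          ∫⁻ ζ, ‖∏ i, f (ζ i)‖ₑ ^ 2 * w (vsum ζ) ∂(sphPi d k))) := by gcongr
    _ = ENNReal.ofReal (2 * Real.pi) ^ d * (surfaceMeasure d Set.univ *
          (k * ∫⁻ ζ, ‖∏ i, f (ζ i)‖ₑ ^ 2 * w (vsum ζ) ∂(sphPi d k))) := by ring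
    _ ≤ ENNReal.ofReal (2 * Real.pi) ^ d * (surfaceMeasure d Set.univ *
          ∫⁻ ζ, (∑ i, ‖f (ζ i)‖ₑ ^ (2 * k)) * w (vsum ζ) ∂(sphPi d k)) := by gcongr
    _ = _ := by
      rw [lintegral_sum_marginal hd hw hmap hw2 hf]
      ring

/-- The case of equality in the sharp inequality. -/
theorem exists_factor_of_extension_pow_eq (hd : d ≠ 0) (hk : 2 ≤ k) (h : HasL2Density d k)
    {f : Sphere d → ℂ} (hf : AEStronglyMeasurable f (surfaceMeasure d))
    (hfin : ∫⁻ ζ, ‖f ζ‖ₑ ^ (2 * k) ∂(surfaceMeasure d) ≠ ∞)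
    (heq : (∫⁻ ξ, ‖extension d (fun _ => 1) ξ‖ₑ ^ (2 * k)) *
        ∫⁻ ζ, ‖f ζ‖ₑ ^ (2 * k) ∂(surfaceMeasure d) ≤
      surfaceMeasure d Set.univ * ∫⁻ ξ, ‖extension d f ξ‖ₑ ^ (2 * k)) :
    (∃ G : Space d → ℂ, Measurable G ∧ ∀ᵐ ζ ∂(sphPi d k), ∏ i, f (ζ i) = G (vsum ζ)) ∧
      ∃ c, ∀ᵐ ζ ∂(surfaceMeasure d), ‖f ζ‖ = c := by
  obtain ⟨w, hw, hmap, hw2⟩ := h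
  have hkne : k ≠ 0 := by omega
  have hk0 : (k : ℝ≥0∞) ≠ 0 := by exact_mod_cast hkne
  have hσ0 := surfaceMeasure_univ_ne_zero hd
  have hσt : surfaceMeasure d Set.univ ≠ ∞ := measure_ne_top _ _
  have hFm := aestronglyMeasurable_prod_eval (k := k) hf
  have h1 := lintegral_fourierPush_sq_le measurable_vsum hw hmap hw2 norm_vsum_le hFm
  obtain ⟨hwfin, h2⟩ := lintegral_extension_one_pow hw hmap hw2
  have h4 := lintegral_sum_marginal hd hw hmap hw2 hf
  rw [h2] at heq
  simp_rw [enorm_extension_pow] at heq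
  obtain ⟨P, hP⟩ : ∃ P, P = ∫⁻ ζ, ‖∏ i, f (ζ i)‖ₑ ^ 2 * w (vsum ζ) ∂(sphPi d k) := ⟨_, rfl⟩
  obtain ⟨S, hS⟩ : ∃ S, S = ∫⁻ ζ, (∑ i, ‖f (ζ i)‖ₑ ^ (2 * k)) * w (vsum ζ) ∂(sphPi d k) :=
    ⟨_, rfl⟩
  have hpt : ∀ ζ : Fin k → Sphere d, k * (‖∏ i, f (ζ i)‖ₑ ^ 2 * w (vsum ζ)) ≤
      (∑ i, ‖f (ζ i)‖ₑ ^ (2 * k)) * w (vsum ζ) := fun ζ => by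
    rw [← mul_assoc, enorm_prod_sq]
    gcongr
    exact (prod_enorm_sq_le_sum_pow hkne _).1
  have h3 : (k : ℝ≥0∞) * P ≤ S := by
    rw [hP, hS, ← lintegral_const_mul' _ _ (ENNReal.natCast_ne_top k)]
    exact lintegral_mono hpt
  rw [← hS] at h4
  have hStop : S ≠ ∞ := by
    intro htop
    rw [htop, ENNReal.mul_top hσ0] at h4
    exact (show (k : ℝ≥0∞) * ((∫⁻ ζ, w (vsum ζ) ∂(sphPi d k)) *
      ∫⁻ ζ, ‖f ζ‖ₑ ^ (2 * k) ∂(surfaceMeasure d)) ≠ ∞ by finiteness) h4.symm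
  have hPtop : P ≠ ∞ := by
    intro htop
    rw [htop, ENNReal.mul_top hk0] at h3
    exact hStop (top_le_iff.1 h3)
  rw [← hP] at h1
  obtain ⟨X, hX⟩ : ∃ X, X = ∫⁻ ξ, ‖fourierPush (sphPi d k) vsum (fun ζ => ∏ i, f (ζ i)) ξ‖ₑ ^ 2 :=
    ⟨_, rfl⟩
  rw [← hX] at h1 heq
  -- Here X is the Fourier side, P the integral of the product and S that of the AM-GM sum. In
  -- general kX ≤ k(2π)^d P ≤ (2π)^d S; the hypothesis closes the cycle. The first equality makes
  -- the tensor product a function of the sum, the second gives equality in AM-GM wherever 0 < w <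
  -- ∞.
  have hkey : ENNReal.ofReal (2 * Real.pi) ^ d * S ≤ k * X := by
    rw [← ENNReal.mul_le_mul_iff_right hσ0 hσt]
    calc surfaceMeasure d Set.univ * (ENNReal.ofReal (2 * Real.pi) ^ d * S)
        = ENNReal.ofReal (2 * Real.pi) ^ d * (surfaceMeasure d Set.univ * S) := by ring
      _ = k * ((ENNReal.ofReal (2 * Real.pi) ^ d * ∫⁻ ζ, w (vsum ζ) ∂(sphPi d k)) *
          ∫⁻ ζ, ‖f ζ‖ₑ ^ (2 * k) ∂(surfaceMeasure d)) := by rw [h4]; ring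
      _ ≤ k * (surfaceMeasure d Set.univ * X) := by gcongr
      _ = _ := by ring
  have hp0 := two_pi_pow_ne_zero d
  have hpt' := two_pi_pow_ne_top d
  constructor
  · refine exists_factor_of_lintegral_fourierPush_sq_eq measurable_vsum hw hmap hw2 norm_vsum_le
      hFm (hP ▸ hPtop) ?_
    rw [← hP, ← hX, ← ENNReal.mul_le_mul_iff_right hk0 (ENNReal.natCast_ne_top k)]
    calc (k : ℝ≥0∞) * (ENNReal.ofReal (2 * Real.pi) ^ d * P)
        = ENNReal.ofReal (2 * Real.pi) ^ d * (k * P) := by ring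
      _ ≤ ENNReal.ofReal (2 * Real.pi) ^ d * S := by gcongr
      _ ≤ _ := hkey
  · have hSP : S ≤ k * P := by
      rw [← ENNReal.mul_le_mul_iff_right hp0 hpt']
      calc ENNReal.ofReal (2 * Real.pi) ^ d * S ≤ k * X := hkey
        _ ≤ k * (ENNReal.ofReal (2 * Real.pi) ^ d * P) := by gcongr
        _ = _ := by ring
    have hws : Measurable fun ζ : Fin k → Sphere d => w (vsum ζ) := hw.comp measurable_vsum
    have hae : ∀ᵐ ζ ∂(sphPi d k), k * (‖∏ i, f (ζ i)‖ₑ ^ 2 * w (vsum ζ)) =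
        (∑ i, ‖f (ζ i)‖ₑ ^ (2 * k)) * w (vsum ζ) := by
      refine ae_eq_of_ae_le_of_lintegral_le (.of_forall hpt) ?_ ?_ ?_
      · rw [lintegral_const_mul' _ _ (ENNReal.natCast_ne_top k), ← hP]
        finiteness
      · refine AEMeasurable.mul ?_ hws.aemeasurable
        exact Finset.aemeasurable_fun_sum _ fun i _ => (hf.comp_quasiMeasurePreserving
          (Measure.quasiMeasurePreserving_eval _ i)).enorm.pow_const _
      · rw [lintegral_const_mul' _ _ (ENNReal.natCast_ne_top k), ← hP, ← hS]
        exact hSP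
    refine exists_norm_eq_of_ae hd hk ?_
    filter_upwards [hae, ae_density_comp_ne_zero measurable_vsum hw hmap,
      ae_comp_of_ae measurable_vsum hmap (ae_density_lt_top hw2 hw)] with ζ h5 h6 h7
    rw [← mul_assoc, ENNReal.mul_left_inj h6 h7.ne, enorm_prod_sq] at h5
    exact (prod_enorm_sq_le_sum_pow hkne _).2 h5.ge

end SharpEven

/-! ### Moment identities from the functional equation. -/

section Identities

variable {d k : ℕ}

theorem integrable_mul_continuous {f φ : Sphere d → ℂ} (hf : Integrable f (surfaceMeasure d))
    (hφ : Continuous φ) : Integrable (fun ζ => f ζ * φ ζ) (surfaceMeasure d) := by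
  obtain ⟨C, hC⟩ := isCompact_univ.exists_bound_of_continuousOn hφ.continuousOn
  exact hf.mul_bdd (c := C) hφ.aestronglyMeasurable
    (.of_forall fun ζ => hC ζ (Set.mem_univ _))

theorem integral_mul_sphPi_two (u v : Sphere d → ℂ) :
    ∫ ζ, u (ζ 0) * v (ζ 1) ∂(sphPi d 2) =
      (∫ ζ, u ζ ∂(surfaceMeasure d)) * ∫ ζ, v ζ ∂(surfaceMeasure d) := by
  have := integral_fintype_prod_eq_prod (μ := fun _ : Fin 2 => surfaceMeasure d) (![u, v])
  simpa [Fin.prod_univ_two] using this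

theorem integrable_mul_sphPi_two {u v : Sphere d → ℂ} (hu : Integrable u (surfaceMeasure d))
    (hv : Integrable v (surfaceMeasure d)) :
    Integrable (fun ζ => u (ζ 0) * v (ζ 1)) (sphPi d 2) := by
  have := Integrable.fintype_prod (μ := fun _ : Fin 2 => surfaceMeasure d) (f := ![u, v])
    (by simpa [Fin.forall_fin_two] using ⟨hu, hv⟩)
  simpa [Fin.prod_univ_two] using this

theorem integral_mul_sphPi_three (u v w : Sphere d → ℂ) :
    ∫ ζ, u (ζ 0) * v (ζ 1) * w (ζ 2) ∂(sphPi d 3) =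
      (∫ ζ, u ζ ∂(surfaceMeasure d)) * (∫ ζ, v ζ ∂(surfaceMeasure d)) *
        ∫ ζ, w ζ ∂(surfaceMeasure d) := by
  have := integral_fintype_prod_eq_prod (μ := fun _ : Fin 3 => surfaceMeasure d) (![u, v, w])
  simpa [Fin.prod_univ_three] using this

theorem integrable_mul_sphPi_three {u v w : Sphere d → ℂ} (hu : Integrable u (surfaceMeasure d))
    (hv : Integrable v (surfaceMeasure d)) (hw : Integrable w (surfaceMeasure d)) :
    Integrable (fun ζ => u (ζ 0) * v (ζ 1) * w (ζ 2)) (sphPi d 3) := by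
  have := Integrable.fintype_prod (μ := fun _ : Fin 3 => surfaceMeasure d) (f := ![u, v, w])
    (by
      intro i
      fin_cases i
      · exact hu
      · exact hv
      · exact hw)
  simpa [Fin.prod_univ_three] using this

theorem integral_add_three {α : Type*} [MeasurableSpace α] {μ : Measure α} {u v w : α → ℂ}
    (hu : Integrable u μ) (hv : Integrable v μ) (hw : Integrable w μ) :
    ∫ x, (u x + v x + w x) ∂μ = ∫ x, u x ∂μ + ∫ x, v x ∂μ + ∫ x, w x ∂μ := by
  rw [← integral_add hu hv]
  exact integral_add (hu.add hv) hw

/-- A trilinear expression in products of functions of three points. -/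
def tripleSum (u₀ u₁ u₂ v₀ v₁ v₂ w₀ w₁ w₂ : Sphere d → ℂ) (ζ : Fin 3 → Sphere d) : ℂ :=
  u₀ (ζ 0) * u₁ (ζ 1) * u₂ (ζ 2) + v₀ (ζ 0) * v₁ (ζ 1) * v₂ (ζ 2) + w₀ (ζ 0) * w₁ (ζ 1) * w₂ (ζ 2)

theorem tripleSum_integral {u₀ u₁ u₂ v₀ v₁ v₂ w₀ w₁ w₂ : Sphere d → ℂ}
    (hu₀ : Integrable u₀ (surfaceMeasure d))
    (hu₁ : Integrable u₁ (surfaceMeasure d))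
    (hu₂ : Integrable u₂ (surfaceMeasure d))
    (hv₀ : Integrable v₀ (surfaceMeasure d))
    (hv₁ : Integrable v₁ (surfaceMeasure d))
    (hv₂ : Integrable v₂ (surfaceMeasure d))
    (hw₀ : Integrable w₀ (surfaceMeasure d))
    (hw₁ : Integrable w₁ (surfaceMeasure d))
    (hw₂ : Integrable w₂ (surfaceMeasure d)) :
    Integrable (tripleSum u₀ u₁ u₂ v₀ v₁ v₂ w₀ w₁ w₂) (sphPi d 3) ∧
    ∫ ζ, tripleSum u₀ u₁ u₂ v₀ v₁ v₂ w₀ w₁ w₂ ζ ∂(sphPi d 3) =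
      (∫ ζ, u₀ ζ ∂(surfaceMeasure d)) * (∫ ζ, u₁ ζ ∂(surfaceMeasure d)) *
        (∫ ζ, u₂ ζ ∂(surfaceMeasure d)) +
      (∫ ζ, v₀ ζ ∂(surfaceMeasure d)) * (∫ ζ, v₁ ζ ∂(surfaceMeasure d)) *
        (∫ ζ, v₂ ζ ∂(surfaceMeasure d)) +
      (∫ ζ, w₀ ζ ∂(surfaceMeasure d)) * (∫ ζ, w₁ ζ ∂(surfaceMeasure d)) *
        (∫ ζ, w₂ ζ ∂(surfaceMeasure d)) := by
  have h1 := integrable_mul_sphPi_three hu₀ hu₁ hu₂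
  have h2 := integrable_mul_sphPi_three hv₀ hv₁ hv₂
  have h3 := integrable_mul_sphPi_three hw₀ hw₁ hw₂
  refine ⟨(h1.add h2).add h3, ?_⟩
  rw [← integral_mul_sphPi_three, ← integral_mul_sphPi_three, ← integral_mul_sphPi_three]
  exact integral_add_three h1 h2 h3

/-- The function `ζ_i exp(z·ζ)` on the sphere. -/
def coordExp (z : Fin d → ℂ) (i : Fin d) (ζ : Sphere d) : ℂ := ((ζ : Space d) i : ℂ) * pexp z ζ

/-- The derivative of `exp(z·ζ)` under the rotation field in the `(j, k)`-plane. -/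
def skewExp (z : Fin d → ℂ) (j k : Fin d) (ζ : Sphere d) : ℂ :=
  (((ζ : Space d) j : ℂ) * z k - ((ζ : Space d) k : ℂ) * z j) * pexp z ζ

theorem continuous_coord (i : Fin d) : Continuous fun ζ : Sphere d => (((ζ : Space d) i : ℝ) : ℂ) :=
  Complex.continuous_ofReal.comp
    ((EuclideanSpace.proj (𝕜 := ℝ) i).continuous.comp continuous_subtype_val)

theorem continuous_coordExp (z : Fin d → ℂ) (i : Fin d) : Continuous (coordExp z i) :=
  (continuous_coord i).mul ((continuous_pexp z).comp continuous_subtype_val)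

theorem continuous_skewExp (z : Fin d → ℂ) (j k : Fin d) : Continuous (skewExp z j k) :=
  (((continuous_coord j).mul continuous_const).sub ((continuous_coord k).mul continuous_const)).mul
    ((continuous_pexp z).comp continuous_subtype_val)

theorem integral_skewExp (z : Fin d → ℂ) (j k : Fin d) :
    ∫ ζ, skewExp z j k ζ ∂(surfaceMeasure d) = 0 := integral_infRot_pexp z j k

theorem wave_mul_pexp (z : Fin d → ℂ) (ξ x : Space d) :
    wave x ξ * pexp z x = pexp (z + waveFreq ξ) x := by
  rw [pexp_add, pexp_waveFreq, mul_comm]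

/-- The moments `∫ f ζ_i exp(z·ζ)`. -/
def coordMoment (f : Sphere d → ℂ) (z : Fin d → ℂ) (i : Fin d) : ℂ :=
  ∫ ζ, f ζ * coordExp z i ζ ∂(surfaceMeasure d)

/-- The moments of `f` against the rotational derivatives of exponentials. -/
def skewMoment (f : Sphere d → ℂ) (z : Fin d → ℂ) (j k : Fin d) : ℂ :=
  ∫ ζ, f ζ * skewExp z j k ζ ∂(surfaceMeasure d)

/-- The source of all moment identities: a function of the sum is orthogonal to every integrable a
whose image under the sum map vanishes. -/
theorem integral_prod_mul_eq_zero {f : Sphere d → ℂ} {G : Space d → ℂ} (hG : Measurable G)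
    (h : ∀ᵐ ζ ∂(sphPi d k), ∏ i, f (ζ i) = G (vsum ζ)) {a : (Fin k → Sphere d) → ℂ}
    (ha : Integrable a (sphPi d k)) (hfa : Integrable (fun ζ => (∏ i, f (ζ i)) * a ζ) (sphPi d k))
    (h0 : ∀ ξ, fourierPush (sphPi d k) vsum a ξ = 0) :
    ∫ ζ, (∏ i, f (ζ i)) * a ζ ∂(sphPi d k) = 0 := by
  have e : (fun ζ => (∏ i, f (ζ i)) * a ζ) =ᵐ[sphPi d k] fun ζ => G (vsum ζ) * a ζ :=
    h.mono fun ζ hζ => by simp only [hζ]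
  rw [integral_congr_ae e]
  exact integral_comp_mul_eq_zero measurable_vsum ha h0 hG (hfa.congr e)

/-- The test function is the cyclic sum over (i,j,k) of ζ_i exp(z·ζ) tensored with a rotational
derivative of an exponential, symmetrized in the two points. A character at the sum shifts both
frequencies by the same vector ν. The extra terms are the 3×3 minors of (ζ₀,ζ₁,ν) and of (ζ₁,ζ₀,ν),
which cancel. What remains has mean zero because each term contains a rotational derivative, so the
image of the test function under the sum map vanishes. -/
theorem moment_identity_two {f : Sphere d → ℂ} (hf : Integrable f (surfaceMeasure d))
    {G : Space d → ℂ} (hG : Measurable G)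
    (h : ∀ᵐ ζ ∂(sphPi d 2), ∏ i, f (ζ i) = G (vsum ζ)) (z z' : Fin d → ℂ) (i j k : Fin d) :
    (coordMoment f z i * skewMoment f z' j k + skewMoment f z j k * coordMoment f z' i) +
    (coordMoment f z j * skewMoment f z' k i + skewMoment f z k i * coordMoment f z' j) +
    (coordMoment f z k * skewMoment f z' i j + skewMoment f z i j * coordMoment f z' k) = 0 := by
  have hc : ∀ z i, Integrable (coordExp z i) (surfaceMeasure d) := fun z i =>
    integrable_of_continuous_sphere (continuous_coordExp z i)
  have hs : ∀ z j k, Integrable (skewExp z j k) (surfaceMeasure d) := fun z j k =>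
    integrable_of_continuous_sphere (continuous_skewExp z j k)
  have hfc : ∀ z i, Integrable (fun ζ => f ζ * coordExp z i ζ) (surfaceMeasure d) := fun z i =>
    integrable_mul_continuous hf (continuous_coordExp z i)
  have hfs : ∀ z j k, Integrable (fun ζ => f ζ * skewExp z j k ζ) (surfaceMeasure d) :=
    fun z j k => integrable_mul_continuous hf (continuous_skewExp z j k)
  obtain ⟨E, hE⟩ : ∃ E : (Fin d → ℂ) → (Fin d → ℂ) → Fin d → Fin d → Fin d →
      (Fin 2 → Sphere d) → ℂ, E = fun z z' i j k ζ =>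
        coordExp z i (ζ 0) * skewExp z' j k (ζ 1) + skewExp z j k (ζ 0) * coordExp z' i (ζ 1) :=
    ⟨_, rfl⟩
  have hEi : ∀ z z' i j k, Integrable (E z z' i j k) (sphPi d 2) := by
    intro z z' i j k
    rw [hE]
    exact (integrable_mul_sphPi_two (hc z i) (hs z' j k)).add
      (integrable_mul_sphPi_two (hs z j k) (hc z' i))
  have hE0 : ∀ z z' i j k, ∫ ζ, E z z' i j k ζ ∂(sphPi d 2) = 0 := by
    intro z z' i j k
    rw [hE]
    rw [integral_add (integrable_mul_sphPi_two (hc z i) (hs z' j k))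
      (integrable_mul_sphPi_two (hs z j k) (hc z' i)), integral_mul_sphPi_two,
      integral_mul_sphPi_two, integral_skewExp, integral_skewExp]
    ring
  have hfE : ∀ z z' i j k, (fun ζ => (∏ i, f (ζ i)) * E z z' i j k ζ) = fun ζ : Fin 2 → Sphere d =>
      (f (ζ 0) * coordExp z i (ζ 0)) * (f (ζ 1) * skewExp z' j k (ζ 1)) +
      (f (ζ 0) * skewExp z j k (ζ 0)) * (f (ζ 1) * coordExp z' i (ζ 1)) := by
    intro z z' i j k
    ext ζ
    rw [hE, Fin.prod_univ_two]
    ring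
  have hfEi : ∀ z z' i j k, Integrable (fun ζ => (∏ i, f (ζ i)) * E z z' i j k ζ) (sphPi d 2) := by
    intro z z' i j k
    rw [hfE]
    exact (integrable_mul_sphPi_two (hfc z i) (hfs z' j k)).add
      (integrable_mul_sphPi_two (hfs z j k) (hfc z' i))
  have hfEint : ∀ z z' i j k, ∫ ζ, (∏ i, f (ζ i)) * E z z' i j k ζ ∂(sphPi d 2) =
      coordMoment f z i * skewMoment f z' j k + skewMoment f z j k * coordMoment f z' i := by
    intro z z' i j k
    rw [hfE, integral_add (integrable_mul_sphPi_two (hfc z i) (hfs z' j k))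
      (integrable_mul_sphPi_two (hfs z j k) (hfc z' i)),
      integral_mul_sphPi_two (fun ζ => f ζ * coordExp z i ζ) (fun ζ => f ζ * skewExp z' j k ζ),
      integral_mul_sphPi_two (fun ζ => f ζ * skewExp z j k ζ) (fun ζ => f ζ * coordExp z' i ζ)]
    rfl
  have key := integral_prod_mul_eq_zero hG h
    (a := fun ζ => E z z' i j k ζ + E z z' j k i ζ + E z z' k i j ζ)
    (((hEi z z' i j k).add (hEi z z' j k i)).add (hEi z z' k i j)) ?_ ?_
  · simp_rw [mul_add] at key
    rwa [integral_add_three (hfEi z z' i j k) (hfEi z z' j k i) (hfEi z z' k i j), hfEint, hfEint, hfEint] at key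
  · simp_rw [mul_add]
    exact ((hfEi z z' i j k).add (hfEi z z' j k i)).add (hfEi z z' k i j)
  · intro ξ
    have e : ∀ ζ : Fin 2 → Sphere d, wave (vsum ζ) ξ *
        (E z z' i j k ζ + E z z' j k i ζ + E z z' k i j ζ) =
        E (z + waveFreq ξ) (z' + waveFreq ξ) i j k ζ +
        E (z + waveFreq ξ) (z' + waveFreq ξ) j k i ζ +
        E (z + waveFreq ξ) (z' + waveFreq ξ) k i j ζ := by
      intro ζ
      simp only [hE, vsum, Fin.sum_univ_two, wave_add, coordExp, skewExp, ← wave_mul_pexp,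
        Pi.add_apply]
      ring
    rw [fourierPush, integral_congr_ae (.of_forall e),
      integral_add_three (hEi _ _ i j k) (hEi _ _ j k i) (hEi _ _ k i j), hE0, hE0, hE0]
    ring

/-- The analogue for three points within one coordinate plane. Here the extra terms created by a
frequency shift ν cancel by the Plücker relation [ζ₀,ν][ζ₁,ζ₂] + [ζ₁,ν][ζ₂,ζ₀] + [ζ₂,ν][ζ₀,ζ₁] = 0,
the brackets being the 2×2 minors in rows i and j. -/
theorem moment_identity_three {f : Sphere d → ℂ} (hf : Integrable f (surfaceMeasure d))
    {G : Space d → ℂ} (hG : Measurable G)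
    (h : ∀ᵐ ζ ∂(sphPi d 3), ∏ i, f (ζ i) = G (vsum ζ)) (z₀ z₁ z₂ : Fin d → ℂ) (i j : Fin d) :
    skewMoment f z₀ i j *
        (coordMoment f z₁ i * coordMoment f z₂ j - coordMoment f z₁ j * coordMoment f z₂ i) +
    skewMoment f z₁ i j *
        (coordMoment f z₂ i * coordMoment f z₀ j - coordMoment f z₂ j * coordMoment f z₀ i) +
    skewMoment f z₂ i j *
        (coordMoment f z₀ i * coordMoment f z₁ j - coordMoment f z₀ j * coordMoment f z₁ i) = 0 := by
  have hc : ∀ z i, Integrable (coordExp z i) (surfaceMeasure d) := fun z i =>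
    integrable_of_continuous_sphere (continuous_coordExp z i)
  have hs : ∀ z j k, Integrable (skewExp z j k) (surfaceMeasure d) := fun z j k =>
    integrable_of_continuous_sphere (continuous_skewExp z j k)
  have hfc : ∀ z i, Integrable (fun ζ => f ζ * coordExp z i ζ) (surfaceMeasure d) := fun z i =>
    integrable_mul_continuous hf (continuous_coordExp z i)
  have hfs : ∀ z j k, Integrable (fun ζ => f ζ * skewExp z j k ζ) (surfaceMeasure d) :=
    fun z j k => integrable_mul_continuous hf (continuous_skewExp z j k)
  obtain ⟨E, hE⟩ : ∃ E : (Fin d → ℂ) → (Fin d → ℂ) → (Fin d → ℂ) → Fin d → Fin d →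
      (Fin 3 → Sphere d) → ℂ, E = fun z₀ z₁ z₂ i j =>
        tripleSum (skewExp z₀ i j) (coordExp z₁ i) (coordExp z₂ j) (coordExp z₀ j)
          (skewExp z₁ i j) (coordExp z₂ i) (coordExp z₀ i) (coordExp z₁ j) (skewExp z₂ i j) :=
    ⟨_, rfl⟩
  have hEI : ∀ z₀ z₁ z₂ i j, Integrable (E z₀ z₁ z₂ i j) (sphPi d 3) ∧
      ∫ ζ, E z₀ z₁ z₂ i j ζ ∂(sphPi d 3) = 0 := by
    intro z₀ z₁ z₂ i j
    have := tripleSum_integral (hs z₀ i j) (hc z₁ i) (hc z₂ j) (hc z₀ j) (hs z₁ i j) (hc z₂ i)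
      (hc z₀ i) (hc z₁ j) (hs z₂ i j)
    simp only [integral_skewExp, zero_mul, mul_zero, add_zero] at this
    rw [hE]
    exact this
  have hEi := fun z₀ z₁ z₂ i j => (hEI z₀ z₁ z₂ i j).1
  have hE0 := fun z₀ z₁ z₂ i j => (hEI z₀ z₁ z₂ i j).2
  have hfEI : ∀ z₀ z₁ z₂ i j,
      Integrable (fun ζ => (∏ i, f (ζ i)) * E z₀ z₁ z₂ i j ζ) (sphPi d 3) ∧
      ∫ ζ, (∏ i, f (ζ i)) * E z₀ z₁ z₂ i j ζ ∂(sphPi d 3) =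
      skewMoment f z₀ i j * coordMoment f z₁ i * coordMoment f z₂ j +
      coordMoment f z₀ j * skewMoment f z₁ i j * coordMoment f z₂ i +
      coordMoment f z₀ i * coordMoment f z₁ j * skewMoment f z₂ i j := by
    intro z₀ z₁ z₂ i j
    have := tripleSum_integral (hfs z₀ i j) (hfc z₁ i) (hfc z₂ j) (hfc z₀ j) (hfs z₁ i j)
      (hfc z₂ i) (hfc z₀ i) (hfc z₁ j) (hfs z₂ i j)
    have e : (fun ζ => (∏ i, f (ζ i)) * E z₀ z₁ z₂ i j ζ) = tripleSum
        (fun ζ => f ζ * skewExp z₀ i j ζ) (fun ζ => f ζ * coordExp z₁ i ζ)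
        (fun ζ => f ζ * coordExp z₂ j ζ) (fun ζ => f ζ * coordExp z₀ j ζ)
        (fun ζ => f ζ * skewExp z₁ i j ζ) (fun ζ => f ζ * coordExp z₂ i ζ)
        (fun ζ => f ζ * coordExp z₀ i ζ) (fun ζ => f ζ * coordExp z₁ j ζ)
        (fun ζ => f ζ * skewExp z₂ i j ζ) := by
      ext ζ
      rw [hE, Fin.prod_univ_three]
      simp only [tripleSum]
      ring
    rw [e]
    exact this
  have hfEi := fun z₀ z₁ z₂ i j => (hfEI z₀ z₁ z₂ i j).1
  have hfEint := fun z₀ z₁ z₂ i j => (hfEI z₀ z₁ z₂ i j).2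
  have key := integral_prod_mul_eq_zero hG h
    (a := fun ζ => E z₀ z₁ z₂ i j ζ + E z₀ z₁ z₂ j i ζ)
    ((hEi z₀ z₁ z₂ i j).add (hEi z₀ z₁ z₂ j i)) ?_ ?_
  · simp_rw [mul_add] at key
    rw [integral_add (hfEi z₀ z₁ z₂ i j) (hfEi z₀ z₁ z₂ j i), hfEint, hfEint] at key
    have anti : ∀ z, skewMoment f z j i = -skewMoment f z i j := by
      intro z
      rw [skewMoment, skewMoment, ← integral_neg]
      congr with ζ
      simp only [skewExp]
      ring
    rw [anti, anti, anti] at key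
    linear_combination key
  · simp_rw [mul_add]
    exact (hfEi z₀ z₁ z₂ i j).add (hfEi z₀ z₁ z₂ j i)
  · intro ξ
    have e : ∀ ζ : Fin 3 → Sphere d, wave (vsum ζ) ξ *
        (E z₀ z₁ z₂ i j ζ + E z₀ z₁ z₂ j i ζ) =
        E (z₀ + waveFreq ξ) (z₁ + waveFreq ξ) (z₂ + waveFreq ξ) i j ζ +
        E (z₀ + waveFreq ξ) (z₁ + waveFreq ξ) (z₂ + waveFreq ξ) j i ζ := by
      intro ζ
      simp only [hE, tripleSum, vsum, Fin.sum_univ_three, wave_add, coordExp, skewExp,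
        ← wave_mul_pexp, Pi.add_apply]
      ring
    rw [fourierPush, integral_congr_ae (.of_forall e),
      integral_add (hEi _ _ _ i j) (hEi _ _ _ j i), hE0, hE0]
    ring

end Identities

/-! ### From polynomial identities to a single vector τ. -/

section LinearAlgebra

variable {d : ℕ}

/-- Pairs of a vector and a matrix. -/
abbrev VecMat (d : ℕ) : Type := (Fin d → ℂ) × (Fin d → Fin d → ℂ)

/-- The polarised wedge product of a vector and a matrix. -/
def wedge (p q : VecMat d) (i j k : Fin d) : ℂ :=
  (p.1 i * q.2 j k + p.2 j k * q.1 i) + (p.1 j * q.2 k i + p.2 k i * q.1 j) +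
    (p.1 k * q.2 i j + p.2 i j * q.1 k)

theorem wedge_span_eq_zero {T : Set (VecMat d)} {i j k : Fin d}
    (h : ∀ p ∈ T, ∀ q ∈ T, wedge p q i j k = 0) {p q : VecMat d}
    (hp : p ∈ Submodule.span ℂ T) (hq : q ∈ Submodule.span ℂ T) : wedge p q i j k = 0 := by
  induction hp using Submodule.span_induction with
  | mem p hp =>
    induction hq using Submodule.span_induction with
    | mem q hq => exact h p hp q hq
    | zero => simp [wedge]
    | add x y _ _ hx hy =>
      simp only [wedge, Prod.fst_add, Prod.snd_add, Pi.add_apply] at hx hy ⊢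
      linear_combination hx + hy
    | smul c x _ hx =>
      simp only [wedge, Prod.smul_fst, Prod.smul_snd, Pi.smul_apply, smul_eq_mul] at hx ⊢
      linear_combination c * hx
  | zero => simp [wedge]
  | add x y _ _ hx hy =>
    simp only [wedge, Prod.fst_add, Prod.snd_add, Pi.add_apply] at hx hy ⊢
    linear_combination hx + hy
  | smul c x _ hx =>
    simp only [wedge, Prod.smul_fst, Prod.smul_snd, Pi.smul_apply, smul_eq_mul] at hx ⊢
    linear_combination c * hx

theorem antisymm_span {T : Set (VecMat d)} (h : ∀ p ∈ T, ∀ j k, p.2 k j = -p.2 j k) {p : VecMat d}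
    (hp : p ∈ Submodule.span ℂ T) (j k : Fin d) : p.2 k j = -p.2 j k := by
  induction hp using Submodule.span_induction with
  | mem p hp => exact h p hp j k
  | zero => simp
  | add x y _ _ hx hy => simp [hx, hy, add_comm]
  | smul c x _ hx => simp [hx]

/-- A trilinear expression in planar vectors and matrices. -/
def planar (i j : Fin d) (p q r : VecMat d) : ℂ :=
  p.2 i j * (q.1 i * r.1 j - q.1 j * r.1 i)

theorem planar_span_eq_zero {T : Set (VecMat d)} {i j : Fin d}
    (h : ∀ p ∈ T, ∀ q ∈ T, ∀ r ∈ T, planar i j p q r + planar i j q r p + planar i j r p q = 0)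
    {p q r : VecMat d} (hp : p ∈ Submodule.span ℂ T) (hq : q ∈ Submodule.span ℂ T)
    (hr : r ∈ Submodule.span ℂ T) : planar i j p q r + planar i j q r p + planar i j r p q = 0 := by
  have step : ∀ {q r : VecMat d}, (∀ p ∈ T, planar i j p q r + planar i j q r p + planar i j r p q = 0) →
      ∀ p ∈ Submodule.span ℂ T, planar i j p q r + planar i j q r p + planar i j r p q = 0 := by
    intro q r h p hp
    induction hp using Submodule.span_induction with
    | mem p hp => exact h p hp
    | zero => simp [planar]
    | add x y _ _ hx hy =>
      simp only [planar, Prod.fst_add, Prod.snd_add, Pi.add_apply] at hx hy ⊢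
      linear_combination hx + hy
    | smul c x _ hx =>
      simp only [planar, Prod.smul_fst, Prod.smul_snd, Pi.smul_apply, smul_eq_mul] at hx ⊢
      linear_combination c * hx
  have cyc : ∀ {p q r : VecMat d}, planar i j p q r + planar i j q r p + planar i j r p q = 0 →
      planar i j q r p + planar i j r p q + planar i j p q r = 0 := by
    intro p q r h
    linear_combination h
  refine step (fun p hp => cyc (cyc (step (fun q hq => cyc (cyc (step (fun r hr =>
    cyc (cyc (h p hp q hq r hr))) r hr))) q hq))) p hp

/-- Wedging with a lift of the basis vector e_i shows that a pair with zero vector part is zero, so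
the matrix is a linear function of the vector. Applied to lifts of basis vectors, the identity kills
the entries away from row and column i and matches the others, which leaves v ∧ τ. -/
theorem exists_vector_of_wedge (hd : 3 ≤ d) {S : Submodule ℂ (VecMat d)}
    (hw : ∀ p ∈ S, ∀ q ∈ S, ∀ i j k, wedge p q i j k = 0)
    (ha : ∀ p ∈ S, ∀ j k, p.2 k j = -p.2 j k) (hs : ∀ v, ∃ p ∈ S, p.1 = v) :
    ∃ τ : Fin d → ℂ, ∀ p ∈ S, ∀ j k, p.2 j k = p.1 j * τ k - p.1 k * τ j := by
  choose b hb hb1 using fun m : Fin d => hs (Pi.single m 1)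
  have hker : ∀ p ∈ S, p.1 = 0 → ∀ j k, p.2 j k = 0 := by
    intro p hp h0 j k
    by_cases hjk : j = k
    · subst hjk
      have := ha p hp j j
      linear_combination this / 2
    -- A third index outside {j,k} is where d ≥ 3 is needed.
    · obtain ⟨i, hi⟩ : ∃ i, i ∉ ({j, k} : Finset (Fin d)) := by
        by_contra! hall
        have h1 : (Finset.univ : Finset (Fin d)) ⊆ {j, k} := fun i _ => hall i
        have h2 := (Finset.card_le_card h1).trans Finset.card_le_two
        rw [Finset.card_univ, Fintype.card_fin] at h2
        omega
      simp only [Finset.mem_insert, Finset.mem_singleton, not_or] at hi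
      have := hw (b i) (hb i) p hp i j k
      simpa [wedge, hb1, h0, Ne.symm hi.1, Ne.symm hi.2] using this
  have hexp : ∀ p ∈ S, ∀ j k, p.2 j k = ∑ m, p.1 m * (b m).2 j k := by
    intro p hp j k
    have h1 : p - ∑ m, p.1 m • b m ∈ S :=
      S.sub_mem hp (S.sum_mem fun m _ => S.smul_mem _ (hb m))
    have h2 := hker _ h1 (by
      ext n
      simp [Prod.fst_sum, hb1, Finset.sum_apply, Pi.single_apply]) j k
    simpa [Prod.snd_sum, Finset.sum_apply, sub_eq_zero] using h2
  have hoff : ∀ i j k : Fin d, i ≠ j → i ≠ k → (b i).2 j k = 0 := by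
    intro i j k hij hik
    have := hw (b i) (hb i) (b i) (hb i) i j k
    simp only [wedge, hb1, Pi.single_eq_same, Pi.single_eq_of_ne hij.symm,
      Pi.single_eq_of_ne hik.symm] at this
    linear_combination this / 2
  have hdiag : ∀ i j k : Fin d, i ≠ j → i ≠ k → j ≠ k → (b j).2 j k = (b i).2 i k := by
    intro i j k hij hik hjk
    have := hw (b i) (hb i) (b j) (hb j) i j k
    simp only [wedge, hb1, Pi.single_eq_same, Pi.single_eq_of_ne hij.symm,
      Pi.single_eq_of_ne hik.symm, Pi.single_eq_of_ne hij, Pi.single_eq_of_ne hjk.symm] at this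
    have h2 := ha (b i) (hb i) i k
    linear_combination this - h2
  have hτ : ∀ k : Fin d, ∃ t, ∀ j, j ≠ k → (b j).2 j k = t := by
    intro k
    obtain ⟨i, hi⟩ : ∃ i, i ≠ k := by
      have : Nontrivial (Fin d) := Fin.nontrivial_iff_two_le.2 (by omega)
      exact exists_ne k
    refine ⟨(b i).2 i k, fun j hj => ?_⟩
    by_cases hij : i = j
    · rw [hij]
    · exact hdiag i j k hij hi hj
  choose τ hτ using hτ
  refine ⟨τ, fun p hp j k => ?_⟩
  by_cases hjk : j = k
  · subst hjk
    have := ha p hp j j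
    linear_combination this / 2
  · rw [hexp p hp, Finset.sum_eq_add_of_mem j k (Finset.mem_univ _) (Finset.mem_univ _) hjk,
      hτ k j hjk, ha (b k) (hb k) k j, hτ j k (Ne.symm hjk)]
    · ring
    · intro m _ hm
      rw [hoff m j k hm.1 hm.2, mul_zero]

/-- In the plane an antisymmetric matrix has one free entry. The trilinear identity against lifts of
the two basis vectors shows that this entry is a linear form in the vector, and every linear form on
the plane is v ↦ v₀τ₁ - v₁τ₀ for some τ. -/
theorem exists_vector_of_planar {S : Submodule ℂ (VecMat 2)}
    (hw : ∀ p ∈ S, ∀ q ∈ S, ∀ r ∈ S, planar 0 1 p q r + planar 0 1 q r p + planar 0 1 r p q = 0)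
    (ha : ∀ p ∈ S, ∀ j k, p.2 k j = -p.2 j k) (hs : ∀ v, ∃ p ∈ S, p.1 = v) :
    ∃ τ : Fin 2 → ℂ, ∀ p ∈ S, ∀ j k, p.2 j k = p.1 j * τ k - p.1 k * τ j := by
  obtain ⟨q, hq, hq1⟩ := hs ![1, 0]
  obtain ⟨r, hr, hr1⟩ := hs ![0, 1]
  refine ⟨![-r.2 0 1, q.2 0 1], fun p hp => ?_⟩
  have h01 : p.2 0 1 = p.1 0 * q.2 0 1 + p.1 1 * r.2 0 1 := by
    have := hw p hp q hq r hr
    simp only [planar, hq1, hr1, Matrix.cons_val_zero, Matrix.cons_val_one] at this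
    linear_combination this
  have h10 := ha p hp 0 1
  have h00 := ha p hp 0 0
  have h11 := ha p hp 1 1
  rw [Fin.forall_fin_two, Fin.forall_fin_two, Fin.forall_fin_two]
  simp only [Matrix.cons_val_zero, Matrix.cons_val_one]
  refine ⟨⟨?_, ?_⟩, ?_, ?_⟩
  · linear_combination h00 / 2
  · linear_combination h01
  · linear_combination h10 - h01
  · linear_combination h11 / 2

end LinearAlgebra

/-! ### The moments of f span all vectors. -/

section Moments

variable {d k : ℕ}

theorem skewMoment_antisymm (f : Sphere d → ℂ) (z : Fin d → ℂ) (j k : Fin d) :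
    skewMoment f z k j = -skewMoment f z j k := by
  rw [skewMoment, skewMoment, ← integral_neg]
  congr with ζ
  simp only [skewExp]
  ring

/-- At frequencies z = -iξ the relation says that f(ζ)(c·ζ) has vanishing Fourier transform, so it
vanishes almost everywhere; and c·ζ is nonzero off a null set. -/
theorem ae_eq_zero_of_coordMoment {f : Sphere d → ℂ} (hf : Integrable f (surfaceMeasure d))
    {c : Fin d → ℂ} (hc : c ≠ 0) (h : ∀ z, ∑ i, c i * coordMoment f z i = 0) :
    f =ᵐ[surfaceMeasure d] 0 := by
  have hcont : Continuous fun ζ : Sphere d => cform c (ζ : Space d) :=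
    (cform c).continuous.comp continuous_subtype_val
  have h0 : (fun ζ : Sphere d => f ζ * cform c (ζ : Space d)) =ᵐ[surfaceMeasure d] 0 := by
    refine ae_eq_zero_of_fourierPush_eq_zero (s := ((↑) : Sphere d → Space d))
      (.subtype_coe Metric.isClosed_sphere.measurableSet) (integrable_mul_continuous hf hcont) ?_
    intro ξ
    rw [← h (waveFreq ξ), fourierPush]
    simp only [coordMoment]
    simp_rw [← integral_const_mul]
    rw [← integral_finsetSum _ fun i _ =>
      (integrable_mul_continuous hf (continuous_coordExp _ i)).const_mul _]
    congr with ζ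
    rw [cform_apply, Finset.mul_sum, Finset.mul_sum]
    refine Finset.sum_congr rfl fun i _ => ?_
    rw [coordExp, pexp_waveFreq]
    ring
  have hne : ∀ᵐ ζ : Sphere d ∂(surfaceMeasure d), cform c (ζ : Space d) ≠ 0 := by
    obtain ⟨i, hi⟩ := Function.ne_iff.1 hc
    have hre : ∀ ζ : Space d, (cform c ζ).re = inner ℝ (WithLp.toLp 2 fun i => (c i).re) ζ := by
      intro ζ
      simp [cform_apply, PiLp.inner_apply, mul_comm]
    have him : ∀ ζ : Space d, (cform c ζ).im = inner ℝ (WithLp.toLp 2 fun i => (c i).im) ζ := by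
      intro ζ
      simp [cform_apply, PiLp.inner_apply, mul_comm]
    -- The zeros of a nonzero complex linear form lie in the real hyperplane of its real or
    -- imaginary part, whichever is nonzero.
    by_cases hr : (c i).re = 0
    · have hv : (WithLp.toLp 2 fun i => (c i).im : Space d) ≠ 0 := by
        intro h
        have h2 := congrArg (fun v : Space d => v i) h
        exact hi (Complex.ext hr h2)
      rw [ae_iff]
      refine measure_mono_null (fun (ζ : Sphere d) hζ => ?_) (surfaceMeasure_hyperplane hv)
      simp only [ne_eq, not_not, Set.mem_ofPred_eq] at hζ ⊢
      rw [← him, hζ, Complex.zero_im]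
    · have hv : (WithLp.toLp 2 fun i => (c i).re : Space d) ≠ 0 := by
        intro h
        exact hr (congrArg (fun v : Space d => v i) h)
      rw [ae_iff]
      refine measure_mono_null (fun (ζ : Sphere d) hζ => ?_) (surfaceMeasure_hyperplane hv)
      simp only [ne_eq, not_not, Set.mem_ofPred_eq] at hζ ⊢
      rw [← hre, hζ, Complex.zero_re]
  filter_upwards [h0, hne] with ζ h1 h2
  simpa [h2] using h1

/-- The moments of `f`. -/
def momentSet (f : Sphere d → ℂ) : Set (VecMat d) :=
  Set.range fun z => (coordMoment f z, skewMoment f z)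

theorem momentSet_surjective {f : Sphere d → ℂ} (hf : Integrable f (surfaceMeasure d))
    (h0 : ¬ f =ᵐ[surfaceMeasure d] 0) (v : Fin d → ℂ) :
    ∃ p ∈ Submodule.span ℂ (momentSet f), p.1 = v := by
  suffices h : (Submodule.span ℂ (momentSet f)).map (LinearMap.fst ℂ _ _) = ⊤ by
    have hv : v ∈ (Submodule.span ℂ (momentSet f)).map (LinearMap.fst ℂ _ _) := h ▸ Submodule.mem_top
    simpa using hv
  by_contra hne
  obtain ⟨ℓ, hℓ0, hℓ⟩ := Submodule.exists_le_ker_of_lt_top _ (lt_top_iff_ne_top.2 hne)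
  have hrep : ∀ v : Fin d → ℂ, ℓ v = ∑ i, ℓ (Pi.single i 1) * v i := by
    intro v
    rw [ℓ.pi_apply_eq_sum_univ v]
    refine Finset.sum_congr rfl fun i _ => ?_
    rw [smul_eq_mul, mul_comm]
    congr 2
    ext j
    simp [Pi.single_apply, eq_comm]
  refine h0 (ae_eq_zero_of_coordMoment hf (c := fun i => ℓ (Pi.single i 1)) ?_ fun z => ?_)
  · intro hc
    refine hℓ0 (LinearMap.ext fun v => ?_)
    rw [hrep]
    simp [congrFun hc]
  · rw [← hrep]
    refine LinearMap.mem_ker.1 (hℓ ?_)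
    exact Submodule.mem_map.2 ⟨(coordMoment f z, skewMoment f z),
      Submodule.subset_span ⟨z, rfl⟩, rfl⟩

/-- The essential gain is that τ does not depend on the frequency z. This follows by passing from
the moments to their span, whose vector parts exhaust the space. -/
theorem exists_skewMoment_eq (hdk : 3 ≤ d ∧ k = 2 ∨ d = 2 ∧ k = 3) {f : Sphere d → ℂ}
    (hf : Integrable f (surfaceMeasure d)) (h0 : ¬ f =ᵐ[surfaceMeasure d] 0)
    {G : Space d → ℂ} (hG : Measurable G)
    (h : ∀ᵐ ζ ∂(sphPi d k), ∏ i, f (ζ i) = G (vsum ζ)) :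
    ∃ τ : Fin d → ℂ, ∀ z j k, skewMoment f z j k =
      coordMoment f z j * τ k - coordMoment f z k * τ j := by
  have hsurj := momentSet_surjective hf h0
  have hanti : ∀ p ∈ Submodule.span ℂ (momentSet f), ∀ j k, p.2 k j = -p.2 j k := by
    refine fun p hp => antisymm_span ?_ hp
    rintro _ ⟨z, rfl⟩ j k
    exact skewMoment_antisymm f z j k
  obtain ⟨τ, hτ⟩ : ∃ τ : Fin d → ℂ, ∀ p ∈ Submodule.span ℂ (momentSet f), ∀ j k,
      p.2 j k = p.1 j * τ k - p.1 k * τ j := by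
    rcases hdk with ⟨hd, rfl⟩ | ⟨rfl, rfl⟩
    · refine exists_vector_of_wedge hd (fun p hp q hq i j k => wedge_span_eq_zero ?_ hp hq) hanti
        hsurj
      rintro _ ⟨z, rfl⟩ _ ⟨z', rfl⟩
      exact moment_identity_two hf hG h z z' i j k
    · refine exists_vector_of_planar (fun p hp q hq r hr => planar_span_eq_zero ?_ hp hq hr) hanti
        hsurj
      rintro _ ⟨z, rfl⟩ _ ⟨z', rfl⟩ _ ⟨z'', rfl⟩
      exact moment_identity_three hf hG h z z' z'' 0 1
  exact ⟨τ, fun z => hτ _ (Submodule.subset_span ⟨z, rfl⟩)⟩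

end Moments

/-! ### Vanishing rotational moments force a constant. -/

section Radial

variable {d k : ℕ}

theorem extension_eq_fourierPush (f : Sphere d → ℂ) :
    extension d f = fourierPush (surfaceMeasure d) (↑) f := rfl

theorem integrable_sphere_wave_mul {g : Sphere d → ℂ} (hg : Integrable g (surfaceMeasure d))
    (ξ : Space d) : Integrable (fun ζ : Sphere d => wave ζ ξ * g ζ) (surfaceMeasure d) :=
  integrable_wave_mul measurable_subtype_coe hg ξ

/-- Up to the factor -i this is the derivative of the transform of gσ at c in the tangential
direction η. It arises by contracting the rotational moments at frequency -ic with the coefficients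
η_j c_k, where orthogonality of c and η leaves the factor ‖c‖². -/
theorem integral_inner_mul_wave_eq_zero {g : Sphere d → ℂ} (hg : Integrable g (surfaceMeasure d))
    (h : ∀ z j k, skewMoment g z j k = 0) {c η : Space d} (hc : c ≠ 0) (hη : inner ℝ c η = 0) :
    ∫ ζ : Sphere d, ((inner ℝ (ζ : Space d) η : ℝ) : ℂ) * (wave ζ c * g ζ)
      ∂(surfaceMeasure d) = 0 := by
  have h1 : ∑ j, ∑ k, ((η j * c k : ℝ) : ℂ) * skewMoment g (waveFreq c) j k = 0 := by
    simp [h]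
  simp only [skewMoment] at h1
  simp_rw [← integral_const_mul] at h1
  have hi : ∀ j k, Integrable (fun ζ => ((η j * c k : ℝ) : ℂ) * (g ζ * skewExp (waveFreq c) j k ζ))
      (surfaceMeasure d) := fun j k =>
    (integrable_mul_continuous hg (continuous_skewExp _ j k)).const_mul _
  simp_rw [← integral_finsetSum _ fun k _ => hi _ k] at h1
  rw [← integral_finsetSum _ fun j _ => integrable_finsetSum _ fun k _ => hi j k] at h1
  have e : ∀ ζ : Sphere d, ∑ j, ∑ k, ((η j * c k : ℝ) : ℂ) * (g ζ * skewExp (waveFreq c) j k ζ) =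
      (-(Complex.I * ((‖c‖ ^ 2 : ℝ) : ℂ))) *
        (((inner ℝ (ζ : Space d) η : ℝ) : ℂ) * (wave ζ c * g ζ)) := by
    intro ζ
    have e1 : ∀ j k, ((η j * c k : ℝ) : ℂ) * (g ζ * skewExp (waveFreq c) j k ζ) =
        -(Complex.I * (wave ζ c * g ζ)) *
          (((ζ : Space d) j * η j * (c k * c k) - η j * c j * ((ζ : Space d) k * c k) : ℝ) : ℂ) := by
      intro j k
      simp only [skewExp, pexp_waveFreq, waveFreq]
      push_cast
      ring
    simp_rw [e1, ← Finset.mul_sum, ← Complex.ofReal_sum]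
    have e2 : ∑ j, ∑ k, ((ζ : Space d) j * η j * (c k * c k) - η j * c j * ((ζ : Space d) k * c k)) =
        ‖c‖ ^ 2 * inner ℝ (ζ : Space d) η := by
      simp_rw [Finset.sum_sub_distrib, ← Finset.mul_sum, ← Finset.sum_mul]
      have a1 : ∑ j, (ζ : Space d) j * η j = inner ℝ (ζ : Space d) η := by
        simp [PiLp.inner_apply, mul_comm]
      have a2 : ∑ k, c k * c k = ‖c‖ ^ 2 := by
        simp_rw [EuclideanSpace.norm_sq_eq, Real.norm_eq_abs, sq_abs, sq]
      have a3 : ∑ j, η j * c j = 0 := by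
        rw [← hη]
        simp [PiLp.inner_apply]
      rw [a1, a2, a3]
      ring
    rw [e2]
    push_cast
    ring
  simp_rw [e] at h1
  rw [integral_const_mul] at h1
  refine (mul_eq_zero.1 h1).resolve_left ?_
  simp [hc]

/-- Along a circle centred at the origin the velocity is orthogonal to the position, so the
tangential derivative vanishes identically. -/
theorem extension_circle {g : Sphere d → ℂ} (hg : Integrable g (surfaceMeasure d))
    (h : ∀ z j k, skewMoment g z j k = 0) {x y : Space d} (hx : x ≠ 0) (hxy : ‖x‖ = ‖y‖)
    (h0 : inner ℝ x y = 0) (t : ℝ) :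
    extension d g (Real.cos t • x + Real.sin t • y) = extension d g x := by
  have hc : ∀ t : ℝ, HasDerivAt (fun t : ℝ => Real.cos t • x + Real.sin t • y)
      (-Real.sin t • x + Real.cos t • y) t := fun t =>
    ((Real.hasDerivAt_cos t).smul_const x).add ((Real.hasDerivAt_sin t).smul_const y)
  have horth : ∀ t : ℝ, inner ℝ (Real.cos t • x + Real.sin t • y)
      (-Real.sin t • x + Real.cos t • y) = 0 := by
    intro t
    simp only [inner_add_left, inner_add_right, inner_smul_left, inner_smul_right,
      real_inner_self_eq_norm_sq, h0, real_inner_comm x y, hxy, conj_trivial]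
    ring
  have hne : ∀ t : ℝ, Real.cos t • x + Real.sin t • y ≠ 0 := by
    intro t h1
    have h2 : ‖Real.cos t • x + Real.sin t • y‖ ^ 2 = ‖x‖ ^ 2 := by
      rw [norm_add_sq_real, norm_smul, norm_smul, inner_smul_left, inner_smul_right, h0, ← hxy]
      simp only [Real.norm_eq_abs, mul_pow, sq_abs, conj_trivial, mul_zero, add_zero]
      rw [← add_mul, Real.cos_sq_add_sin_sq, one_mul]
    rw [h1, norm_zero, zero_pow two_ne_zero] at h2
    exact hx (by simpa using h2.symm)
  have hd : ∀ t : ℝ, HasDerivAt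
      (fun t : ℝ => extension d g (Real.cos t • x + Real.sin t • y)) 0 t := by
    intro t
    have hF' : ∀ (ζ : Sphere d) (t : ℝ), HasDerivAt
        (fun t : ℝ => wave ζ (Real.cos t • x + Real.sin t • y) * g ζ)
        (-Complex.I * (((inner ℝ (ζ : Space d) (-Real.sin t • x + Real.cos t • y) : ℝ) : ℂ) *
          (wave ζ (Real.cos t • x + Real.sin t • y) * g ζ))) t := by
      intro ζ t
      have h1 : HasDerivAt (fun t : ℝ => (inner ℝ (ζ : Space d)
          (Real.cos t • x + Real.sin t • y) : ℝ))
          (inner ℝ (ζ : Space d) (-Real.sin t • x + Real.cos t • y)) t := by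
        have := (hasDerivAt_const t (ζ : Space d)).inner ℝ (hc t)
        simpa using this
      have h2 := ((h1.ofReal_comp.const_mul Complex.I).neg.cexp).mul_const (g ζ)
      refine h2.congr_deriv ?_
      simp only [wave, Pi.neg_apply]
      ring
    have key := hasDerivAt_integral_of_dominated_loc_of_deriv_le (μ := surfaceMeasure d)
      (F := fun (t : ℝ) (ζ : Sphere d) => wave ζ (Real.cos t • x + Real.sin t • y) * g ζ)
      (F' := fun (t : ℝ) (ζ : Sphere d) =>
        -Complex.I * (((inner ℝ (ζ : Space d) (-Real.sin t • x + Real.cos t • y) : ℝ) : ℂ) *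
          (wave ζ (Real.cos t • x + Real.sin t • y) * g ζ))) (x₀ := t) (s := Set.univ)
      (bound := fun ζ => (‖x‖ + ‖y‖) * ‖g ζ‖) Filter.univ_mem
      (.of_forall fun t => (integrable_sphere_wave_mul hg _).aestronglyMeasurable)
      (integrable_sphere_wave_mul hg _) ?_ ?_ (hg.norm.const_mul _)
      (.of_forall fun ζ t _ => hF' ζ t)
    · refine key.2.congr_deriv ?_
      rw [integral_const_mul, integral_inner_mul_wave_eq_zero hg h (hne t) (horth t), mul_zero]
    · refine AEStronglyMeasurable.const_mul (AEStronglyMeasurable.mul ?_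
        (integrable_sphere_wave_mul hg _).aestronglyMeasurable) _
      exact (Complex.continuous_ofReal.comp
        (continuous_subtype_val.inner continuous_const)).aestronglyMeasurable
    · refine .of_forall fun ζ t _ => ?_
      rw [norm_mul, norm_mul, norm_mul, norm_neg, Complex.norm_I, one_mul, norm_wave, one_mul,
        Complex.norm_real]
      gcongr
      refine (norm_inner_le_norm _ _).trans ?_
      rw [norm_coe_sphere, one_mul]
      refine (norm_add_le _ _).trans ?_
      rw [norm_smul, norm_smul, Real.norm_eq_abs, Real.norm_eq_abs, abs_neg]
      gcongr
      · exact mul_le_of_le_one_left (norm_nonneg _) (Real.abs_sin_le_one t)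
      · exact mul_le_of_le_one_left (norm_nonneg _) (Real.abs_cos_le_one t)
  have := is_const_of_deriv_eq_zero (fun t => (hd t).differentiableAt) (fun t => (hd t).deriv) t 0
  simpa using this

theorem exists_orthogonal_norm_eq (hd : 2 ≤ d) {x : Space d} (hx : x ≠ 0) :
    ∃ y : Space d, ‖y‖ = ‖x‖ ∧ inner ℝ x y = 0 := by
  obtain ⟨n, rfl⟩ : ∃ n, d = n + 1 := ⟨d - 1, by omega⟩
  have hfact : Fact (Module.finrank ℝ (Space (n + 1)) = n + 1) := ⟨by simp⟩
  have h1 := Submodule.finrank_orthogonal_span_singleton (𝕜 := ℝ) (n := n) hx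
  have h2 : (ℝ ∙ x)ᗮ ≠ ⊥ := by
    intro h
    rw [h, finrank_bot] at h1
    omega
  obtain ⟨y, hy, hy0⟩ := Submodule.exists_mem_ne_zero_of_ne_bot h2
  refine ⟨(‖x‖ / ‖y‖) • y, ?_, ?_⟩
  · rw [norm_smul, norm_div, norm_norm, norm_norm, div_mul_cancel₀ _ (norm_ne_zero_iff.2 hy0)]
  · rw [inner_smul_right, Submodule.mem_orthogonal_singleton_iff_inner_right.1 hy, mul_zero]

theorem exists_circle (hd : 2 ≤ d) {x y : Space d} (hx : x ≠ 0) (hxy : ‖y‖ = ‖x‖) :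
    ∃ (e : Space d) (t : ℝ), ‖x‖ = ‖e‖ ∧ inner ℝ x e = 0 ∧
      y = Real.cos t • x + Real.sin t • e := by
  have hx' : ‖x‖ ≠ 0 := norm_ne_zero_iff.2 hx
  obtain ⟨e, a, s, he, hxe, hy⟩ : ∃ (e : Space d) (a s : ℝ), ‖x‖ = ‖e‖ ∧ inner ℝ x e = 0 ∧
      y = a • x + s • e := by
    set a : ℝ := inner ℝ x y / ‖x‖ ^ 2 with ha
    by_cases hb : y - a • x = 0
    · obtain ⟨e, he, hxe⟩ := exists_orthogonal_norm_eq hd hx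
      exact ⟨e, a, 0, he.symm, hxe, by rw [zero_smul, add_zero]; exact sub_eq_zero.1 hb⟩
    · have hb' : ‖y - a • x‖ ≠ 0 := norm_ne_zero_iff.2 hb
      refine ⟨(‖x‖ / ‖y - a • x‖) • (y - a • x), a, ‖y - a • x‖ / ‖x‖, ?_, ?_, ?_⟩
      · rw [norm_smul, norm_div, norm_norm, norm_norm, div_mul_cancel₀ _ hb']
      · rw [inner_smul_right, inner_sub_right, inner_smul_right, real_inner_self_eq_norm_sq, ha,
          div_mul_cancel₀ _ (by positivity), sub_self, mul_zero]
      · rw [smul_smul, div_mul_div_cancel₀ hx', div_self hb', one_smul]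
        abel
  have has : a ^ 2 + s ^ 2 = 1 := by
    have h1 : ‖y‖ ^ 2 = (a ^ 2 + s ^ 2) * ‖x‖ ^ 2 := by
      rw [hy, norm_add_sq_real, norm_smul, norm_smul, inner_smul_left, inner_smul_right, hxe, ← he]
      simp only [Real.norm_eq_abs, mul_pow, sq_abs, mul_zero, add_zero]
      ring
    rw [hxy] at h1
    have h2 : ‖x‖ ^ 2 ≠ 0 := by positivity
    field_simp at h1
    exact h1.symm
  have hn : ‖(⟨a, s⟩ : ℂ)‖ = 1 := by
    rw [Complex.norm_def, Complex.normSq_mk, ← sq, ← sq, has, Real.sqrt_one]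
  have hn0 : (⟨a, s⟩ : ℂ) ≠ 0 := norm_ne_zero_iff.1 (by rw [hn]; exact one_ne_zero)
  refine ⟨e, Complex.arg ⟨a, s⟩, he, hxe, ?_⟩
  rw [Complex.cos_arg hn0, Complex.sin_arg, hn, div_one, div_one]
  exact hy

theorem extension_eq_of_norm_eq (hd : 2 ≤ d) {g : Sphere d → ℂ}
    (hg : Integrable g (surfaceMeasure d)) (h : ∀ z j k, skewMoment g z j k = 0) {x y : Space d}
    (hxy : ‖y‖ = ‖x‖) : extension d g y = extension d g x := by
  by_cases hx : x = 0
  · rw [hx, norm_zero, norm_eq_zero] at hxy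
    rw [hx, hxy]
  · obtain ⟨e, t, he, hxe, rfl⟩ := exists_circle hd hx hxy
    exact extension_circle hg h hx he hxe t

theorem extension_one_isometry (L : Space d ≃ₗᵢ[ℝ] Space d) (ξ : Space d) :
    extension d (fun _ => 1) (L ξ) = extension d (fun _ => 1) ξ := by
  have h := (measurePreserving_sphereMap L).integral_comp (measurableEmbedding_sphereMap L)
    (fun ζ : Sphere d => wave ζ (L ξ) * 1)
  refine h.symm.trans ?_
  refine integral_congr_ae (.of_forall fun ζ => ?_)
  simp only [wave, coe_sphereMap, L.inner_map_map]

theorem integral_extension_smul {g : Sphere d → ℂ} (hg : Integrable g (surfaceMeasure d)) (r : ℝ) :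
    ∫ u : Sphere d, extension d g (r • (u : Space d)) ∂(surfaceMeasure d) =
      ∫ ζ : Sphere d, ∫ u : Sphere d, wave ζ (r • (u : Space d)) * g ζ
        ∂(surfaceMeasure d) ∂(surfaceMeasure d) := by
  have hi : Integrable (fun p : Sphere d × Sphere d => g p.2)
      ((surfaceMeasure d).prod (surfaceMeasure d)) := hg.comp_snd (surfaceMeasure d)
  have hm : Measurable fun p : Sphere d × Sphere d => wave p.2 (r • (p.1 : Space d)) :=
    measurable_wave (measurable_subtype_coe.comp measurable_snd)
      (show Measurable fun p : Sphere d × Sphere d => r • (p.1 : Space d) from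
        (measurable_subtype_coe.comp measurable_fst).const_smul r)
  have hj : Integrable (fun p : Sphere d × Sphere d => wave p.2 (r • (p.1 : Space d)) * g p.2)
      ((surfaceMeasure d).prod (surfaceMeasure d)) :=
    hi.bdd_mul (c := 1) hm.aestronglyMeasurable (.of_forall fun p => (norm_wave _ _).le)
  exact integral_integral_swap
    (f := fun u ζ : Sphere d => wave ζ (r • (u : Space d)) * g ζ) hj

/-- The transform of gσ is radial, hence equal to its average over directions. By Fubini and the
symmetry of the inner product that average is a multiple of (∫g) times the transform of σ, and
injectivity of the Fourier transform identifies g with its mean. -/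
theorem ae_eq_const_of_skewMoment (hd : 2 ≤ d) {g : Sphere d → ℂ}
    (hg : Integrable g (surfaceMeasure d)) (h : ∀ z j k, skewMoment g z j k = 0) :
    ∃ c : ℂ, ∀ᵐ ζ ∂(surfaceMeasure d), g ζ = c := by
  have hd0 : d ≠ 0 := by omega
  have hσ : (surfaceMeasure d).real Set.univ ≠ 0 :=
    (ENNReal.toReal_pos (surfaceMeasure_univ_ne_zero hd0) (measure_ne_top _ _)).ne'
  have hσ' : ((surfaceMeasure d).real Set.univ : ℂ) ≠ 0 := by exact_mod_cast hσ
  have key : ∀ ξ, ((surfaceMeasure d).real Set.univ : ℂ) * extension d g ξ =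
      (∫ ζ, g ζ ∂(surfaceMeasure d)) * extension d (fun _ => 1) ξ := by
    intro ξ
    have h1 : ∫ u : Sphere d, extension d g (‖ξ‖ • (u : Space d)) ∂(surfaceMeasure d) =
        ((surfaceMeasure d).real Set.univ : ℂ) * extension d g ξ := by
      have : ∀ u : Sphere d, extension d g (‖ξ‖ • (u : Space d)) = extension d g ξ := fun u =>
        extension_eq_of_norm_eq hd hg h (by rw [norm_smul, norm_norm, norm_coe_sphere, mul_one])
      simp_rw [this]
      rw [integral_const, Complex.real_smul]
    have h2 : ∀ ζ : Sphere d, ∫ u : Sphere d, wave ζ (‖ξ‖ • (u : Space d)) * g ζ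
        ∂(surfaceMeasure d) = g ζ * extension d (fun _ => 1) ξ := by
      intro ζ
      obtain ⟨L, hL⟩ := exists_isometry_apply_eq (x := ξ) (y := ‖ξ‖ • (ζ : Space d))
        (by rw [norm_smul, norm_norm, norm_coe_sphere, mul_one])
      rw [integral_mul_const, mul_comm, ← extension_one_isometry L ξ, hL]
      congr 1
      refine integral_congr_ae (.of_forall fun u => ?_)
      simp only [wave, inner_smul_right, mul_one, real_inner_comm (ζ : Space d) (u : Space d)]
    rw [← h1, integral_extension_smul hg ‖ξ‖]
    simp_rw [h2]
    exact integral_mul_const _ _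
  refine ⟨(∫ ζ, g ζ ∂(surfaceMeasure d)) / ((surfaceMeasure d).real Set.univ : ℂ), ?_⟩
  obtain ⟨m, hm⟩ : ∃ m, m = ∫ ζ, g ζ ∂(surfaceMeasure d) := ⟨_, rfl⟩
  rw [← hm] at key ⊢
  have h0 : (fun ζ => g ζ - m / ((surfaceMeasure d).real Set.univ : ℂ)) =ᵐ[surfaceMeasure d] 0 := by
    refine ae_eq_zero_of_fourierPush_eq_zero (s := ((↑) : Sphere d → Space d))
      (.subtype_coe Metric.isClosed_sphere.measurableSet) (hg.sub (integrable_const _)) ?_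
    intro ξ
    have e : ∀ ζ : Sphere d, wave ζ ξ * (g ζ - m / ((surfaceMeasure d).real Set.univ : ℂ)) =
        wave ζ ξ * g ζ - m / ((surfaceMeasure d).real Set.univ : ℂ) * (wave ζ ξ * 1) := fun ζ => by
      ring
    rw [fourierPush]
    simp_rw [e]
    rw [integral_sub (integrable_sphere_wave_mul hg ξ)
      ((integrable_sphere_wave_mul (integrable_const 1) ξ).const_mul _), integral_const_mul]
    have hk := key ξ
    simp only [extension_eq_fourierPush, fourierPush] at hk
    refine mul_left_cancel₀ hσ' ?_
    rw [mul_sub, hk, ← mul_assoc, mul_div_cancel₀ _ hσ', sub_self, mul_zero]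
  filter_upwards [h0] with ζ hζ
  exact sub_eq_zero.1 hζ

end Radial

/-! ### Solutions of the functional equation. -/

section Classification

variable {d k : ℕ}

theorem pexp_neg_mul (z : Fin d → ℂ) (x : Space d) : pexp (-z) x * pexp z x = 1 := by
  rw [← pexp_add, neg_add_cancel, pexp, cform_apply]
  simp

/-- Multiplying f by exp(τ·ζ) shifts the frequency by τ, and the resulting correction to the
rotational moments is exactly the v ∧ τ found before. All rotational moments of the product
therefore vanish, and the product is constant. -/
theorem ae_eq_pexp_of_prod_eq_comp_of_card (hdk : 3 ≤ d ∧ k = 2 ∨ d = 2 ∧ k = 3) {f : Sphere d → ℂ}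
    (hf : Integrable f (surfaceMeasure d)) (h0 : ¬ f =ᵐ[surfaceMeasure d] 0)
    {G : Space d → ℂ} (hG : Measurable G)
    (h : ∀ᵐ ζ ∂(sphPi d k), ∏ i, f (ζ i) = G (vsum ζ)) :
    ∃ (c : ℂ) (z : Fin d → ℂ), c ≠ 0 ∧ ∀ᵐ ζ : Sphere d ∂(surfaceMeasure d), f ζ = c * pexp z ζ := by
  obtain ⟨τ, hτ⟩ := exists_skewMoment_eq hdk hf h0 hG h
  have hg : Integrable (fun ζ : Sphere d => f ζ * pexp τ ζ) (surfaceMeasure d) :=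
    integrable_mul_continuous hf ((continuous_pexp τ).comp continuous_subtype_val)
  have hskew : ∀ z j k, skewMoment (fun ζ => f ζ * pexp τ ζ) z j k = 0 := by
    intro z j k
    have h1 := hτ (z + τ) j k
    rw [← sub_eq_zero] at h1
    simp only [coordMoment, skewMoment] at h1
    rw [← integral_mul_const, ← integral_mul_const, ← integral_sub, ← integral_sub] at h1
    · rw [← h1, skewMoment]
      congr with ζ
      simp only [skewExp, coordExp, pexp_add, Pi.add_apply]
      ring
    · exact integrable_mul_continuous hf (continuous_skewExp _ _ _)
    · exact ((integrable_mul_continuous hf (continuous_coordExp _ _)).mul_const _).sub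
        ((integrable_mul_continuous hf (continuous_coordExp _ _)).mul_const _)
    · exact (integrable_mul_continuous hf (continuous_coordExp _ _)).mul_const _
    · exact (integrable_mul_continuous hf (continuous_coordExp _ _)).mul_const _
  obtain ⟨c, hc⟩ := ae_eq_const_of_skewMoment (by omega) hg hskew
  have hfc : ∀ᵐ ζ : Sphere d ∂(surfaceMeasure d), f ζ = c * pexp (-τ) ζ := by
    filter_upwards [hc] with ζ hζ
    rw [← hζ, mul_assoc, mul_comm (pexp τ _), pexp_neg_mul, mul_one]
  refine ⟨c, -τ, fun h => h0 ?_, hfc⟩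
  filter_upwards [hfc] with ζ hζ
  rw [hζ, h, zero_mul, Pi.zero_apply]

/-- Freeze one generic point η with f(η) ≠ 0 and divide. This reduces the number of points to the
least value available in the given dimension. -/
theorem exists_prod_eq_comp_of_succ {f : Sphere d → ℂ} (h0 : ¬ f =ᵐ[surfaceMeasure d] 0)
    {G : Space d → ℂ} (hG : Measurable G)
    (h : ∀ᵐ ζ ∂(sphPi d (k + 1)), ∏ i, f (ζ i) = G (vsum ζ)) :
    ∃ G : Space d → ℂ, Measurable G ∧ ∀ᵐ ζ ∂(sphPi d k), ∏ i, f (ζ i) = G (vsum ζ) := by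
  have h1 : ∃ᶠ η in ae (surfaceMeasure d), f η ≠ 0 := Filter.not_eventually.1 h0
  obtain ⟨η, hη0, hη⟩ := (h1.and_eventually (sphPi_ae_succ h)).exists
  refine ⟨fun x => (f η)⁻¹ * G (η + x), ?_, hη.mono fun ζ hζ => ?_⟩
  · exact (hG.comp (measurable_const.add measurable_id)).const_mul _
  · rw [vsum_cons, Fin.prod_univ_succ] at hζ
    simp only [Fin.cons_zero, Fin.cons_succ] at hζ
    change ∏ i, f (ζ i) = (f η)⁻¹ * G (η + vsum ζ)
    rw [← hζ, inv_mul_cancel_left₀ hη0]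

/-- The functions on the sphere whose tensor power is a function of the sum are the exponentials of
complex linear forms. -/
theorem ae_eq_pexp_of_prod_eq_comp (hdk : 3 ≤ d ∧ 2 ≤ k ∨ d = 2 ∧ 3 ≤ k) {f : Sphere d → ℂ}
    (hf : Integrable f (surfaceMeasure d)) (h0 : ¬ f =ᵐ[surfaceMeasure d] 0)
    (h : ∃ G : Space d → ℂ, Measurable G ∧ ∀ᵐ ζ ∂(sphPi d k), ∏ i, f (ζ i) = G (vsum ζ)) :
    ∃ (c : ℂ) (z : Fin d → ℂ), c ≠ 0 ∧ ∀ᵐ ζ : Sphere d ∂(surfaceMeasure d), f ζ = c * pexp z ζ := by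
  rcases hdk with ⟨hd, hk⟩ | ⟨rfl, hk⟩
  · induction k, hk using Nat.le_induction with
    | base =>
      obtain ⟨G, hG, h⟩ := h
      exact ae_eq_pexp_of_prod_eq_comp_of_card (Or.inl ⟨hd, rfl⟩) hf h0 hG h
    | succ k _ ih =>
      obtain ⟨G, hG, h⟩ := h
      exact ih (exists_prod_eq_comp_of_succ h0 hG h)
  · induction k, hk using Nat.le_induction with
    | base =>
      obtain ⟨G, hG, h⟩ := h
      exact ae_eq_pexp_of_prod_eq_comp_of_card (Or.inr ⟨rfl, rfl⟩) hf h0 hG h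
    | succ k _ ih =>
      obtain ⟨G, hG, h⟩ := h
      exact ih (exists_prod_eq_comp_of_succ h0 hG h)

end Classification

/-! ### Characters as extremizers and the passage to larger exponents. -/

section Exponentials

variable {d k : ℕ}

/-- The character `ζ ↦ exp(i ξ·ζ)`. -/
def character (ξ : Space d) (ζ : Sphere d) : ℂ :=
  Complex.exp (Complex.I * ((inner ℝ ξ (ζ : Space d) : ℝ) : ℂ))

theorem norm_character (ξ : Space d) (ζ : Sphere d) : ‖character ξ ζ‖ = 1 := by
  rw [character, mul_comm]
  exact Complex.norm_exp_ofReal_mul_I _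

theorem continuous_character (ξ : Space d) : Continuous (character ξ) :=
  Complex.continuous_exp.comp (continuous_const.mul (Complex.continuous_ofReal.comp
    (continuous_const.inner continuous_subtype_val)))

theorem extension_const_mul_character (c : ℂ) (ξ₀ ξ : Space d) :
    extension d (fun ζ => c * character ξ₀ ζ) ξ = c * extension d (fun _ => 1) (ξ - ξ₀) := by
  rw [extension, extension, ← integral_const_mul]
  congr with ζ
  rw [character, mul_left_comm, ← Complex.exp_add, inner_sub_right, mul_one,
    real_inner_comm ξ₀ (ζ : Space d)]
  congr 2
  push_cast
  ring

theorem norm_pexp (z : Fin d → ℂ) (x : Space d) :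
    ‖pexp z x‖ = Real.exp (inner ℝ (WithLp.toLp 2 fun i => (z i).re) x) := by
  rw [pexp, Complex.norm_exp, cform_apply]
  simp [PiLp.inner_apply, mul_comm]

/-- An exponential of constant modulus is a character. -/
theorem exists_character_of_norm_pexp (hd : d ≠ 0) {c : ℂ} {z : Fin d → ℂ} {r : ℝ} (hc : c ≠ 0)
    (h : ∀ᵐ ζ : Sphere d ∂(surfaceMeasure d), ‖c * pexp z ζ‖ = r) :
    ∃ ξ : Space d, ∀ ζ : Sphere d, pexp z ζ = character ξ ζ := by
  set v : Space d := WithLp.toLp 2 fun i => (z i).re with hv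
  have hc' : ‖c‖ ≠ 0 := norm_ne_zero_iff.2 hc
  have : NeZero (surfaceMeasure d) :=
    ⟨fun h => surfaceMeasure_univ_ne_zero hd (by simp [h])⟩
  have h1 : ∀ᵐ ζ : Sphere d ∂(surfaceMeasure d), Real.exp (inner ℝ v (ζ : Space d)) = r / ‖c‖ := by
    filter_upwards [h] with ζ hζ
    rw [norm_mul, norm_pexp, ← hv] at hζ
    rw [← hζ, mul_div_cancel_left₀ _ hc']
  -- Comparing the modulus at ζ and -ζ gives ⟨v,ζ⟩ = -⟨v,ζ⟩ for v = Re z; a nonzero v would have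
  -- this hold only on a null set.
  have h2 := (measurePreserving_sphereMap
    (LinearIsometryEquiv.neg ℝ (E := Space d))).quasiMeasurePreserving.ae h1
  have h3 : ∀ᵐ ζ : Sphere d ∂(surfaceMeasure d), inner ℝ v (ζ : Space d) = 0 := by
    filter_upwards [h1, h2] with ζ h1 h2
    rw [← h1, coe_sphereMap_neg, inner_neg_right, Real.exp_eq_exp] at h2
    linarith
  have hv0 : v = 0 := by
    by_contra hne
    have h4 := surfaceMeasure_hyperplane hne
    have h5 : ∀ᵐ ζ : Sphere d ∂(surfaceMeasure d), inner ℝ v (ζ : Space d) ≠ 0 := by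
      rw [ae_iff]
      simpa using h4
    obtain ⟨ζ, h6, h7⟩ := (h3.and h5).exists
    exact h7 h6
  have hz : ∀ i, (z i).re = 0 := fun i => congrArg (fun v : Space d => v i) hv0
  refine ⟨WithLp.toLp 2 fun i => (z i).im, fun ζ => ?_⟩
  rw [pexp, character, cform_apply, PiLp.inner_apply]
  congr 1
  push_cast
  rw [Finset.mul_sum]
  refine Finset.sum_congr rfl fun i _ => ?_
  have : z i = Complex.I * ((z i).im : ℂ) := by
    apply Complex.ext <;> simp [hz i]
  conv_lhs => rw [this]
  simp
  ring

/-- The sharp extension inequality from `L^q` to `L^p`, with its cases of equality. -/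
def SharpAt (d : ℕ) (p q : ℝ≥0∞) : Prop :=
  eLpNorm (extension d fun _ => 1) p volume ≠ ∞ ∧
  ∀ f : Sphere d → ℂ, MemLp f q (surfaceMeasure d) →
    sphereArea d ^ (q⁻¹).toReal * eLpNorm (extension d f) p volume ≤
      eLpNorm (extension d fun _ => 1) p volume * eLpNorm f q (surfaceMeasure d) ∧
    (eLpNorm (extension d fun _ => 1) p volume * eLpNorm f q (surfaceMeasure d) ≤
      sphereArea d ^ (q⁻¹).toReal * eLpNorm (extension d f) p volume →
      ¬ (f =ᵐ[surfaceMeasure d] 0) →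
      ∃ (c : ℂ) (ξ : Space d), c ≠ 0 ∧ f =ᵐ[surfaceMeasure d] fun ζ => c * character ξ ζ)

theorem eLpNorm_const_mul_character (hd : d ≠ 0) {q : ℝ≥0∞} (hq : q ≠ 0) (c : ℂ) (ξ : Space d) :
    eLpNorm (fun ζ => c * character ξ ζ) q (surfaceMeasure d) =
      ‖c‖ₑ * sphereArea d ^ (q⁻¹).toReal := by
  have hμ : surfaceMeasure d ≠ 0 := fun h => surfaceMeasure_univ_ne_zero hd (by simp [h])
  rw [eLpNorm_congr_norm_ae (g := fun _ => c)
    (.of_forall fun ζ => by rw [norm_mul, norm_character, mul_one]), eLpNorm_const _ hq hμ,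
    one_div, ENNReal.toReal_inv]
  rfl

theorem eLpNorm_extension_const_mul_character {p : ℝ≥0∞} (c : ℂ) (ξ : Space d) :
    eLpNorm (extension d fun ζ => c * character ξ ζ) p volume =
      ‖c‖ₑ * eLpNorm (extension d fun _ => 1) p volume := by
  have hcont : Continuous (extension d fun _ => 1) :=
    continuous_fourierPush measurable_subtype_coe (integrable_const 1)
  have e : (extension d fun ζ => c * character ξ ζ) =
      c • ((extension d fun _ => 1) ∘ fun x => x - ξ) := by
    ext x
    simp [extension_const_mul_character]
  rw [e, eLpNorm_const_smul, eLpNorm_comp_measurePreserving hcont.aestronglyMeasurable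
    (measurePreserving_sub_right volume ξ)]

theorem extension_congr_ae {f g : Sphere d → ℂ} (h : f =ᵐ[surfaceMeasure d] g) :
    extension d f = extension d g := by
  ext ξ
  refine integral_congr_ae ?_
  filter_upwards [h] with ζ hζ
  rw [hζ]

/-- For q ≥ q₀ Hölder on the finite measure σ combines with the sharp inequality at q₀. Characters
have constant modulus and merely translate the transform of σ, so they are optimal in both steps.
Conversely an extremizer at q forces equality in the inequality at q₀. -/
theorem SharpAt.conclusion (hd : d ≠ 0) {p q₀ q : ℝ≥0∞} (h : SharpAt d p q₀) (h0 : q₀ ≠ 0)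
    (hq : q₀ ≤ q) :
    sharpConst d p q ≠ ∞ ∧
    sharpConst d p q =
      sphereArea d ^ (-(q⁻¹).toReal) * eLpNorm (extension d fun _ => 1) p volume ∧
    ∀ f : Sphere d → ℂ, IsExtremizer d p q f ↔
      ∃ (c : ℂ) (ξ : Space d), c ≠ 0 ∧ f =ᵐ[surfaceMeasure d] fun ζ => c * character ξ ζ := by
  obtain ⟨hE, hf⟩ := h
  have hq0 : q ≠ 0 := fun h => h0 (le_zero_iff.1 (h ▸ hq))
  have hS0 : sphereArea d ≠ 0 := surfaceMeasure_univ_ne_zero hd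
  have hSt : sphereArea d ≠ ∞ := measure_ne_top _ _
  obtain ⟨E, hEdef⟩ : ∃ E, E = eLpNorm (extension d fun _ => 1) p volume := ⟨_, rfl⟩
  obtain ⟨S, hS⟩ : ∃ S, S = sphereArea d := ⟨_, rfl⟩
  rw [← hEdef] at hE hf ⊢
  rw [← hS] at hS0 hSt hf ⊢
  have hpow0 : ∀ t : ℝ, S ^ t ≠ 0 := fun t => (ENNReal.rpow_pos (pos_iff_ne_zero.2 hS0) hSt).ne'
  have hpowt : ∀ t : ℝ, S ^ t ≠ ∞ := fun t => ENNReal.rpow_ne_top_of_ne_zero hS0 hSt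
  have hHolder : ∀ f : Sphere d → ℂ, AEStronglyMeasurable f (surfaceMeasure d) →
      eLpNorm f q₀ (surfaceMeasure d) ≤
        eLpNorm f q (surfaceMeasure d) * S ^ ((q₀⁻¹).toReal - (q⁻¹).toReal) := by
    intro f hfm
    have := eLpNorm_le_eLpNorm_mul_rpow_measure_univ hq hfm
    rw [one_div, one_div, ← ENNReal.toReal_inv, ← ENNReal.toReal_inv] at this
    rw [hS]
    exact this
  have hnorm : ∀ f : Sphere d → ℂ, IsNonzeroLp d q f → eLpNorm f q (surfaceMeasure d) ≠ 0 ∧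
      eLpNorm f q (surfaceMeasure d) ≠ ∞ := by
    intro f hf
    refine ⟨fun h => hf.2 ?_, hf.1.2.ne⟩
    exact (eLpNorm_eq_zero_iff hf.1.1 hq0).1 h
  have hmul : ∀ f : Sphere d → ℂ, eLpNorm (extension d f) p volume =
      S ^ (-(q₀⁻¹).toReal) * (S ^ (q₀⁻¹).toReal * eLpNorm (extension d f) p volume) := by
    intro f
    rw [← mul_assoc, ← ENNReal.rpow_add _ _ hS0 hSt, neg_add_cancel, ENNReal.rpow_zero, one_mul]
  have hle : ∀ f : Sphere d → ℂ, IsNonzeroLp d q f →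
      eLpNorm (extension d f) p volume / eLpNorm f q (surfaceMeasure d) ≤
        S ^ (-(q⁻¹).toReal) * E := by
    intro f hfq
    obtain ⟨hn0, hnt⟩ := hnorm f hfq
    rw [ENNReal.div_le_iff hn0 hnt, hmul f]
    calc S ^ (-(q₀⁻¹).toReal) * (S ^ (q₀⁻¹).toReal * eLpNorm (extension d f) p volume)
        ≤ S ^ (-(q₀⁻¹).toReal) * (E * (eLpNorm f q (surfaceMeasure d) *
            S ^ ((q₀⁻¹).toReal - (q⁻¹).toReal))) := by
          exact mul_le_mul' le_rfl (((hf f (hfq.1.mono_exponent hq)).1).trans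
            (mul_le_mul' le_rfl (hHolder f hfq.1.1)))
      _ = (S ^ (-(q₀⁻¹).toReal) * S ^ ((q₀⁻¹).toReal - (q⁻¹).toReal)) * E *
            eLpNorm f q (surfaceMeasure d) := by ring
      _ = _ := by
          rw [← ENNReal.rpow_add _ _ hS0 hSt]
          congr 3
          ring
  have hchar : ∀ (c : ℂ) (ξ : Space d), c ≠ 0 →
      IsNonzeroLp d q (fun ζ => c * character ξ ζ) ∧
      eLpNorm (extension d fun ζ => c * character ξ ζ) p volume /
        eLpNorm (fun ζ => c * character ξ ζ) q (surfaceMeasure d) = S ^ (-(q⁻¹).toReal) * E := by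
    intro c ξ hc
    have hcont : Continuous fun ζ => c * character ξ ζ :=
      continuous_const.mul (continuous_character ξ)
    have hc0 : ‖c‖ₑ ≠ 0 := enorm_ne_zero.2 hc
    have e1 := eLpNorm_const_mul_character hd hq0 c ξ
    rw [← hS] at e1
    refine ⟨⟨⟨hcont.aestronglyMeasurable, ?_⟩, fun hz => ?_⟩, ?_⟩
    · rw [e1]
      exact ENNReal.mul_lt_top enorm_lt_top (hpowt _).lt_top
    · rw [← eLpNorm_eq_zero_iff hcont.aestronglyMeasurable hq0, e1] at hz
      exact (mul_ne_zero hc0 (hpow0 _)) hz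
    · rw [e1, eLpNorm_extension_const_mul_character, ← hEdef, ENNReal.mul_div_mul_left _ _ hc0
        enorm_ne_top, ENNReal.rpow_neg, mul_comm, ENNReal.div_eq_inv_mul, mul_comm]
  have hC : sharpConst d p q = S ^ (-(q⁻¹).toReal) * E := by
    refine le_antisymm (iSup₂_le hle) ?_
    obtain ⟨h1, h2⟩ := hchar 1 0 one_ne_zero
    rw [← h2]
    exact le_iSup₂ (f := fun (f : Sphere d → ℂ) (_ : IsNonzeroLp d q f) =>
      eLpNorm (extension d f) p volume / eLpNorm f q (surfaceMeasure d)) _ h1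
  refine ⟨?_, hC, fun f => ⟨fun hfe => ?_, ?_⟩⟩
  · rw [hC]
    exact ENNReal.mul_ne_top (hpowt _) hE
  · obtain ⟨hfq, hfe⟩ := hfe
    obtain ⟨hn0, hnt⟩ := hnorm f hfq
    have hfe : eLpNorm (extension d f) p volume =
        S ^ (-(q⁻¹).toReal) * E * eLpNorm f q (surfaceMeasure d) := by
      rw [← hC, ← hfe, ENNReal.div_mul_cancel hn0 hnt]
    refine (hf f (hfq.1.mono_exponent hq)).2 ?_ hfq.2
    rw [hfe]
    calc E * eLpNorm f q₀ (surfaceMeasure d)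
        ≤ E * (eLpNorm f q (surfaceMeasure d) * S ^ ((q₀⁻¹).toReal - (q⁻¹).toReal)) := by
          gcongr
          exact hHolder f hfq.1.1
      _ = (S ^ (q₀⁻¹).toReal * S ^ (-(q⁻¹).toReal)) * E * eLpNorm f q (surfaceMeasure d) := by
          rw [← ENNReal.rpow_add _ _ hS0 hSt, sub_eq_add_neg]
          ring
      _ = _ := by ring
  · rintro ⟨c, ξ, hc, hfc⟩
    obtain ⟨⟨h1, h1'⟩, h2⟩ := hchar c ξ hc
    refine ⟨⟨(memLp_congr_ae hfc).2 h1, fun hz => h1' (hfc.symm.trans hz)⟩, ?_⟩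
    rw [hC, extension_congr_ae hfc, eLpNorm_congr_ae hfc, h2]

theorem sharpAt_two_mul (hdk : 3 ≤ d ∧ 2 ≤ k ∨ d = 2 ∧ 3 ≤ k) :
    SharpAt d ((2 * k : ℕ) : ℝ≥0∞) ((2 * k : ℕ) : ℝ≥0∞) := by
  have hd : d ≠ 0 := by omega
  have hk : k ≠ 0 := by omega
  have hk2 : 2 * k ≠ 0 := by omega
  have hdens := hasL2Density hdk
  have hpow : (sphereArea d ^ ((((2 * k : ℕ) : ℝ≥0∞))⁻¹).toReal) ^ (2 * k) =
      surfaceMeasure d Set.univ := by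
    rw [← ENNReal.rpow_natCast, ← ENNReal.rpow_mul, ENNReal.toReal_inv, ENNReal.toReal_natCast,
      inv_mul_cancel₀ (by exact_mod_cast hk2), ENNReal.rpow_one]
    rfl
  refine ⟨fun h => lintegral_extension_one_pow_ne_top hdens ?_, fun f hf => ⟨?_, fun heq h0 => ?_⟩⟩
  · rw [← eLpNorm_natCast_pow hk2, h, ENNReal.top_pow hk2]
  · rw [← ENNReal.pow_le_pow_left_iff hk2, mul_pow, mul_pow, hpow, eLpNorm_natCast_pow hk2,
      eLpNorm_natCast_pow hk2, eLpNorm_natCast_pow hk2]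
    exact lintegral_extension_pow_le hd hk hdens hf.1
  · rw [← ENNReal.pow_le_pow_left_iff hk2, mul_pow, mul_pow, hpow, eLpNorm_natCast_pow hk2,
      eLpNorm_natCast_pow hk2, eLpNorm_natCast_pow hk2] at heq
    obtain ⟨hG, r, hr⟩ := exists_factor_of_extension_pow_eq hd (by omega) hdens hf.1
      ((memLp_natCast_iff hk2 hf.1).1 hf).ne heq
    obtain ⟨c, z, hc, hz⟩ := ae_eq_pexp_of_prod_eq_comp hdk
      (hf.integrable (by exact_mod_cast Nat.one_le_iff_ne_zero.2 hk2)) h0 hG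
    obtain ⟨ξ, hξ⟩ := exists_character_of_norm_pexp hd hc (z := z) (r := r) (by
      filter_upwards [hr, hz] with ζ h1 h2
      rw [← h2, h1])
    refine ⟨c, ξ, hc, ?_⟩
    filter_upwards [hz] with ζ h1
    rw [h1, hξ]

end Exponentials

/-! ### Taylor coefficients of the kernel (1+t)^{1/2}(1-t)^{(d-3)/2}. -/

section Series

/-- The Taylor coefficients of `√(1 + x)`. -/
def sqrtCoeff (n : ℕ) : ℝ := Ring.choose (1 / 2 : ℝ) n

theorem sqrtCoeff_zero : sqrtCoeff 0 = 1 := Ring.choose_zero_right _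

theorem sqrtCoeff_succ (n : ℕ) : (n + 1) * sqrtCoeff (n + 1) = (1 / 2 - n) * sqrtCoeff n := by
  have h := Ring.choose_smul_choose (1 / 2 : ℝ) (Nat.le_succ n)
  rw [Nat.succ_eq_add_one, Nat.choose_succ_self_right, Nat.add_sub_cancel_left,
    Ring.choose_one_right, nsmul_eq_mul] at h
  rw [sqrtCoeff, sqrtCoeff]
  push_cast at h
  linear_combination h

theorem sqrtCoeff_sign (n : ℕ) : 0 ≤ (-1) ^ n * sqrtCoeff (n + 1) := by
  induction n with
  | zero =>
    have := sqrtCoeff_succ 0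
    rw [sqrtCoeff_zero] at this
    norm_num at this ⊢
    rw [this]
    norm_num
  | succ n ih =>
    have h := sqrtCoeff_succ (n + 1)
    have hn : (0 : ℝ) ≤ n := Nat.cast_nonneg n
    have h2 : 0 < ((n + 1 : ℕ) : ℝ) + 1 := by positivity
    refine nonneg_of_mul_nonneg_right (a := ((n + 1 : ℕ) : ℝ) + 1) ?_ h2
    have : (((n + 1 : ℕ) : ℝ) + 1) * ((-1) ^ (n + 1) * sqrtCoeff (n + 1 + 1)) =
        (n + 1 / 2) * ((-1) ^ n * sqrtCoeff (n + 1)) := by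
      rw [mul_left_comm, h, pow_succ]
      push_cast
      ring
    rw [this]
    positivity

theorem sqrtCoeff_odd_nonneg (n : ℕ) : 0 ≤ sqrtCoeff (2 * n + 1) := by
  have := sqrtCoeff_sign (2 * n)
  rwa [pow_mul, neg_one_sq, one_pow, one_mul] at this

theorem sqrtCoeff_even_nonpos (n : ℕ) : sqrtCoeff (2 * n + 2) ≤ 0 := by
  have := sqrtCoeff_sign (2 * n + 1)
  rw [pow_succ, pow_mul, neg_one_sq, one_pow, one_mul] at this
  linarith

theorem hasSum_sqrtCoeff {x : ℝ} (hx : |x| < 1) :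
    HasSum (fun n => sqrtCoeff n * x ^ n) ((1 + x) ^ (1 / 2 : ℝ)) := by
  have h := (Real.one_add_rpow_hasFPowerSeriesOnBall_zero (a := 1 / 2)).hasSum (y := x) (by
    rw [Metric.mem_eball, edist_zero_right, ← ofReal_norm, Real.norm_eq_abs]
    simpa using hx)
  rw [zero_add] at h
  have e : (fun n => sqrtCoeff n * x ^ n) = fun n => binomialSeries ℝ (1 / 2 : ℝ) n fun _ => x := by
    ext n
    rw [binomialSeries_apply, List.ofFn_const, List.prod_replicate, smul_eq_mul]
    rfl
  rw [e]
  exact h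

/-- The Taylor coefficients of `(1 - x) φ x` in terms of those of `φ`. -/
def mulOneSub (c : ℕ → ℝ) : ℕ → ℝ
  | 0 => c 0
  | n + 1 => c (n + 1) - c n

theorem hasSum_mulOneSub {c : ℕ → ℝ} {x s : ℝ} (h : HasSum (fun n => c n * x ^ n) s) :
    HasSum (fun n => mulOneSub c n * x ^ n) ((1 - x) * s) := by
  have h1 : HasSum (fun n => c (n + 1) * x ^ (n + 1)) (s - c 0) := by
    have := (hasSum_nat_add_iff' (f := fun n => c n * x ^ n) 1).2 h
    simpa using this
  have h2 : HasSum (fun n => c n * x ^ (n + 1)) (s * x) := by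
    have := h.mul_right x
    simpa only [pow_succ, mul_assoc] using this
  have h3 := h1.sub h2
  rw [← hasSum_nat_add_iff' 1]
  have e : (fun n => mulOneSub c (n + 1) * x ^ (n + 1)) =
      fun n => c (n + 1) * x ^ (n + 1) - c n * x ^ (n + 1) := by
    ext n
    rw [mulOneSub, sub_mul]
  rw [e]
  convert h3 using 1
  rw [Finset.sum_range_one, mulOneSub, pow_zero, mul_one]
  ring

theorem hasSum_even {c : ℕ → ℝ} {x s t : ℝ} (hs : HasSum (fun n => c n * x ^ n) s)
    (ht : HasSum (fun n => c n * (-x) ^ n) t) :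
    HasSum (fun n => 2 * c (2 * n) * x ^ (2 * n)) (s + t) := by
  have h := hs.add ht
  have hinj : Function.Injective fun n : ℕ => 2 * n := fun a b h => by simpa using h
  rw [← hinj.hasSum_iff] at h
  · convert h using 2 with n
    simp only [Function.comp_apply]
    rw [pow_mul (-x), neg_sq, ← pow_mul]
    ring
  · intro n hn
    have hodd : Odd n := by
      by_contra he
      rw [Nat.not_odd_iff_even] at he
      obtain ⟨m, hm⟩ := he
      exact hn ⟨m, by simp only [hm]; ring⟩
    rw [hodd.neg_pow]
    ring

/-- The kernel `(1+t)^{1/2} (1-t)^{(d-3)/2}`. -/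
def kernel (d : ℕ) (t : ℝ) : ℝ := (1 + t) ^ (1 / 2 : ℝ) * (1 - t) ^ (((d : ℝ) - 3) / 2)

theorem continuous_kernel {d : ℕ} (hd : 3 ≤ d) : Continuous (kernel d) := by
  have hd' : (3 : ℝ) ≤ d := by exact_mod_cast hd
  refine Continuous.mul ?_ ?_
  · exact (continuous_const.add continuous_id).rpow_const fun x => Or.inr (by norm_num)
  · exact (continuous_const.sub continuous_id).rpow_const fun x => Or.inr (by linarith)

/-- For d = 4 and d = 6 the kernel and its reflection add up to the same function 2√(1-x²). For d =
3, 5, 7 the kernel is (1-x)^m√(1+x) with m = 0, 1, 2, and the alternating signs of the square root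
series decide. For d = 8 the sum is 2(1+x²)√(1-x²), whose x² coefficient is positive. -/
theorem kernel_even_series {d : ℕ} (hd : 3 ≤ d) (hd7 : d ≤ 7) : ∃ b : ℕ → ℝ,
    (∀ n, b (n + 1) ≤ 0) ∧ ∀ x, |x| < 1 →
      HasSum (fun n => b n * x ^ (2 * n)) (kernel d x + kernel d (-x)) := by
  have hodd := sqrtCoeff_odd_nonneg
  have hev := sqrtCoeff_even_nonpos
  have heven : ∀ d : ℕ, (d = 4 ∨ d = 6) → ∃ b : ℕ → ℝ, (∀ n, b (n + 1) ≤ 0) ∧ ∀ x, |x| < 1 →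
      HasSum (fun n => b n * x ^ (2 * n)) (kernel d x + kernel d (-x)) := by
    intro d hd
    refine ⟨fun n => 2 * ((-1) ^ n * sqrtCoeff n), fun n => ?_, fun x hx => ?_⟩
    · have := sqrtCoeff_sign n
      simp only [pow_succ]
      linarith
    · have hx' : |-x ^ 2| < 1 := by
        rw [abs_neg, abs_pow]
        exact pow_lt_one₀ (abs_nonneg _) hx two_ne_zero
      obtain ⟨h1, h2⟩ := abs_lt.1 hx
      have h3 : 0 < 1 + x := by linarith
      have h4 : 0 < 1 - x := by linarith
      have h := (hasSum_sqrtCoeff hx').mul_left 2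
      have e : (1 + -x ^ 2) ^ (1 / 2 : ℝ) = (1 + x) ^ (1 / 2 : ℝ) * (1 - x) ^ (1 / 2 : ℝ) := by
        rw [← Real.mul_rpow h3.le h4.le]
        ring_nf
      rw [e] at h
      have hterm : (fun n => 2 * ((-1) ^ n * sqrtCoeff n) * x ^ (2 * n)) =
          fun n => 2 * (sqrtCoeff n * (-x ^ 2) ^ n) := by
        ext n
        rw [neg_pow (x ^ 2), ← pow_mul]
        ring
      rw [hterm]
      have hsum : kernel d x + kernel d (-x) =
          2 * ((1 + x) ^ (1 / 2 : ℝ) * (1 - x) ^ (1 / 2 : ℝ)) := by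
        rcases hd with rfl | rfl
        · have e4 : (((4 : ℕ) : ℝ) - 3) / 2 = 1 / 2 := by norm_num
          rw [kernel, kernel, e4, sub_neg_eq_add, ← sub_eq_add_neg]
          ring
        · have e6 : (((6 : ℕ) : ℝ) - 3) / 2 = 1 / 2 + 1 := by norm_num
          rw [kernel, kernel, e6, sub_neg_eq_add, ← sub_eq_add_neg, Real.rpow_add h3,
            Real.rpow_add h4, Real.rpow_one, Real.rpow_one]
          ring
      rw [hsum]
      exact h
  have hgen : ∀ (d : ℕ) (c : ℕ → ℝ), (∀ n, c (2 * n + 2) ≤ 0) →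
      (∀ x, |x| < 1 → HasSum (fun n => c n * x ^ n) (kernel d x)) →
      ∃ b : ℕ → ℝ, (∀ n, b (n + 1) ≤ 0) ∧ ∀ x, |x| < 1 →
      HasSum (fun n => b n * x ^ (2 * n)) (kernel d x + kernel d (-x)) := by
    intro d c hc hs
    refine ⟨fun n => 2 * c (2 * n), fun n => ?_, fun x hx => ?_⟩
    · have := hc n
      simp only [mul_add]
      linarith
    · exact hasSum_even (hs x hx) (hs (-x) (by rwa [abs_neg]))
  have hk3 : ∀ x : ℝ, kernel 3 x = (1 + x) ^ (1 / 2 : ℝ) := fun x => by simp [kernel]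
  have hk5 : ∀ x : ℝ, kernel 5 x = (1 - x) * (1 + x) ^ (1 / 2 : ℝ) := fun x => by
    have : (((5 : ℕ) : ℝ) - 3) / 2 = 1 := by norm_num
    rw [kernel, this, Real.rpow_one, mul_comm]
  have hk7 : ∀ x : ℝ, kernel 7 x = (1 - x) * ((1 - x) * (1 + x) ^ (1 / 2 : ℝ)) := fun x => by
    have : (((7 : ℕ) : ℝ) - 3) / 2 = (2 : ℕ) := by norm_num
    rw [kernel, this, Real.rpow_natCast]
    ring
  obtain rfl | rfl | rfl | rfl | rfl : d = 3 ∨ d = 4 ∨ d = 5 ∨ d = 6 ∨ d = 7 := by omega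
  · refine hgen 3 sqrtCoeff hev fun x hx => ?_
    rw [hk3]
    exact hasSum_sqrtCoeff hx
  · exact heven 4 (Or.inl rfl)
  · refine hgen 5 (mulOneSub sqrtCoeff) (fun n => ?_) fun x hx => ?_
    · change sqrtCoeff (2 * n + 2) - sqrtCoeff (2 * n + 1) ≤ 0
      linarith [hev n, hodd n]
    · rw [hk5]
      exact hasSum_mulOneSub (hasSum_sqrtCoeff hx)
  · exact heven 6 (Or.inr rfl)
  · refine hgen 7 (mulOneSub (mulOneSub sqrtCoeff)) (fun n => ?_) fun x hx => ?_
    -- The coefficient of x² is the delicate one: it is -1/8 - 1 + 1, where the constant term 1 of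
    -- the square root has the unfavourable sign. In higher degree all three contributions have the
    -- right sign.
    · rcases n with _ | n
      · have h0 := sqrtCoeff_succ 0
        have h1 := sqrtCoeff_succ 1
        rw [sqrtCoeff_zero] at h0
        norm_num at h0 h1
        change (sqrtCoeff 2 - sqrtCoeff 1) - (sqrtCoeff 1 - sqrtCoeff 0) ≤ 0
        rw [sqrtCoeff_zero]
        linarith
      · change (sqrtCoeff (2 * (n + 1) + 2) - sqrtCoeff (2 * (n + 1) + 1)) -
          (sqrtCoeff (2 * (n + 1) + 1) - sqrtCoeff (2 * n + 2)) ≤ 0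
        linarith [hev n, hev (n + 1), hodd (n + 1)]
    · rw [hk7]
      exact hasSum_mulOneSub (hasSum_mulOneSub (hasSum_sqrtCoeff hx))

end Series

/-! ### Constants maximize the energy among even densities. -/

section KernelInequality

variable {d : ℕ}

/-- The pair measure `σ × σ`. -/
abbrev pairMeasure (d : ℕ) : Measure (Sphere d × Sphere d) :=
  (surfaceMeasure d).prod (surfaceMeasure d)

/-- The inner product of a pair of points of the sphere. -/
def pairInner (p : Sphere d × Sphere d) : ℝ := inner ℝ (p.1 : Space d) (p.2 : Space d)

theorem continuous_pairInner : Continuous (pairInner (d := d)) :=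
  (continuous_subtype_val.comp continuous_fst).inner (continuous_subtype_val.comp continuous_snd)

theorem abs_pairInner_le (p : Sphere d × Sphere d) : |pairInner p| ≤ 1 := by
  have := abs_real_inner_le_norm (p.1 : Space d) (p.2 : Space d)
  rwa [norm_coe_sphere, norm_coe_sphere, one_mul] at this

theorem exists_bound_comp_pairInner {φ : ℝ → ℝ} (hφ : Continuous φ) :
    ∃ C, ∀ t, |t| ≤ 1 → ‖φ t‖ ≤ C := by
  obtain ⟨C, hC⟩ := (isCompact_Icc (a := (-1 : ℝ)) (b := 1)).exists_bound_of_continuousOn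
    hφ.continuousOn
  exact ⟨C, fun t ht => hC t (abs_le.1 ht)⟩

theorem integrable_mul_comp_pairInner {φ : ℝ → ℝ} (hφ : Continuous φ)
    {K : Sphere d × Sphere d → ℝ} (hK : Integrable K (pairMeasure d)) :
    Integrable (fun p => K p * φ (pairInner p)) (pairMeasure d) := by
  obtain ⟨C, hC⟩ := exists_bound_comp_pairInner hφ
  exact hK.mul_bdd (c := C) (hφ.comp continuous_pairInner).aestronglyMeasurable
    (.of_forall fun p => hC _ (abs_pairInner_le p))

theorem pairInner_pow (p : Sphere d × Sphere d) (n : ℕ) :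
    pairInner p ^ n = ∑ j : Fin n → Fin d,
      (∏ i, (p.1 : Space d) (j i)) * ∏ i, (p.2 : Space d) (j i) := by
  have : pairInner p = ∑ i, (p.1 : Space d) i * (p.2 : Space d) i := by
    rw [pairInner, PiLp.inner_apply]
    simp [mul_comm]
  rw [this, Fintype.sum_pow]
  simp_rw [Finset.prod_mul_distrib]

theorem continuous_monomial {n : ℕ} (j : Fin n → Fin d) :
    Continuous fun ζ : Sphere d => ∏ i, (ζ : Space d) (j i) := by
  refine continuous_finsetProd _ fun i _ => ?_
  exact (EuclideanSpace.proj (𝕜 := ℝ) (j i)).continuous.comp continuous_subtype_val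

/-- Expanding ⟨ζ,η⟩^n into products of monomials in each variable makes the double integral a sum of
squares. -/
theorem integral_pairInner_pow_nonneg {H : Sphere d → ℝ} (hH : Integrable H (surfaceMeasure d))
    (n : ℕ) : 0 ≤ ∫ p, H p.1 * H p.2 * pairInner p ^ n ∂(pairMeasure d) := by
  have hm : ∀ j : Fin n → Fin d,
      Integrable (fun ζ : Sphere d => H ζ * ∏ i, (ζ : Space d) (j i)) (surfaceMeasure d) := fun j => by
    obtain ⟨C, hC⟩ := (isCompact_univ (X := Sphere d)).exists_bound_of_continuousOn
      (continuous_monomial j).continuousOn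
    exact hH.mul_bdd (c := C) (continuous_monomial j).aestronglyMeasurable
      (.of_forall fun ζ => hC ζ (Set.mem_univ _))
  have e : (fun p : Sphere d × Sphere d => H p.1 * H p.2 * pairInner p ^ n) =
      fun p => ∑ j : Fin n → Fin d, (H p.1 * ∏ i, (p.1 : Space d) (j i)) *
        (H p.2 * ∏ i, (p.2 : Space d) (j i)) := by
    ext p
    rw [pairInner_pow, Finset.mul_sum]
    refine Finset.sum_congr rfl fun j _ => ?_
    ring
  rw [e, integral_finsetSum _ fun j _ => (hm j).mul_prod (hm j)]
  refine Finset.sum_nonneg fun j _ => ?_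
  rw [integral_prod_mul (fun ζ : Sphere d => H ζ * ∏ i, (ζ : Space d) (j i))
    (fun ζ : Sphere d => H ζ * ∏ i, (ζ : Space d) (j i))]
  exact mul_self_nonneg _

theorem exists_integral_inner_eq (φ : ℝ → ℝ) : ∃ m : ℝ, ∀ ζ : Sphere d,
    ∫ η : Sphere d, φ (inner ℝ (ζ : Space d) η) ∂(surfaceMeasure d) = m := by
  by_cases h : Nonempty (Sphere d)
  · obtain ⟨ζ₀⟩ := h
    refine ⟨∫ η : Sphere d, φ (inner ℝ (ζ₀ : Space d) η) ∂(surfaceMeasure d), fun ζ => ?_⟩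
    obtain ⟨L, hL⟩ := exists_isometry_apply_eq ((norm_coe_sphere ζ₀).trans (norm_coe_sphere ζ).symm)
    rw [← (measurePreserving_sphereMap L).integral_comp (measurableEmbedding_sphereMap L)]
    simp_rw [coe_sphereMap, ← hL, LinearIsometryEquiv.inner_map_map]
  · exact ⟨0, fun ζ => (h ⟨ζ⟩).elim⟩

/-- The kernel `a² - S² G ⊗ G` where `a = ∫ G` and `S` is the area of the sphere. -/
def gapKernel (d : ℕ) (G : Sphere d → ℝ) (p : Sphere d × Sphere d) : ℝ :=
  (∫ ζ, G ζ ∂(surfaceMeasure d)) ^ 2 - (surfaceMeasure d).real Set.univ ^ 2 * (G p.1 * G p.2)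

theorem integrable_gapKernel {G : Sphere d → ℝ} (hG : Integrable G (surfaceMeasure d)) :
    Integrable (gapKernel d G) (pairMeasure d) :=
  (integrable_const _).sub ((hG.mul_prod hG).const_mul _)

theorem integral_gapKernel {G : Sphere d → ℝ} (hG : Integrable G (surfaceMeasure d)) :
    ∫ p, gapKernel d G p ∂(pairMeasure d) = 0 := by
  unfold gapKernel
  rw [integral_sub (integrable_const _) ((hG.mul_prod hG).const_mul _), integral_const,
    integral_const_mul, integral_prod_mul G G, ← Set.univ_prod_univ, measureReal_prod_prod,
    smul_eq_mul]
  ring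

/-- The integral is minus the positive form evaluated at the mean-zero function S G - a. The cross
terms are explicit because the integral of ⟨ζ,η⟩^n over η does not depend on ζ. -/
theorem integral_gapKernel_pow_nonpos {G : Sphere d → ℝ} (hG : Integrable G (surfaceMeasure d))
    (n : ℕ) : ∫ p, gapKernel d G p * pairInner p ^ n ∂(pairMeasure d) ≤ 0 := by
  obtain ⟨m, hm⟩ := exists_integral_inner_eq (d := d) fun t => t ^ n
  obtain ⟨S, hS⟩ : ∃ S, S = (surfaceMeasure d).real Set.univ := ⟨_, rfl⟩
  obtain ⟨a, ha⟩ : ∃ a, a = ∫ ζ, G ζ ∂(surfaceMeasure d) := ⟨_, rfl⟩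
  have hφ : Continuous fun t : ℝ => t ^ n := continuous_pow n
  have h1 : Integrable (fun _ : Sphere d => (1 : ℝ)) (surfaceMeasure d) := integrable_const _
  have hmix : ∀ {u : Sphere d → ℝ}, Integrable u (surfaceMeasure d) →
      ∫ p, u p.1 * 1 * pairInner p ^ n ∂(pairMeasure d) = (∫ ζ, u ζ ∂(surfaceMeasure d)) * m := by
    intro u hu
    rw [integral_prod _ (integrable_mul_comp_pairInner hφ (hu.mul_prod h1)),
      ← integral_mul_const]
    refine integral_congr_ae (.of_forall fun ζ => ?_)
    simp only [mul_one, integral_const_mul]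
    congr 1
    exact hm ζ
  have hmix' : ∫ p, 1 * G p.2 * pairInner p ^ n ∂(pairMeasure d) = a * m := by
    rw [ha, ← hmix hG, ← integral_prod_swap]
    refine integral_congr_ae (.of_forall fun p => ?_)
    simp only [pairInner, Prod.fst_swap, Prod.snd_swap, one_mul, mul_one]
    rw [real_inner_comm]
  have h0 := integral_pairInner_pow_nonneg (H := fun ζ => S * G ζ - a)
    ((hG.const_mul S).sub (integrable_const a)) n
  have i1 := integrable_mul_comp_pairInner hφ (integrable_gapKernel hG)
  have i2 := integrable_mul_comp_pairInner hφ (hG.mul_prod h1)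
  have i3 := integrable_mul_comp_pairInner hφ (h1.mul_prod hG)
  have i4 := integrable_mul_comp_pairInner hφ (h1.mul_prod h1)
  have e : (fun p : Sphere d × Sphere d => (S * G p.1 - a) * (S * G p.2 - a) * pairInner p ^ n) =
      fun p => (2 * a ^ 2 * (1 * 1 * pairInner p ^ n) - gapKernel d G p * pairInner p ^ n) -
        (S * a * (G p.1 * 1 * pairInner p ^ n) + S * a * (1 * G p.2 * pairInner p ^ n)) := by
    ext p
    rw [gapKernel, ← ha, ← hS]
    ring
  have e2 : ∫ p, (2 * a ^ 2 * (1 * 1 * pairInner p ^ n) - gapKernel d G p * pairInner p ^ n) -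
        (S * a * (G p.1 * 1 * pairInner p ^ n) + S * a * (1 * G p.2 * pairInner p ^ n))
        ∂(pairMeasure d) =
      (2 * a ^ 2 * (S * m) - ∫ p, gapKernel d G p * pairInner p ^ n ∂(pairMeasure d)) -
        (S * a * (a * m) + S * a * (a * m)) := by
    refine (integral_sub ((i4.const_mul _).sub i1) ((i2.const_mul _).add (i3.const_mul _))).trans ?_
    congr 1
    · refine (integral_sub (i4.const_mul _) i1).trans ?_
      congr 1
      rw [integral_const_mul]
      congr 1
      refine (hmix h1).trans ?_
      rw [hS, integral_const, smul_eq_mul, mul_one]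
    · refine (integral_add (i2.const_mul _) (i3.const_mul _)).trans ?_
      rw [integral_const_mul, integral_const_mul, hmix', ha]
      congr 2
      exact hmix hG
  rw [e, e2] at h0
  linarith

theorem integral_gapKernel_comp_neg {G : Sphere d → ℝ}
    (heven : ∀ ζ, G (sphereMap (LinearIsometryEquiv.neg ℝ) ζ) = G ζ) (φ : ℝ → ℝ) :
    ∫ p, gapKernel d G p * φ (-pairInner p) ∂(pairMeasure d) =
      ∫ p, gapKernel d G p * φ (pairInner p) ∂(pairMeasure d) := by
  have hmp : MeasurePreserving
      (Prod.map (sphereMap (d := d) (LinearIsometryEquiv.neg ℝ)) (id : Sphere d → Sphere d))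
      (pairMeasure d) (pairMeasure d) :=
    (measurePreserving_sphereMap _).prod (MeasurePreserving.id _)
  have hme : MeasurableEmbedding (Prod.map (sphereMap (d := d) (LinearIsometryEquiv.neg ℝ))
      (id : Sphere d → Sphere d)) :=
    (MeasurableEmbedding.prodMap (measurableEmbedding_sphereMap _) MeasurableEmbedding.id :)
  rw [← hmp.integral_comp hme fun p => gapKernel d G p * φ (pairInner p)]
  refine integral_congr_ae (.of_forall fun p => ?_)
  simp only [gapKernel, pairInner, Prod.map_fst, Prod.map_snd, heven, coe_sphereMap_neg,
    inner_neg_left, id]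

/-- Evenness of G lets φ be replaced by its even part. The constant term contributes nothing because
the gap kernel has total integral zero, and every other term is a product of two nonpositive
numbers. The series is available only inside the unit interval, so its argument is first scaled by r
< 1, and r → 1 by dominated convergence. -/
theorem integral_gapKernel_nonneg {φ : ℝ → ℝ} (hφ : Continuous φ) {b : ℕ → ℝ}
    (hb : ∀ n, b (n + 1) ≤ 0)
    (hs : ∀ x, |x| < 1 → HasSum (fun n => b n * x ^ (2 * n)) (φ x + φ (-x)))
    {G : Sphere d → ℝ} (hG : Integrable G (surfaceMeasure d))
    (heven : ∀ ζ, G (sphereMap (LinearIsometryEquiv.neg ℝ) ζ) = G ζ) :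
    0 ≤ ∫ p, gapKernel d G p * φ (pairInner p) ∂(pairMeasure d) := by
  have hK := integrable_gapKernel hG
  obtain ⟨ψ, hψ⟩ : ∃ ψ : ℝ → ℝ, ψ = fun x => φ x + φ (-x) := ⟨_, rfl⟩
  have hψc : Continuous ψ := by rw [hψ]; fun_prop
  have h1 : 2 * ∫ p, gapKernel d G p * φ (pairInner p) ∂(pairMeasure d) =
      ∫ p, gapKernel d G p * ψ (pairInner p) ∂(pairMeasure d) := by
    have e : (fun p : Sphere d × Sphere d => gapKernel d G p * ψ (pairInner p)) =
        fun p => gapKernel d G p * φ (pairInner p) + gapKernel d G p * φ (-pairInner p) := by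
      ext p
      rw [hψ]
      ring
    rw [e]
    refine Eq.trans ?_ (integral_add (integrable_mul_comp_pairInner hφ hK)
      (integrable_mul_comp_pairInner (hφ.comp continuous_neg) hK)).symm
    rw [two_mul, ← integral_gapKernel_comp_neg heven]
    rfl
  have h2 : ∀ r : ℝ, 0 ≤ r → r < 1 →
      0 ≤ ∫ p, gapKernel d G p * ψ (r * pairInner p) ∂(pairMeasure d) := by
    intro r hr0 hr1
    have hr : |r| < 1 := by rwa [abs_of_nonneg hr0]
    have hsum := (hs r hr).summable.abs
    have hrt : ∀ p : Sphere d × Sphere d, |r * pairInner p| < 1 := fun p => by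
      rw [abs_mul, abs_of_nonneg hr0]
      exact (mul_le_of_le_one_right hr0 (abs_pairInner_le p)).trans_lt hr1
    have hterm : ∀ n, Integrable (fun p : Sphere d × Sphere d =>
        gapKernel d G p * (b n * (r * pairInner p) ^ (2 * n))) (pairMeasure d) := fun n =>
      integrable_mul_comp_pairInner (φ := fun t => b n * (r * t) ^ (2 * n)) (by fun_prop) hK
    have hlim := hasSum_integral_of_dominated_convergence (μ := pairMeasure d)
      (F := fun n p => gapKernel d G p * (b n * (r * pairInner p) ^ (2 * n)))
      (f := fun p => gapKernel d G p * ψ (r * pairInner p))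
      (fun n p => ‖gapKernel d G p‖ * |b n * r ^ (2 * n)|)
      (fun n => (hterm n).1) (fun n => .of_forall fun p => ?_)
      (.of_forall fun p => hsum.mul_left _) ?_ (.of_forall fun p => ?_)
    · refine hlim.nonneg fun n => ?_
      have e : (fun p : Sphere d × Sphere d =>
          gapKernel d G p * (b n * (r * pairInner p) ^ (2 * n))) =
          fun p => b n * r ^ (2 * n) * (gapKernel d G p * pairInner p ^ (2 * n)) := by
        ext p
        ring
      rw [e, integral_const_mul]
      rcases n with _ | n
      · simp [integral_gapKernel hG]
      · exact mul_nonneg_of_nonpos_of_nonpos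
          (mul_nonpos_of_nonpos_of_nonneg (hb n) (by positivity))
          (integral_gapKernel_pow_nonpos hG _)
    · rw [norm_mul]
      gcongr
      rw [Real.norm_eq_abs, abs_mul, abs_mul, abs_pow, abs_pow, abs_mul, abs_of_nonneg hr0]
      gcongr
      exact mul_le_of_le_one_right hr0 (abs_pairInner_le p)
    · simp_rw [tsum_mul_left]
      exact hK.norm.mul_const _
    · have := (hs _ (hrt p)).mul_left (gapKernel d G p)
      rw [hψ]
      exact this
  obtain ⟨C, hC⟩ := exists_bound_comp_pairInner hψc
  obtain ⟨r, hrm, hrI, hrt⟩ := exists_seq_strictMono_tendsto' (show (0 : ℝ) < 1 by norm_num)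
  have h3 : Filter.Tendsto
      (fun n => ∫ p, gapKernel d G p * ψ (r n * pairInner p) ∂(pairMeasure d)) Filter.atTop
      (nhds (∫ p, gapKernel d G p * ψ (pairInner p) ∂(pairMeasure d))) := by
    refine tendsto_integral_of_dominated_convergence (fun p => ‖gapKernel d G p‖ * C)
      (fun n => ?_) (hK.norm.mul_const _) (fun n => .of_forall fun p => ?_)
      (.of_forall fun p => ?_)
    · exact (integrable_mul_comp_pairInner (φ := fun t => ψ (r n * t)) (by fun_prop) hK).1
    · rw [norm_mul]
      gcongr
      refine hC _ ?_
      rw [abs_mul, abs_of_pos (hrI n).1]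
      exact mul_le_one₀ (hrI n).2.le (abs_nonneg _) (abs_pairInner_le p)
    · have : Filter.Tendsto (fun n => r n * pairInner p) Filter.atTop (nhds (1 * pairInner p)) :=
        hrt.mul_const _
      rw [one_mul] at this
      exact ((hψc.tendsto _).comp this).const_mul _
  have h4 := ge_of_tendsto' h3 fun n => h2 (r n) (hrI n).1.le (hrI n).2
  linarith

/-- Among even densities of given mass, the constant maximizes the energy of the kernel. -/
theorem integral_kernel_le (hd : 3 ≤ d) (hd7 : d ≤ 7)
    {G : Sphere d → ℝ} (hG : Integrable G (surfaceMeasure d))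
    (heven : ∀ ζ, G (sphereMap (LinearIsometryEquiv.neg ℝ) ζ) = G ζ) :
    (surfaceMeasure d).real Set.univ ^ 2 *
        ∫ p, G p.1 * G p.2 * kernel d (pairInner p) ∂(pairMeasure d) ≤
      (∫ ζ, G ζ ∂(surfaceMeasure d)) ^ 2 * ∫ p, kernel d (pairInner p) ∂(pairMeasure d) := by
  obtain ⟨b, hb, hs⟩ := kernel_even_series hd hd7
  have h := integral_gapKernel_nonneg (continuous_kernel hd) hb hs hG heven
  have i1 := integrable_mul_comp_pairInner (continuous_kernel hd) (hG.mul_prod hG)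
  have i2 : Integrable (fun p => kernel d (pairInner p)) (pairMeasure d) := by
    simpa using integrable_mul_comp_pairInner (continuous_kernel hd)
      (integrable_const (μ := pairMeasure d) (1 : ℝ))
  have e : (fun p => gapKernel d G p * kernel d (pairInner p)) = fun p =>
      (∫ ζ, G ζ ∂(surfaceMeasure d)) ^ 2 * kernel d (pairInner p) -
        (surfaceMeasure d).real Set.univ ^ 2 * (G p.1 * G p.2 * kernel d (pairInner p)) := by
    ext p
    rw [gapKernel]
    ring
  rw [e] at h
  have e2 := integral_sub (i2.const_mul ((∫ ζ, G ζ ∂(surfaceMeasure d)) ^ 2))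
    (i1.const_mul ((surfaceMeasure d).real Set.univ ^ 2))
  rw [e2, integral_const_mul, integral_const_mul] at h
  linarith

end KernelInequality

/-! ### The Helmholtz equation and the identity ∫u⁴ = 3∑∫(u ∂_j u)². -/

section IntegrationByParts

variable {d : ℕ}

/-- Multiplication by `-iζ_j`. -/
def coordMul (j : Fin d) (F : Sphere d → ℂ) (ζ : Sphere d) : ℂ :=
  -(Complex.I * (((ζ : Space d) j : ℝ) : ℂ)) * F ζ

theorem abs_coord_le (j : Fin d) (ζ : Sphere d) : |(ζ : Space d) j| ≤ 1 :=
  (PiLp.norm_apply_le (ζ : Space d) j).trans_eq (norm_coe_sphere ζ)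

theorem norm_coordMul_le (j : Fin d) (F : Sphere d → ℂ) (ζ : Sphere d) :
    ‖coordMul j F ζ‖ ≤ ‖F ζ‖ := by
  rw [coordMul, norm_mul, norm_neg, norm_mul, Complex.norm_I, one_mul, Complex.norm_real]
  exact mul_le_of_le_one_left (norm_nonneg _) (abs_coord_le j ζ)

theorem integrable_coordMul {F : Sphere d → ℂ} (hF : Integrable F (surfaceMeasure d)) (j : Fin d) :
    Integrable (coordMul j F) (surfaceMeasure d) := by
  have h := integrable_mul_continuous hF
    (φ := fun ζ => -(Complex.I * (((ζ : Space d) j : ℝ) : ℂ)))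
    ((continuous_coord j).const_mul Complex.I).neg
  refine h.congr (.of_forall fun ζ => ?_)
  rw [coordMul]
  ring

theorem continuous_extension {F : Sphere d → ℂ} (hF : Integrable F (surfaceMeasure d)) :
    Continuous (extension d F) := continuous_fourierPush measurable_subtype_coe hF

theorem hasLineDerivAt_extension {F : Sphere d → ℂ} (hF : Integrable F (surfaceMeasure d))
    (j : Fin d) (ξ : Space d) :
    HasLineDerivAt ℝ (extension d F) (extension d (coordMul j F) ξ) ξ (bvec j) := by
  have hpt : ∀ (ζ : Sphere d) (t : ℝ), HasDerivAt
      (fun t : ℝ => wave (ζ : Space d) (ξ + t • bvec j) * F ζ)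
      (wave (ζ : Space d) (ξ + t • bvec j) * coordMul j F ζ) t := by
    intro ζ t
    have h1 : HasDerivAt (fun t : ℝ => ((inner ℝ (ζ : Space d) (ξ + t • bvec j) : ℝ) : ℂ))
        (((ζ : Space d) j : ℝ) : ℂ) t := by
      have e : (fun t : ℝ => (inner ℝ (ζ : Space d) (ξ + t • bvec j) : ℝ)) =
          fun t => inner ℝ (ζ : Space d) ξ + t * (ζ : Space d) j := by
        ext t
        rw [inner_add_right, inner_smul_right, real_inner_comm (bvec j), inner_bvec]
      have h0 : HasDerivAt (fun t : ℝ => (inner ℝ (ζ : Space d) (ξ + t • bvec j) : ℝ))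
          ((ζ : Space d) j) t := by
        rw [e]
        simpa using ((hasDerivAt_id t).mul_const ((ζ : Space d) j)).const_add
          (inner ℝ (ζ : Space d) ξ)
      exact h0.ofReal_comp
    have h2 := ((h1.const_mul Complex.I).fun_neg.cexp).mul_const (F ζ)
    refine h2.congr_deriv ?_
    rw [coordMul, wave]
    ring
  have h := (hasDerivAt_integral_of_dominated_loc_of_deriv_le (μ := surfaceMeasure d)
    (s := Set.univ) (x₀ := (0 : ℝ)) (bound := fun ζ => ‖F ζ‖)
    (F := fun (t : ℝ) (ζ : Sphere d) => wave (ζ : Space d) (ξ + t • bvec j) * F ζ)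
    (F' := fun (t : ℝ) (ζ : Sphere d) => wave (ζ : Space d) (ξ + t • bvec j) * coordMul j F ζ)
    Filter.univ_mem (.of_forall fun t => (integrable_sphere_wave_mul hF _).1)
    (integrable_sphere_wave_mul hF _) (integrable_sphere_wave_mul (integrable_coordMul hF j) _).1
    (.of_forall fun ζ t _ => ?_) hF.norm (.of_forall fun ζ t _ => hpt ζ t)).2
  · have e : extension d (coordMul j F) ξ = ∫ ζ : Sphere d,
        wave (ζ : Space d) (ξ + (0 : ℝ) • bvec j) * coordMul j F ζ ∂(surfaceMeasure d) := by
      rw [zero_smul, add_zero]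
      rfl
    rw [e]
    exact h
  · rw [norm_mul, norm_wave, one_mul]
    exact norm_coordMul_le j F ζ

/-- This is Δu = -u for the transform u of a density on the unit sphere, since ∑ζ_j² = 1. -/
theorem sum_extension_coordMul_coordMul {F : Sphere d → ℂ}
    (hF : Integrable F (surfaceMeasure d)) (ξ : Space d) :
    ∑ j, extension d (coordMul j (coordMul j F)) ξ = -extension d F ξ := by
  have h : ∀ j, Integrable (fun ζ : Sphere d => wave ζ ξ * coordMul j (coordMul j F) ζ)
      (surfaceMeasure d) := fun j =>
    integrable_sphere_wave_mul (integrable_coordMul (integrable_coordMul hF j) j) ξ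
  simp only [extension_eq_fourierPush, fourierPush]
  rw [← integral_finsetSum _ fun j _ => h j, ← integral_neg]
  refine integral_congr_ae (.of_forall fun ζ => ?_)
  have h1 : ∑ j, (((ζ : Space d) j : ℝ) : ℂ) ^ 2 = 1 := by
    have := EuclideanSpace.real_norm_sq_eq (ζ : Space d)
    rw [norm_coe_sphere, one_pow] at this
    exact_mod_cast this.symm
  have e : ∀ j, wave (ζ : Space d) ξ * coordMul j (coordMul j F) ζ =
      (((ζ : Space d) j : ℝ) : ℂ) ^ 2 * -(wave (ζ : Space d) ξ * F ζ) := by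
    intro j
    simp only [coordMul]
    linear_combination (wave (ζ : Space d) ξ * (((ζ : Space d) j : ℝ) : ℂ) ^ 2 * F ζ) *
      Complex.I_sq
  simp only [e]
  rw [← Finset.sum_mul, h1, one_mul]

/-- Both sides are the j-th derivative of u²: differentiation multiplies by -i x_j on the side of
the image measure. -/
theorem two_mul_extension_mul_coordMul {F : Sphere d → ℂ}
    (hF : Integrable F (surfaceMeasure d)) (j : Fin d) (ξ : Space d) :
    fourierPush (sphPi d 2) vsum
      (fun ζ => -(Complex.I * ((vsum ζ j : ℝ) : ℂ)) * (F (ζ 0) * F (ζ 1))) ξ =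
    2 * (extension d F ξ * extension d (coordMul j F) ξ) := by
  have h0 := integrable_sphere_wave_mul hF ξ
  have h1 := integrable_sphere_wave_mul (integrable_coordMul hF j) ξ
  have e : (fun ζ : Fin 2 → Sphere d => wave (vsum ζ) ξ *
      (-(Complex.I * ((vsum ζ j : ℝ) : ℂ)) * (F (ζ 0) * F (ζ 1)))) = fun ζ =>
      (wave (ζ 0 : Space d) ξ * coordMul j F (ζ 0)) * (wave (ζ 1 : Space d) ξ * F (ζ 1)) +
      (wave (ζ 0 : Space d) ξ * F (ζ 0)) * (wave (ζ 1 : Space d) ξ * coordMul j F (ζ 1)) := by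
    ext ζ
    simp only [vsum, Fin.sum_univ_two, wave_add, coordMul, PiLp.add_apply, Complex.ofReal_add]
    ring
  rw [fourierPush, e, integral_add (integrable_mul_sphPi_two h1 h0)
    (integrable_mul_sphPi_two h0 h1),
    integral_mul_sphPi_two (fun ζ : Sphere d => wave (ζ : Space d) ξ * coordMul j F ζ)
      (fun ζ : Sphere d => wave (ζ : Space d) ξ * F ζ),
    integral_mul_sphPi_two (fun ζ : Sphere d => wave (ζ : Space d) ξ * F ζ)
      (fun ζ : Sphere d => wave (ζ : Space d) ξ * coordMul j F ζ)]
  change extension d (coordMul j F) ξ * extension d F ξ +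
    extension d F ξ * extension d (coordMul j F) ξ = _
  ring

theorem lintegral_extension_four_le_of_norm_le {F : Sphere d → ℂ} {g : Sphere d → ℝ}
    (hF : Integrable F (surfaceMeasure d)) (hg : Integrable g (surfaceMeasure d))
    (hle : ∀ᵐ ζ ∂(surfaceMeasure d), ‖F ζ‖ ≤ g ζ) :
    ∫⁻ ξ, ‖extension d F ξ‖ₑ ^ 4 ≤ ∫⁻ ξ, ‖extension d (fun ζ => (g ζ : ℂ)) ξ‖ₑ ^ 4 := by
  have h : ∀ F : Sphere d → ℂ, ∫⁻ ξ, ‖extension d F ξ‖ₑ ^ 4 =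
      ∫⁻ ξ, ‖fourierPush (sphPi d 2) vsum (fun ζ => F (ζ 0) * F (ζ 1)) ξ‖ₑ ^ 2 := fun F => by
    refine lintegral_congr fun ξ => ?_
    have := enorm_extension_pow (k := 2) F ξ
    simpa only [Fin.prod_univ_two] using this
  rw [h, h]
  have hg2 : Integrable (fun ζ : Fin 2 → Sphere d => g (ζ 0) * g (ζ 1)) (sphPi d 2) := by
    have := (integrable_mul_sphPi_two hg.ofReal hg.ofReal).re (𝕜 := ℂ)
    simpa using this
  have := lintegral_fourierPush_sq_le_of_norm_le (μ := sphPi d 2) measurable_vsum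
    (integrable_mul_sphPi_two hF hF) hg2 ?_
  · simpa only [Complex.ofReal_mul] using this
  · have hq := fun i : Fin 2 =>
      (Measure.quasiMeasurePreserving_eval (fun _ : Fin 2 => surfaceMeasure d) i).ae hle
    filter_upwards [hq 0, hq 1] with ζ h0 h1
    rw [norm_mul]
    exact mul_le_mul h0 h1 (norm_nonneg _) ((norm_nonneg _).trans h0)

theorem integrable_mul_four {α : Type*} [MeasurableSpace α] {μ : Measure α} {a b c e : α → ℂ}
    (ha : MemLp a 4 μ) (hb : MemLp b 4 μ) (hc : MemLp c 4 μ) (he : MemLp e 4 μ) :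
    Integrable (fun x => a x * b x * (c x * e x)) μ := by
  have hp : ∀ {u : α → ℂ}, MemLp u 4 μ → Integrable (fun x => ‖u x‖ ^ 4) μ := fun hu => by
    have := hu.integrable_norm_pow (p := 4) (by norm_num)
    simpa using this
  refine (((hp ha).add (hp hb)).add ((hp hc).add (hp he))).mono'
    ((ha.1.mul hb.1).mul (hc.1.mul he.1)) (.of_forall fun x => ?_)
  simp only [norm_mul, Pi.add_apply]
  nlinarith [sq_nonneg (‖a x‖ * ‖b x‖ - ‖c x‖ * ‖e x‖), sq_nonneg (‖a x‖ ^ 2 - ‖b x‖ ^ 2),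
    sq_nonneg (‖c x‖ ^ 2 - ‖e x‖ ^ 2), sq_nonneg (‖a x‖ ^ 2 + ‖b x‖ ^ 2),
    sq_nonneg (‖c x‖ ^ 2 + ‖e x‖ ^ 2)]

/-- Write u⁴ = -u³Δu and integrate by parts in each coordinate. No conjugates occur; the identity
holds for complex u. -/
theorem integral_extension_pow_four {F : Sphere d → ℂ} (hF : Integrable F (surfaceMeasure d))
    (h0 : MemLp (extension d F) 4) (h1 : ∀ j, MemLp (extension d (coordMul j F)) 4)
    (h2 : ∀ j, MemLp (extension d (coordMul j (coordMul j F))) 4) :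
    ∫ ξ, extension d F ξ ^ 4 =
      3 * ∑ j, ∫ ξ, (extension d F ξ * extension d (coordMul j F) ξ) ^ 2 := by
  have hparts : ∀ j, ∫ ξ, extension d F ξ ^ 3 * extension d (coordMul j (coordMul j F)) ξ =
      -(3 * ∫ ξ, (extension d F ξ * extension d (coordMul j F) ξ) ^ 2) := by
    intro j
    have hpow : ∀ ξ, HasLineDerivAt ℝ (fun ξ => extension d F ξ ^ 3)
        (3 * extension d F ξ ^ 2 * extension d (coordMul j F) ξ) ξ (bvec j) := by
      intro ξ
      have h := hasLineDerivAt_extension hF j ξ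
      have h' := HasDerivAt.fun_pow h 3
      refine HasDerivAt.congr_deriv h' ?_
      simp
    have hv := hasLineDerivAt_extension (integrable_coordMul hF j) j
    have h := integral_bilinear_hasLineDerivAt_right_eq_neg_left_of_integrable
      (μ := (volume : Measure (Space d))) (v := bvec j) (B := ContinuousLinearMap.mul ℝ ℂ)
      (f := fun ξ => extension d F ξ ^ 3)
      (f' := fun ξ => 3 * extension d F ξ ^ 2 * extension d (coordMul j F) ξ)
      (g := extension d (coordMul j F)) (g' := extension d (coordMul j (coordMul j F)))
      ?_ ?_ ?_ (fun ξ _ => hpow ξ) (fun ξ _ => hv ξ)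
    · simp only [ContinuousLinearMap.mul_apply'] at h
      rw [h, ← integral_const_mul]
      congr 2
      ext ξ
      ring
    · refine ((integrable_mul_four h0 h0 (h1 j) (h1 j)).const_mul 3).congr (.of_forall fun ξ => ?_)
      simp only [ContinuousLinearMap.mul_apply']
      ring
    · refine (integrable_mul_four h0 h0 h0 (h2 j)).congr (.of_forall fun ξ => ?_)
      simp only [ContinuousLinearMap.mul_apply']
      ring
    · refine (integrable_mul_four h0 h0 h0 (h1 j)).congr (.of_forall fun ξ => ?_)
      simp only [ContinuousLinearMap.mul_apply']
      ring
  have hi : ∀ j, Integrable fun ξ =>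
      extension d F ξ ^ 3 * extension d (coordMul j (coordMul j F)) ξ := fun j => by
    refine (integrable_mul_four h0 h0 h0 (h2 j)).congr (.of_forall fun ξ => ?_)
    ring
  have e : (fun ξ => extension d F ξ ^ 4) = fun ξ =>
      -∑ j, extension d F ξ ^ 3 * extension d (coordMul j (coordMul j F)) ξ := by
    ext ξ
    rw [← Finset.mul_sum, sum_extension_coordMul_coordMul hF]
    ring
  rw [e, integral_neg, integral_finsetSum _ fun j _ => hi j]
  simp_rw [hparts]
  rw [Finset.sum_neg_distrib, neg_neg, ← Finset.mul_sum]

theorem conj_extension {F : Sphere d → ℂ}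
    (hF : ∀ ζ, starRingEnd ℂ (F (sphereMap (LinearIsometryEquiv.neg ℝ) ζ)) = F ζ) (ξ : Space d) :
    starRingEnd ℂ (extension d F ξ) = extension d F ξ := by
  have e : extension d F ξ = ∫ ζ : Sphere d,
      wave (sphereMap (LinearIsometryEquiv.neg ℝ) ζ : Space d) ξ *
        F (sphereMap (LinearIsometryEquiv.neg ℝ) ζ) ∂(surfaceMeasure d) :=
    ((measurePreserving_sphereMap (LinearIsometryEquiv.neg ℝ)).integral_comp
      (measurableEmbedding_sphereMap _) fun ζ : Sphere d => wave ζ ξ * F ζ).symm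
  nth_rw 1 [e]
  rw [← integral_conj]
  refine integral_congr_ae (.of_forall fun ζ => ?_)
  simp only [map_mul, hF, conj_wave, coe_sphereMap_neg, neg_neg]
  rfl

theorem conj_coordMul {F : Sphere d → ℂ}
    (hF : ∀ ζ, starRingEnd ℂ (F (sphereMap (LinearIsometryEquiv.neg ℝ) ζ)) = F ζ) (j : Fin d)
    (ζ : Sphere d) :
    starRingEnd ℂ (coordMul j F (sphereMap (LinearIsometryEquiv.neg ℝ) ζ)) = coordMul j F ζ := by
  simp only [coordMul, map_mul, map_neg, hF, Complex.conj_I, Complex.conj_ofReal,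
    coe_sphereMap_neg, PiLp.neg_apply, Complex.ofReal_neg]
  ring

theorem lintegral_enorm_pow_of_conj {α : Type*} [MeasurableSpace α] {μ : Measure α} {a : α → ℂ}
    (ha : ∀ x, starRingEnd ℂ (a x) = a x) (hi : Integrable (fun x => a x ^ 2) μ) :
    ∫⁻ x, ‖a x‖ₑ ^ 2 ∂μ = ENNReal.ofReal (∫ x, a x ^ 2 ∂μ).re := by
  have e : ∀ x, ‖a x‖ ^ 2 = (a x ^ 2).re := fun x => by
    have := Complex.mul_conj' (a x)
    rw [ha, ← sq] at this
    rw [this, ← Complex.ofReal_pow, Complex.ofReal_re]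
  have hre : (∫ x, a x ^ 2 ∂μ).re = ∫ x, (a x ^ 2).re ∂μ := (integral_re hi).symm
  have hire : Integrable (fun x => (a x ^ 2).re) μ := hi.re
  rw [hre, ofReal_integral_eq_lintegral_ofReal hire
    (.of_forall fun x => by simp only [Pi.zero_apply, ← e]; positivity)]
  refine lintegral_congr fun x => ?_
  rw [← e, ENNReal.ofReal_pow (norm_nonneg _), ofReal_norm]

/-- Evenness makes u and its derivatives real, so the integrals of squares are genuine norms, and
the derivatives inherit the L⁴ bound by domination since |ζ_j| ≤ 1. The gain over a direct use of u²
is the factor x_j on the image side, which tames the singularity 1/|x| of the density. -/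
theorem four_mul_lintegral_extension_pow_four {g : Sphere d → ℝ}
    (hg : Integrable g (surfaceMeasure d)) (hg0 : ∀ ζ, 0 ≤ g ζ)
    (heven : ∀ ζ, g (sphereMap (LinearIsometryEquiv.neg ℝ) ζ) = g ζ)
    (hfin : ∫⁻ ξ, ‖extension d (fun ζ => (g ζ : ℂ)) ξ‖ₑ ^ 4 ≠ ∞) :
    4 * ∫⁻ ξ, ‖extension d (fun ζ => (g ζ : ℂ)) ξ‖ₑ ^ 4 =
      3 * ∑ j, ∫⁻ ξ, ‖fourierPush (sphPi d 2) vsum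
        (fun ζ => -(Complex.I * ((vsum ζ j : ℝ) : ℂ)) * ((g (ζ 0) : ℂ) * (g (ζ 1) : ℂ))) ξ‖ₑ ^ 2 := by
  obtain ⟨F, hFdef⟩ : ∃ F : Sphere d → ℂ, F = fun ζ => (g ζ : ℂ) := ⟨_, rfl⟩
  have hF : Integrable F (surfaceMeasure d) := hFdef ▸ hg.ofReal
  have hsym : ∀ ζ, starRingEnd ℂ (F (sphereMap (LinearIsometryEquiv.neg ℝ) ζ)) = F ζ := fun ζ => by
    rw [hFdef]
    simp only [heven, Complex.conj_ofReal]
  have hFn : ∀ ζ, ‖F ζ‖ = g ζ := fun ζ => by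
    rw [hFdef]
    exact Complex.norm_of_nonneg (hg0 ζ)
  have hmem : ∀ {H : Sphere d → ℂ}, Integrable H (surfaceMeasure d) → (∀ ζ, ‖H ζ‖ ≤ g ζ) →
      MemLp (extension d H) 4 := by
    intro H hH hle
    have := memLp_natCast_iff (n := 4) four_ne_zero
      (μ := (volume : Measure (Space d))) (continuous_extension hH).aestronglyMeasurable
    refine this.2 (lt_of_le_of_lt ?_ hfin.lt_top)
    exact lintegral_extension_four_le_of_norm_le hH hg (.of_forall hle)
  have h1 : ∀ j ζ, ‖coordMul j F ζ‖ ≤ g ζ := fun j ζ =>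
    (norm_coordMul_le j F ζ).trans_eq (hFn ζ)
  have h2 : ∀ j ζ, ‖coordMul j (coordMul j F) ζ‖ ≤ g ζ := fun j ζ =>
    (norm_coordMul_le j _ ζ).trans (h1 j ζ)
  have m0 := hmem hF fun ζ => (hFn ζ).le
  have m1 := fun j => hmem (integrable_coordMul hF j) (h1 j)
  have m2 := fun j => hmem (integrable_coordMul (integrable_coordMul hF j) j) (h2 j)
  have key := integral_extension_pow_four hF m0 m1 m2
  have c0 := conj_extension hsym
  have c1 := fun j => conj_extension (conj_coordMul hsym j)
  have i0 : Integrable fun ξ => (extension d F ξ ^ 2) ^ 2 :=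
    (integrable_mul_four m0 m0 m0 m0).congr (.of_forall fun ξ => by ring)
  have i1 : ∀ j, Integrable fun ξ => (extension d F ξ * extension d (coordMul j F) ξ) ^ 2 := fun j =>
    (integrable_mul_four m0 m0 (m1 j) (m1 j)).congr (.of_forall fun ξ => by ring)
  have e0 : ∫⁻ ξ, ‖extension d F ξ‖ₑ ^ 4 = ENNReal.ofReal (∫ ξ, extension d F ξ ^ 4).re := by
    have := lintegral_enorm_pow_of_conj (a := fun ξ => extension d F ξ ^ 2)
      (fun ξ => by rw [map_pow, c0]) i0
    simpa only [enorm_pow, ← pow_mul] using this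
  have e1 : ∀ j, ∫⁻ ξ, ‖fourierPush (sphPi d 2) vsum
        (fun ζ => -(Complex.I * ((vsum ζ j : ℝ) : ℂ)) * (F (ζ 0) * F (ζ 1))) ξ‖ₑ ^ 2 =
      4 * ENNReal.ofReal (∫ ξ, (extension d F ξ * extension d (coordMul j F) ξ) ^ 2).re := fun j => by
    simp_rw [two_mul_extension_mul_coordMul hF]
    rw [← lintegral_enorm_pow_of_conj (fun ξ => by rw [map_mul, c0, c1]) (i1 j),
      ← lintegral_const_mul' _ _ (by norm_num)]
    refine lintegral_congr fun ξ => ?_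
    rw [enorm_mul, mul_pow]
    congr 1
    rw [← ofReal_norm]
    norm_num
  have hF' : ∀ ζ, (g ζ : ℂ) = F ζ := fun ζ => by rw [hFdef]
  simp_rw [hF']
  have e0' : ∫⁻ ξ, ‖extension d (fun ζ => F ζ) ξ‖ₑ ^ 4 =
    ENNReal.ofReal (∫ ξ, extension d F ξ ^ 4).re := e0
  simp_rw [e0', e1]
  rw [← Finset.mul_sum, mul_left_comm, key]
  congr 1
  have hnn : ∀ j, 0 ≤ (∫ ξ, (extension d F ξ * extension d (coordMul j F) ξ) ^ 2).re := by
    intro j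
    have hre := (integral_re (i1 j)).symm
    refine (integral_nonneg fun ξ => ?_).trans_eq hre.symm
    have := Complex.mul_conj' (extension d F ξ * extension d (coordMul j F) ξ)
    rw [map_mul, c0, c1, ← sq] at this
    change (0 : ℝ) ≤ ((extension d F ξ * extension d (coordMul j F) ξ) ^ 2).re
    rw [this, ← Complex.ofReal_pow, Complex.ofReal_re]
    positivity
  rw [← ENNReal.ofReal_sum_of_nonneg fun j _ => hnn j, Complex.mul_re, Complex.re_sum]
  rw [show (3 : ℂ).im = 0 from rfl, zero_mul, sub_zero, show (3 : ℂ).re = 3 from rfl,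
    ENNReal.ofReal_mul (by norm_num)]
  norm_num

end IntegrationByParts

/-! ### The energy bound for even nonnegative densities. -/

section Energy

variable {d : ℕ}

theorem kernel_pairInner_nonneg (p : Sphere d × Sphere d) : 0 ≤ kernel d (pairInner p) := by
  obtain ⟨h1, h2⟩ := abs_le.1 (abs_pairInner_le p)
  exact mul_nonneg (Real.rpow_nonneg (by linarith) _) (Real.rpow_nonneg (by linarith) _)

theorem norm_vsum_two_sq (ζ : Fin 2 → Sphere d) :
    ‖vsum ζ‖ ^ 2 = 2 + 2 * pairInner (ζ 0, ζ 1) := by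
  rw [vsum, Fin.sum_univ_two, norm_add_sq_real, norm_coe_sphere, norm_coe_sphere, pairInner]
  ring

/-- With r = ‖ζ+η‖ and t = ⟨ζ,η⟩ one has r² = 2(1+t) and 4 - r² = 2(1-t). -/
theorem sq_mul_profile {d : ℕ} {r t : ℝ} (hr : 0 ≤ r) (hr2 : r < 2) (h : r ^ 2 = 2 + 2 * t) :
    r ^ 2 * profile d r = 2 ^ (1 / 2 + ((d : ℝ) - 3) / 2) * kernel d t := by
  have ht1 : 0 ≤ 1 + t := by nlinarith
  have ht2 : 0 ≤ 1 - t := by nlinarith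
  have h4 : 4 - r ^ 2 = 2 * (1 - t) := by linarith
  have hr' : r = 2 ^ (1 / 2 : ℝ) * (1 + t) ^ (1 / 2 : ℝ) := by
    rw [← Real.mul_rpow zero_le_two ht1, ← Real.sqrt_eq_rpow, show 2 * (1 + t) = r ^ 2 by linarith,
      Real.sqrt_sq hr]
  have h1 : r ^ 2 * r⁻¹ = r := by
    rcases eq_or_ne r 0 with h0 | h0
    · simp [h0]
    · field_simp
  rw [profile, if_pos hr2, h4, Real.mul_rpow zero_le_two ht2, ← mul_assoc, h1, kernel,
    Real.rpow_add two_pos]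
  nth_rw 1 [hr']
  ring

/-- The density of the sum of two points, together with its relation to the kernel. -/
structure IsPairDensity (w : Space d → ℝ≥0∞) (c : ℝ≥0∞) : Prop where
  measurable : Measurable w
  map_eq : (sphPi d 2).map vsum = volume.withDensity w
  sq_ne_top : ∫⁻ x, w x ^ 2 ≠ ∞
  ne_top : c ≠ ∞
  ae_eq : ∀ᵐ ζ ∂(sphPi d 2), ‖vsum ζ‖ₑ ^ 2 * w (vsum ζ) =
    c * ENNReal.ofReal (kernel d (pairInner (ζ 0, ζ 1)))

theorem exists_isPairDensity (hd : 3 ≤ d) :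
    ∃ (w : Space d → ℝ≥0∞) (c : ℝ≥0∞), IsPairDensity w c := by
  have : NeZero d := ⟨by omega⟩
  obtain ⟨c, hc, hmap⟩ := exists_map_vsum_two_eq (d := d) (by omega)
  have hw : Measurable fun x => c * radialDensity d x := (measurable_radialDensity d).const_mul c
  refine ⟨_, c * ENNReal.ofReal (2 ^ (1 / 2 + ((d : ℝ) - 3) / 2)), hw, hmap, ?_, by finiteness, ?_⟩
  · simp_rw [mul_pow]
    rw [lintegral_const_mul' _ _ (by finiteness)]
    exact ENNReal.mul_ne_top (by finiteness) (lintegral_radialDensity_sq_ne_top hd)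
  -- The profile is set to zero at r = 2, where the kernel need not vanish (d = 3), so that null
  -- sphere is discarded.
  · have h2 : ∀ᵐ x : Space d, ‖x‖ ≠ 2 := by
      rw [ae_iff]
      convert Measure.addHaar_sphere (volume : Measure (Space d)) 0 2 using 2
      ext x
      simp
    filter_upwards [ae_comp_of_ae measurable_vsum hmap h2] with ζ hζ
    have hlt : ‖vsum ζ‖ < 2 := lt_of_le_of_ne (by exact_mod_cast norm_vsum_le ζ) hζ
    have := sq_mul_profile (d := d) (norm_nonneg (vsum ζ)) hlt (norm_vsum_two_sq ζ)
    rw [mul_left_comm, radialDensity, ← ofReal_norm, ← ENNReal.ofReal_pow (norm_nonneg _),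
      ← ENNReal.ofReal_mul (by positivity), this, ENNReal.ofReal_mul (by positivity), mul_assoc]

/-- The quantity bounding the fourth power of the norm of the extension of `g`. -/
def energy (w : Space d → ℝ≥0∞) (g : Sphere d → ℝ) : ℝ≥0∞ :=
  ∫⁻ ζ, ENNReal.ofReal (g (ζ 0) ^ 2 * g (ζ 1) ^ 2) * (‖vsum ζ‖ₑ ^ 2 * w (vsum ζ)) ∂(sphPi d 2)

theorem energy_mono (w : Space d → ℝ≥0∞) {g h : Sphere d → ℝ} (hg : ∀ ζ, 0 ≤ g ζ)
    (hgh : ∀ ζ, g ζ ≤ h ζ) : energy w g ≤ energy w h := by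
  unfold energy
  gcongr with ζ
  · exact hg _
  · exact hgh _
  · exact hg _
  · exact hgh _

variable {w : Space d → ℝ≥0∞} {c : ℝ≥0∞}

theorem energy_eq (hw : IsPairDensity w c) (hd : 3 ≤ d) {g : Sphere d → ℝ}
    (hg : Integrable (fun ζ => g ζ ^ 2) (surfaceMeasure d)) :
    energy w g = c * ENNReal.ofReal
      (∫ p, g p.1 ^ 2 * g p.2 ^ 2 * kernel d (pairInner p) ∂(pairMeasure d)) := by
  have hi := integrable_mul_comp_pairInner (continuous_kernel hd) (hg.mul_prod hg)
  rw [ofReal_integral_eq_lintegral_ofReal hi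
    (.of_forall fun p => mul_nonneg (by positivity) (kernel_pairInner_nonneg p)),
    ← lintegral_const_mul' _ _ hw.ne_top]
  have h := (measurePreserving_piFinTwo (fun _ : Fin 2 => surfaceMeasure d)).lintegral_comp_emb
    (MeasurableEquiv.measurableEmbedding _) (fun p : Sphere d × Sphere d =>
      c * ENNReal.ofReal (g p.1 ^ 2 * g p.2 ^ 2 * kernel d (pairInner p)))
  refine Eq.trans ?_ h
  refine lintegral_congr_ae ?_
  filter_upwards [hw.ae_eq] with ζ hζ
  rw [hζ, mul_left_comm, ← ENNReal.ofReal_mul (by positivity)]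
  rfl

theorem energy_ne_top (hw : IsPairDensity w c) (hd : 3 ≤ d) {g : Sphere d → ℝ}
    (hg : Integrable (fun ζ => g ζ ^ 2) (surfaceMeasure d)) : energy w g ≠ ∞ := by
  rw [energy_eq hw hd hg]
  exact ENNReal.mul_ne_top hw.ne_top ENNReal.ofReal_ne_top

theorem sq_area_mul_energy_le (hw : IsPairDensity w c) (hd : 3 ≤ d) (hd7 : d ≤ 7)
    {g : Sphere d → ℝ} (hg : Integrable (fun ζ => g ζ ^ 2) (surfaceMeasure d))
    (heven : ∀ ζ, g (sphereMap (LinearIsometryEquiv.neg ℝ) ζ) = g ζ) :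
    surfaceMeasure d Set.univ ^ 2 * energy w g ≤
      (∫⁻ ζ, ‖g ζ‖ₑ ^ 2 ∂(surfaceMeasure d)) ^ 2 * energy w (fun _ => 1) := by
  have h := integral_kernel_le hd hd7 hg fun ζ => by rw [heven]
  have e : ∫⁻ ζ, ‖g ζ‖ₑ ^ 2 ∂(surfaceMeasure d) =
      ENNReal.ofReal (∫ ζ, g ζ ^ 2 ∂(surfaceMeasure d)) := by
    rw [ofReal_integral_eq_lintegral_ofReal hg (.of_forall fun ζ => sq_nonneg _)]
    refine lintegral_congr fun ζ => ?_
    rw [← ofReal_norm, ← ENNReal.ofReal_pow (norm_nonneg _), Real.norm_eq_abs, sq_abs]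
  rw [energy_eq hw hd hg, energy_eq hw hd (integrable_const _), e,
    ← ofReal_measureReal (measure_ne_top (surfaceMeasure d) Set.univ), mul_left_comm,
    mul_left_comm _ c, ← ENNReal.ofReal_pow measureReal_nonneg,
    ← ENNReal.ofReal_pow (integral_nonneg fun ζ => sq_nonneg _),
    ← ENNReal.ofReal_mul (sq_nonneg _), ← ENNReal.ofReal_mul (sq_nonneg _)]
  refine mul_le_mul' le_rfl (ENNReal.ofReal_le_ofReal ?_)
  simpa using h

theorem aestronglyMeasurable_coord_mul (j : Fin d) {g : Sphere d → ℝ}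
    (hg : AEStronglyMeasurable g (surfaceMeasure d)) :
    AEStronglyMeasurable (fun ζ : Fin 2 → Sphere d =>
      -(Complex.I * ((vsum ζ j : ℝ) : ℂ)) * ((g (ζ 0) : ℂ) * (g (ζ 1) : ℂ))) (sphPi d 2) := by
  have hgc : AEStronglyMeasurable (fun ζ => (g ζ : ℂ)) (surfaceMeasure d) :=
    Complex.continuous_ofReal.comp_aestronglyMeasurable hg
  have hprod := aestronglyMeasurable_prod_eval (k := 2) hgc
  simp only [Fin.prod_univ_two] at hprod
  have h1 : Continuous fun ζ : Fin 2 → Sphere d => -(Complex.I * ((vsum ζ j : ℝ) : ℂ)) := by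
    have : Continuous fun ζ : Fin 2 → Sphere d => vsum ζ j :=
      (EuclideanSpace.proj (𝕜 := ℝ) j).continuous.comp continuous_vsum
    fun_prop
  exact h1.aestronglyMeasurable.mul hprod

theorem sum_lintegral_coord (hw : Measurable w) {g : Sphere d → ℝ}
    (hg : AEStronglyMeasurable g (surfaceMeasure d)) :
    ∑ j, ∫⁻ ζ, ‖-(Complex.I * ((vsum ζ j : ℝ) : ℂ)) * ((g (ζ 0) : ℂ) * (g (ζ 1) : ℂ))‖ₑ ^ 2 *
      w (vsum ζ) ∂(sphPi d 2) = energy w g := by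
  have hm : ∀ j, AEMeasurable (fun ζ : Fin 2 → Sphere d =>
      ‖-(Complex.I * ((vsum ζ j : ℝ) : ℂ)) * ((g (ζ 0) : ℂ) * (g (ζ 1) : ℂ))‖ₑ ^ 2 *
        w (vsum ζ)) (sphPi d 2) := fun j => by
    exact ((aestronglyMeasurable_coord_mul j hg).enorm.pow_const _).mul
      (hw.comp measurable_vsum).aemeasurable
  rw [← lintegral_finsetSum' _ fun j _ => hm j]
  refine lintegral_congr fun ζ => ?_
  have e : ∀ j, ‖-(Complex.I * ((vsum ζ j : ℝ) : ℂ)) * ((g (ζ 0) : ℂ) * (g (ζ 1) : ℂ))‖ₑ ^ 2 *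
      w (vsum ζ) = ENNReal.ofReal (vsum ζ j ^ 2) *
        (ENNReal.ofReal (g (ζ 0) ^ 2 * g (ζ 1) ^ 2) * w (vsum ζ)) := fun j => by
    rw [← mul_assoc (ENNReal.ofReal _), ← ENNReal.ofReal_mul (sq_nonneg _), ← ofReal_norm,
      ← ENNReal.ofReal_pow (norm_nonneg _)]
    congr 2
    rw [norm_mul, norm_neg, norm_mul, Complex.norm_I, norm_mul, Complex.norm_real,
      Complex.norm_real, Complex.norm_real, mul_pow, mul_pow, mul_pow]
    simp only [Real.norm_eq_abs, sq_abs]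
    ring
  simp_rw [e]
  rw [← Finset.sum_mul, ← ENNReal.ofReal_sum_of_nonneg fun j _ => sq_nonneg _,
    ← EuclideanSpace.real_norm_sq_eq, ENNReal.ofReal_pow (norm_nonneg _), ofReal_norm]
  ring

theorem lintegral_extension_four_le_energy (hw : IsPairDensity w c) {g : Sphere d → ℝ}
    (hg : Integrable g (surfaceMeasure d)) (hg0 : ∀ ζ, 0 ≤ g ζ)
    (heven : ∀ ζ, g (sphereMap (LinearIsometryEquiv.neg ℝ) ζ) = g ζ)
    (hfin : ∫⁻ ξ, ‖extension d (fun ζ => (g ζ : ℂ)) ξ‖ₑ ^ 4 ≠ ∞) :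
    4 * ∫⁻ ξ, ‖extension d (fun ζ => (g ζ : ℂ)) ξ‖ₑ ^ 4 ≤
      3 * (ENNReal.ofReal (2 * Real.pi) ^ d * energy w g) := by
  rw [four_mul_lintegral_extension_pow_four hg hg0 heven hfin,
    ← sum_lintegral_coord hw.measurable hg.1]
  refine mul_le_mul' le_rfl ?_
  rw [Finset.mul_sum]
  refine Finset.sum_le_sum fun j _ => ?_
  exact lintegral_fourierPush_sq_le measurable_vsum hw.measurable hw.map_eq hw.sq_ne_top
    norm_vsum_le (aestronglyMeasurable_coord_mul j hg.1)

/-- For g = 1 the tensor is -i x_j, a function of the sum, so the projection bound is an equality.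
This is what makes the energy bound sharp. -/
theorem four_mul_lintegral_extension_one (hw : IsPairDensity w c) (hd : 3 ≤ d) :
    4 * ∫⁻ ξ, ‖extension d (fun _ => 1) ξ‖ₑ ^ 4 =
      3 * (ENNReal.ofReal (2 * Real.pi) ^ d * energy w (fun _ => 1)) := by
  have hfin := lintegral_extension_one_pow_ne_top (hasL2Density_two hd)
  have h := four_mul_lintegral_extension_pow_four (d := d) (g := fun _ => 1) (integrable_const _)
    (fun _ => zero_le_one) (fun _ => rfl) (by simpa using hfin)
  have hs := sum_lintegral_coord (g := fun _ => (1 : ℝ)) hw.measurable aestronglyMeasurable_const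
  have htop := energy_ne_top hw hd (g := fun _ => 1) (integrable_const _)
  simp only [Complex.ofReal_one, mul_one] at h hs
  rw [h, ← hs]
  congr 1
  rw [Finset.mul_sum]
  refine Finset.sum_congr rfl fun j _ => ?_
  have hm : Measurable fun x : Space d => -(Complex.I * ((x j : ℝ) : ℂ)) := by
    have : Continuous fun x : Space d => x j := (EuclideanSpace.proj (𝕜 := ℝ) j).continuous
    exact Continuous.measurable (by fun_prop)
  refine lintegral_fourierPush_comp_sq_eq (G := fun x : Space d => -(Complex.I * ((x j : ℝ) : ℂ)))
    measurable_vsum hw.measurable hw.map_eq hw.sq_ne_top norm_vsum_le hm ?_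
  rw [← hs] at htop
  exact ne_top_of_le_ne_top htop (Finset.single_le_sum (f := fun j => ∫⁻ ζ : Fin 2 → Sphere d,
    ‖-(Complex.I * ((vsum ζ j : ℝ) : ℂ))‖ₑ ^ 2 * w (vsum ζ) ∂(sphPi d 2))
    (fun j _ => by positivity) (Finset.mem_univ j))

theorem tendsto_extension {F : ℕ → Sphere d → ℂ} {f : Sphere d → ℂ} {b : Sphere d → ℝ}
    (hF : ∀ n, AEStronglyMeasurable (F n) (surfaceMeasure d)) (hb : Integrable b (surfaceMeasure d))
    (hle : ∀ n ζ, ‖F n ζ‖ ≤ b ζ)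
    (hlim : ∀ ζ, Filter.Tendsto (fun n => F n ζ) Filter.atTop (nhds (f ζ))) (ξ : Space d) :
    Filter.Tendsto (fun n => extension d (F n) ξ) Filter.atTop (nhds (extension d f ξ)) := by
  refine tendsto_integral_of_dominated_convergence b (fun n => ?_) hb
    (fun n => .of_forall fun ζ => ?_) (.of_forall fun ζ => (hlim ζ).const_mul _)
  · exact (Continuous.aestronglyMeasurable (continuous_wave continuous_subtype_val
      continuous_const)).mul (hF n)
  · have := hle n ζ
    rw [norm_mul]
    refine (mul_le_of_le_one_left (norm_nonneg _) (norm_wave (ζ : Space d) ξ).le).trans this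

theorem extension_four_ne_top_of_bounded (hd : 3 ≤ d) {g : Sphere d → ℝ}
    (hg : AEStronglyMeasurable g (surfaceMeasure d)) {C : ℝ} (hC : ∀ ζ, ‖g ζ‖ ≤ C) :
    ∫⁻ ξ, ‖extension d (fun ζ => (g ζ : ℂ)) ξ‖ₑ ^ 4 ≠ ∞ := by
  have hd0 : d ≠ 0 := by omega
  have h := lintegral_extension_pow_le hd0 two_ne_zero (hasL2Density_two hd)
    (Complex.continuous_ofReal.comp_aestronglyMeasurable hg)
  have h1 := lintegral_extension_one_pow_ne_top (hasL2Density_two hd)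
  have h2 : ∫⁻ ζ, ‖((g ζ : ℝ) : ℂ)‖ₑ ^ (2 * 2) ∂(surfaceMeasure d) ≠ ∞ := by
    refine ne_top_of_le_ne_top (b := ∫⁻ ζ : Sphere d, ENNReal.ofReal C ^ (2 * 2)
      ∂(surfaceMeasure d)) ?_ ?_
    · rw [lintegral_const]
      exact ENNReal.mul_ne_top (by finiteness) (measure_ne_top _ _)
    · gcongr with ζ
      rw [← ofReal_norm, Complex.norm_real]
      exact ENNReal.ofReal_le_ofReal (hC ζ)
  intro htop
  rw [show 2 * 2 = 4 from rfl] at h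
  have htop' : ∫⁻ ξ, ‖extension d (Complex.ofReal ∘ g) ξ‖ₑ ^ 4 = ∞ := htop
  have h' : surfaceMeasure d Set.univ * ∫⁻ ξ, ‖extension d (Complex.ofReal ∘ g) ξ‖ₑ ^ 4 ≤
    (∫⁻ ξ, ‖extension d (fun _ => 1) ξ‖ₑ ^ (2 * 2)) *
      ∫⁻ ζ, ‖((g ζ : ℝ) : ℂ)‖ₑ ^ (2 * 2) ∂(surfaceMeasure d) := h
  rw [htop', ENNReal.mul_top (surfaceMeasure_univ_ne_zero hd0)] at h'
  exact ENNReal.mul_ne_top h1 h2 (top_le_iff.1 h')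

/-- The integration by parts needs a finite L⁴ norm. Truncations min(g, n) have one by the bound on
L⁴, they keep g even, their energy increases with n, and Fatou passes to the limit. -/
theorem extension_four_bound (hw : IsPairDensity w c) (hd : 3 ≤ d) {g : Sphere d → ℝ}
    (hg : Integrable g (surfaceMeasure d)) (hg0 : ∀ ζ, 0 ≤ g ζ)
    (heven : ∀ ζ, g (sphereMap (LinearIsometryEquiv.neg ℝ) ζ) = g ζ) :
    4 * ∫⁻ ξ, ‖extension d (fun ζ => (g ζ : ℂ)) ξ‖ₑ ^ 4 ≤
      3 * (ENNReal.ofReal (2 * Real.pi) ^ d * energy w g) := by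
  obtain ⟨F, hF⟩ : ∃ F : ℕ → Sphere d → ℝ, F = fun (n : ℕ) ζ => min (g ζ) (n : ℝ) := ⟨_, rfl⟩
  have hF0 : ∀ n ζ, 0 ≤ F n ζ := fun n ζ => hF ▸ le_min (hg0 ζ) (Nat.cast_nonneg n)
  have hFg : ∀ n ζ, F n ζ ≤ g ζ := fun n ζ => hF ▸ min_le_left _ _
  have hFm : ∀ n, AEStronglyMeasurable (F n) (surfaceMeasure d) := fun n =>
    hF ▸ hg.1.inf aestronglyMeasurable_const
  have hFn : ∀ n ζ, ‖F n ζ‖ ≤ g ζ := fun n ζ => by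
    rw [Real.norm_of_nonneg (hF0 n ζ)]
    exact hFg n ζ
  have hFi : ∀ n, Integrable (F n) (surfaceMeasure d) := fun n =>
    hg.mono' (hFm n) (.of_forall (hFn n))
  have hbd : ∀ n, 4 * ∫⁻ ξ, ‖extension d (fun ζ => (F n ζ : ℂ)) ξ‖ₑ ^ 4 ≤
      3 * (ENNReal.ofReal (2 * Real.pi) ^ d * energy w g) := fun n => by
    refine (lintegral_extension_four_le_energy hw (hFi n) (hF0 n) (fun ζ => ?_) ?_).trans ?_
    · rw [hF]
      simp only [heven]
    · refine extension_four_ne_top_of_bounded hd (hFm n) (C := n) fun ζ => ?_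
      rw [Real.norm_of_nonneg (hF0 n ζ), hF]
      exact min_le_right _ _
    · gcongr
      exact energy_mono w (hF0 n) (hFg n)
  have hlim : ∀ ξ, Filter.Tendsto (fun n => 4 * ‖extension d (fun ζ => (F n ζ : ℂ)) ξ‖ₑ ^ 4)
      Filter.atTop (nhds (4 * ‖extension d (fun ζ => (g ζ : ℂ)) ξ‖ₑ ^ 4)) := fun ξ => by
    refine ENNReal.Tendsto.const_mul ?_ (Or.inr (by norm_num))
    refine ((ENNReal.continuous_pow 4).tendsto _).comp ((continuous_enorm.tendsto _).comp ?_)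
    refine tendsto_extension (b := g)
      (fun n => Complex.continuous_ofReal.comp_aestronglyMeasurable (hFm n)) hg
      (fun n ζ => by rw [Complex.norm_real]; exact hFn n ζ) (fun ζ => ?_) ξ
    refine tendsto_const_nhds.congr' ?_
    obtain ⟨N, hN⟩ := exists_nat_ge (g ζ)
    filter_upwards [Filter.eventually_ge_atTop N] with n hn
    have : g ζ ≤ n := hN.trans (by exact_mod_cast hn)
    rw [hF]
    simp only [min_eq_left this]
  rw [← lintegral_const_mul' _ _ (by norm_num)]
  have hliminf : ∀ ξ, 4 * ‖extension d (fun ζ => (g ζ : ℂ)) ξ‖ₑ ^ 4 =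
      Filter.liminf (fun n => 4 * ‖extension d (fun ζ => (F n ζ : ℂ)) ξ‖ₑ ^ 4) Filter.atTop :=
    fun ξ => (hlim ξ).liminf_eq.symm
  simp_rw [hliminf]
  refine (lintegral_liminf_le fun n => ?_).trans ?_
  · exact Measurable.const_mul ((continuous_extension (hFi n).ofReal).measurable.enorm.pow_const 4) 4
  · refine Filter.liminf_le_of_le (by isBoundedDefault) fun b hb => ?_
    obtain ⟨n, hn⟩ := hb.exists
    rw [lintegral_const_mul' _ _ (by norm_num)] at hn
    exact hn.trans (hbd n)

/-- The sharp inequality for even nonnegative densities. -/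
theorem lintegral_extension_four_le_of_even (hd : 3 ≤ d) (hd7 : d ≤ 7) {g : Sphere d → ℝ}
    (hg : Integrable g (surfaceMeasure d)) (hg2 : Integrable (fun ζ => g ζ ^ 2) (surfaceMeasure d))
    (hg0 : ∀ ζ, 0 ≤ g ζ) (heven : ∀ ζ, g (sphereMap (LinearIsometryEquiv.neg ℝ) ζ) = g ζ) :
    surfaceMeasure d Set.univ ^ 2 * ∫⁻ ξ, ‖extension d (fun ζ => (g ζ : ℂ)) ξ‖ₑ ^ 4 ≤
      (∫⁻ ζ, ‖g ζ‖ₑ ^ 2 ∂(surfaceMeasure d)) ^ 2 *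
        ∫⁻ ξ, ‖extension d (fun _ => 1) ξ‖ₑ ^ 4 := by
  obtain ⟨w, c, hw⟩ := exists_isPairDensity hd
  rw [← ENNReal.mul_le_mul_iff_right (show (4 : ℝ≥0∞) ≠ 0 by norm_num) (by norm_num),
    mul_left_comm, mul_left_comm 4, four_mul_lintegral_extension_one hw hd]
  calc surfaceMeasure d Set.univ ^ 2 *
        (4 * ∫⁻ ξ, ‖extension d (fun ζ => (g ζ : ℂ)) ξ‖ₑ ^ 4)
      ≤ surfaceMeasure d Set.univ ^ 2 * (3 * (ENNReal.ofReal (2 * Real.pi) ^ d * energy w g)) := by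
        exact mul_le_mul' le_rfl (extension_four_bound hw hd hg hg0 heven)
    _ = 3 * (ENNReal.ofReal (2 * Real.pi) ^ d * (surfaceMeasure d Set.univ ^ 2 * energy w g)) := by
        ring
    _ ≤ 3 * (ENNReal.ofReal (2 * Real.pi) ^ d * ((∫⁻ ζ, ‖g ζ‖ₑ ^ 2 ∂(surfaceMeasure d)) ^ 2 *
          energy w (fun _ => 1))) := by
        exact mul_le_mul' le_rfl (mul_le_mul' le_rfl (sq_area_mul_energy_le hw hd hd7 hg2 heven))
    _ = _ := by ring

end Energy

/-! ### Even nonnegative maximizers. -/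

section EvenEquality

variable {d : ℕ}

theorem le_of_sum_le_sum {ι : Type*} [Fintype ι] {a b : ι → ℝ≥0∞} (hba : ∀ i, b i ≤ a i)
    (ha : ∀ i, a i ≠ ∞) (h : ∑ i, a i ≤ ∑ i, b i) (i : ι) : a i ≤ b i := by
  classical
  rw [← Finset.add_sum_erase _ _ (Finset.mem_univ i),
    ← Finset.add_sum_erase _ b (Finset.mem_univ i)] at h
  have hfin : ∑ j ∈ Finset.univ.erase i, a j ≠ ∞ := ENNReal.sum_ne_top.2 fun j _ => ha j
  exact (ENNReal.add_le_add_iff_right hfin).1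
    (h.trans (add_le_add le_rfl (Finset.sum_le_sum fun j _ => hba j)))

/-- Equality in the sum of d projection bounds with finite terms forces equality in each, so every
x_j g⊗g is a function of the sum x. -/
theorem exists_factor_of_even_eq (hd : 3 ≤ d) (hd7 : d ≤ 7) {g : Sphere d → ℝ}
    (hg : Integrable g (surfaceMeasure d)) (hg2 : Integrable (fun ζ => g ζ ^ 2) (surfaceMeasure d))
    (hg0 : ∀ ζ, 0 ≤ g ζ) (heven : ∀ ζ, g (sphereMap (LinearIsometryEquiv.neg ℝ) ζ) = g ζ)
    (heq : (∫⁻ ζ, ‖g ζ‖ₑ ^ 2 ∂(surfaceMeasure d)) ^ 2 *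
        ∫⁻ ξ, ‖extension d (fun _ => 1) ξ‖ₑ ^ 4 ≤
      surfaceMeasure d Set.univ ^ 2 * ∫⁻ ξ, ‖extension d (fun ζ => (g ζ : ℂ)) ξ‖ₑ ^ 4) :
    ∃ G : Space d → ℂ, Measurable G ∧
      ∀ᵐ ζ ∂(sphPi d 2), ∏ i, (g (ζ i) : ℂ) = G (vsum ζ) := by
  have hd0 : d ≠ 0 := by omega
  obtain ⟨w, c, hw⟩ := exists_isPairDensity hd
  have hQ := energy_ne_top hw hd hg2
  have hσ0 : surfaceMeasure d Set.univ ^ 2 ≠ 0 :=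
    pow_ne_zero _ (surfaceMeasure_univ_ne_zero hd0)
  have hσt : surfaceMeasure d Set.univ ^ 2 ≠ ∞ := ENNReal.pow_ne_top (measure_ne_top _ _)
  have hp0 := two_pi_pow_ne_zero d
  have hpt := two_pi_pow_ne_top d
  obtain ⟨A, hA⟩ : ∃ A, A = ENNReal.ofReal (2 * Real.pi) ^ d := ⟨_, rfl⟩
  rw [← hA] at hp0 hpt
  have hbound := extension_four_bound hw hd hg hg0 heven
  obtain ⟨X, hX⟩ : ∃ X, X = ∫⁻ ξ, ‖extension d (fun ζ => (g ζ : ℂ)) ξ‖ₑ ^ 4 := ⟨_, rfl⟩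
  have hXt : X ≠ ∞ := by
    intro htop
    rw [← hX, htop, ENNReal.mul_top (by norm_num)] at hbound
    exact (show 3 * (ENNReal.ofReal (2 * Real.pi) ^ d * energy w g) ≠ ∞ by finiteness)
      (top_le_iff.1 hbound)
  have hid := four_mul_lintegral_extension_pow_four hg hg0 heven (hX ▸ hXt)
  have hone := four_mul_lintegral_extension_one hw hd
  have hEn := sq_area_mul_energy_le hw hd hd7 hg2 heven
  rw [← hX] at hid heq
  rw [← hA] at hone
  have hkey : A * energy w g ≤ ∑ j, ∫⁻ ξ, ‖fourierPush (sphPi d 2) vsum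
      (fun ζ => -(Complex.I * ((vsum ζ j : ℝ) : ℂ)) *
        ((g (ζ 0) : ℂ) * (g (ζ 1) : ℂ))) ξ‖ₑ ^ 2 := by
    rw [← ENNReal.mul_le_mul_iff_right (show (3 : ℝ≥0∞) ≠ 0 by norm_num) (by norm_num), ← hid,
      ← ENNReal.mul_le_mul_iff_right hσ0 hσt]
    calc surfaceMeasure d Set.univ ^ 2 * (3 * (A * energy w g))
        = 3 * (A * (surfaceMeasure d Set.univ ^ 2 * energy w g)) := by ring
      _ ≤ 3 * (A * ((∫⁻ ζ, ‖g ζ‖ₑ ^ 2 ∂(surfaceMeasure d)) ^ 2 * energy w (fun _ => 1))) :=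
          mul_le_mul' le_rfl (mul_le_mul' le_rfl hEn)
      _ = (∫⁻ ζ, ‖g ζ‖ₑ ^ 2 ∂(surfaceMeasure d)) ^ 2 * (3 * (A * energy w (fun _ => 1))) := by ring
      _ = 4 * ((∫⁻ ζ, ‖g ζ‖ₑ ^ 2 ∂(surfaceMeasure d)) ^ 2 *
            ∫⁻ ξ, ‖extension d (fun _ => 1) ξ‖ₑ ^ 4) := by
          rw [← hone]
          ring
      _ ≤ 4 * (surfaceMeasure d Set.univ ^ 2 * X) := mul_le_mul' le_rfl heq
      _ = _ := by ring
  have hsum := sum_lintegral_coord hw.measurable hg.1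
  have hfin : ∀ j, ∫⁻ ζ, ‖-(Complex.I * ((vsum ζ j : ℝ) : ℂ)) *
      ((g (ζ 0) : ℂ) * (g (ζ 1) : ℂ))‖ₑ ^ 2 * w (vsum ζ) ∂(sphPi d 2) ≠ ∞ := by
    intro j
    rw [← hsum] at hQ
    exact (ENNReal.sum_ne_top.1 hQ) j (Finset.mem_univ j)
  have hle := fun j => lintegral_fourierPush_sq_le measurable_vsum hw.measurable hw.map_eq
    hw.sq_ne_top norm_vsum_le (aestronglyMeasurable_coord_mul j hg.1)
  have hge : ∀ j, A * ∫⁻ ζ, ‖-(Complex.I * ((vsum ζ j : ℝ) : ℂ)) *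
      ((g (ζ 0) : ℂ) * (g (ζ 1) : ℂ))‖ₑ ^ 2 * w (vsum ζ) ∂(sphPi d 2) ≤
      ∫⁻ ξ, ‖fourierPush (sphPi d 2) vsum (fun ζ => -(Complex.I * ((vsum ζ j : ℝ) : ℂ)) *
        ((g (ζ 0) : ℂ) * (g (ζ 1) : ℂ))) ξ‖ₑ ^ 2 := by
    intro j
    rw [← hsum, Finset.mul_sum] at hkey
    exact le_of_sum_le_sum (fun j => hA ▸ hle j) (fun j => ENNReal.mul_ne_top hpt (hfin j)) hkey j
  have hfac := fun j => exists_factor_of_lintegral_fourierPush_sq_eq measurable_vsum hw.measurable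
    hw.map_eq hw.sq_ne_top norm_vsum_le (aestronglyMeasurable_coord_mul j hg.1) (hfin j)
    (hA ▸ hge j)
  choose G hGm hG using hfac
  -- The d factorizations are recombined through ∑ (i x_j)(-i x_j) = |x|², which is nonzero almost
  -- everywhere.
  refine ⟨fun x => ∑ j, Complex.I * ((x j : ℝ) : ℂ) * G j x / ((‖x‖ ^ 2 : ℝ) : ℂ), ?_, ?_⟩
  · refine Finset.measurable_sum _ fun j _ => ?_
    have : Measurable fun x : Space d => x j :=
      (EuclideanSpace.proj (𝕜 := ℝ) j).continuous.measurable
    exact ((Measurable.const_mul (Complex.measurable_ofReal.comp this) _).mul (hGm j)).div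
      (Complex.measurable_ofReal.comp (measurable_norm.pow_const 2))
  · have : Nontrivial (Space d) := by
      have : NeZero d := ⟨hd0⟩
      infer_instance
    have hne : ∀ᵐ x : Space d, x ≠ 0 := by simp [ae_iff]
    filter_upwards [ae_all_iff.2 hG, ae_comp_of_ae measurable_vsum hw.map_eq hne] with ζ h1 h2
    have h3 : ((‖vsum ζ‖ ^ 2 : ℝ) : ℂ) ≠ 0 := by
      exact_mod_cast (pow_ne_zero 2 (norm_ne_zero_iff.2 h2))
    simp_rw [← h1]
    rw [← Finset.sum_div, eq_div_iff h3, EuclideanSpace.real_norm_sq_eq, Fin.prod_univ_two]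
    push_cast
    rw [Finset.mul_sum]
    refine Finset.sum_congr rfl fun j _ => ?_
    linear_combination ((g (ζ 0) : ℂ) * (g (ζ 1) : ℂ)) * ((vsum ζ j : ℝ) : ℂ) ^ 2 * Complex.I_sq

theorem ae_comp_neg {p : Sphere d → Prop} (h : ∀ᵐ ζ ∂(surfaceMeasure d), p ζ) :
    ∀ᵐ ζ ∂(surfaceMeasure d), p (sphereMap (LinearIsometryEquiv.neg ℝ) ζ) :=
  (measurePreserving_sphereMap (LinearIsometryEquiv.neg ℝ)).quasiMeasurePreserving.ae h

/-- The even nonnegative maximizers are constant. -/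
theorem exists_const_of_even_eq (hd : 3 ≤ d) (hd7 : d ≤ 7) {g : Sphere d → ℝ}
    (hg : Integrable g (surfaceMeasure d)) (hg2 : Integrable (fun ζ => g ζ ^ 2) (surfaceMeasure d))
    (hg0 : ∀ ζ, 0 ≤ g ζ) (heven : ∀ ζ, g (sphereMap (LinearIsometryEquiv.neg ℝ) ζ) = g ζ)
    (hne : ¬ g =ᵐ[surfaceMeasure d] 0)
    (heq : (∫⁻ ζ, ‖g ζ‖ₑ ^ 2 ∂(surfaceMeasure d)) ^ 2 *
        ∫⁻ ξ, ‖extension d (fun _ => 1) ξ‖ₑ ^ 4 ≤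
      surfaceMeasure d Set.univ ^ 2 * ∫⁻ ξ, ‖extension d (fun ζ => (g ζ : ℂ)) ξ‖ₑ ^ 4) :
    ∃ r : ℝ, 0 ≤ r ∧ ∀ᵐ ζ ∂(surfaceMeasure d), g ζ = r := by
  obtain ⟨c, z, -, hz⟩ := ae_eq_pexp_of_prod_eq_comp (k := 2) (Or.inl ⟨hd, le_rfl⟩) hg.ofReal
    (fun h => hne (h.mono fun ζ hζ => by simpa using hζ))
    (exists_factor_of_even_eq hd hd7 hg hg2 hg0 heven heq)
  refine ⟨‖c‖, norm_nonneg c, ?_⟩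
  filter_upwards [hz, ae_comp_neg hz] with ζ h1 h2
  -- Since g is even, g(ζ)² = g(ζ)g(-ζ), and the exponentials at ζ and -ζ cancel, leaving c².
  have h3 : pexp z (ζ : Space d) * pexp z (-(ζ : Space d)) = 1 := by
    rw [pexp, pexp, ← Complex.exp_add, map_neg, add_neg_cancel, Complex.exp_zero]
  rw [heven, coe_sphereMap_neg] at h2
  have h4 : ((g ζ : ℝ) : ℂ) ^ 2 = c ^ 2 := by
    calc ((g ζ : ℝ) : ℂ) ^ 2 = (g ζ : ℂ) * (g ζ : ℂ) := sq _
      _ = (c * pexp z ζ) * (c * pexp z (-(ζ : Space d))) := by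
          exact congrArg₂ _ h1 h2
      _ = c ^ 2 * (pexp z (ζ : Space d) * pexp z (-(ζ : Space d))) := by ring
      _ = c ^ 2 := by rw [h3, mul_one]
  have h5 := congrArg norm h4
  rw [norm_pow, norm_pow, Complex.norm_of_nonneg (hg0 ζ)] at h5
  exact (sq_eq_sq₀ (hg0 ζ) (norm_nonneg c)).1 h5

end EvenEquality

/-! ### Reduction to even functions and the sharp inequality from L² to L⁴. -/

section Symmetrization

variable {d : ℕ}

/-- The antipodal map. -/
def antipode (ζ : Sphere d) : Sphere d := sphereMap (LinearIsometryEquiv.neg ℝ) ζ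

theorem antipode_antipode (ζ : Sphere d) : antipode (antipode ζ) = ζ := by
  ext1
  rw [antipode, antipode, coe_sphereMap_neg, coe_sphereMap_neg, neg_neg]

theorem measurePreserving_antipode :
    MeasurePreserving (antipode (d := d)) (surfaceMeasure d) (surfaceMeasure d) :=
  measurePreserving_sphereMap _

theorem measurableEmbedding_antipode : MeasurableEmbedding (antipode (d := d)) :=
  measurableEmbedding_sphereMap _

/-- The reflection `ζ ↦ conj (f (-ζ))`. -/
def reflect (f : Sphere d → ℂ) (ζ : Sphere d) : ℂ := starRingEnd ℂ (f (antipode ζ))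

/-- The even function `√((|f(ζ)|² + |f(-ζ)|²) / 2)`. -/
def symmetrize (f : Sphere d → ℂ) (ζ : Sphere d) : ℝ :=
  √((‖f ζ‖ ^ 2 + ‖f (antipode ζ)‖ ^ 2) / 2)

theorem symmetrize_nonneg (f : Sphere d → ℂ) (ζ : Sphere d) : 0 ≤ symmetrize f ζ := Real.sqrt_nonneg _

theorem symmetrize_sq (f : Sphere d → ℂ) (ζ : Sphere d) :
    symmetrize f ζ ^ 2 = (‖f ζ‖ ^ 2 + ‖f (antipode ζ)‖ ^ 2) / 2 :=
  Real.sq_sqrt (by positivity)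

theorem symmetrize_antipode (f : Sphere d → ℂ) (ζ : Sphere d) :
    symmetrize f (antipode ζ) = symmetrize f ζ := by
  rw [symmetrize, symmetrize, antipode_antipode, add_comm]

theorem memLp_comp_antipode {f : Sphere d → ℂ} (hf : MemLp f 2 (surfaceMeasure d)) :
    MemLp (fun ζ => f (antipode ζ)) 2 (surfaceMeasure d) :=
  hf.comp_measurePreserving measurePreserving_antipode

theorem integrable_norm_sq {f : Sphere d → ℂ} (hf : MemLp f 2 (surfaceMeasure d)) :
    Integrable (fun ζ => ‖f ζ‖ ^ 2) (surfaceMeasure d) := by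
  have := hf.integrable_norm_pow (p := 2) (by norm_num)
  simpa using this

theorem integrable_symmetrize_sq {f : Sphere d → ℂ} (hf : MemLp f 2 (surfaceMeasure d)) :
    Integrable (fun ζ => symmetrize f ζ ^ 2) (surfaceMeasure d) := by
  simp_rw [symmetrize_sq]
  exact ((integrable_norm_sq hf).add (integrable_norm_sq (memLp_comp_antipode hf))).div_const 2

theorem integrable_symmetrize {f : Sphere d → ℂ} (hf : MemLp f 2 (surfaceMeasure d)) :
    Integrable (symmetrize f) (surfaceMeasure d) := by
  have h1 : Integrable f (surfaceMeasure d) := hf.integrable (by norm_num)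
  have h2 : Integrable (fun ζ => f (antipode ζ)) (surfaceMeasure d) :=
    (memLp_comp_antipode hf).integrable (by norm_num)
  refine (h1.norm.add h2.norm).mono' ?_ (.of_forall fun ζ => ?_)
  · exact Real.continuous_sqrt.comp_aestronglyMeasurable
      ((((h1.1.norm.pow 2).add (h2.1.norm.pow 2))).mul_const (2⁻¹ : ℝ))
  · rw [Real.norm_of_nonneg (symmetrize_nonneg f ζ), Pi.add_apply, symmetrize]
    refine Real.sqrt_le_iff.2 ⟨by positivity, ?_⟩
    nlinarith [norm_nonneg (f ζ), norm_nonneg (f (antipode ζ)),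
      mul_nonneg (norm_nonneg (f ζ)) (norm_nonneg (f (antipode ζ)))]

theorem lintegral_symmetrize_sq {f : Sphere d → ℂ} (hf : MemLp f 2 (surfaceMeasure d)) :
    ∫⁻ ζ, ‖symmetrize f ζ‖ₑ ^ 2 ∂(surfaceMeasure d) = ∫⁻ ζ, ‖f ζ‖ₑ ^ 2 ∂(surfaceMeasure d) := by
  have hc : ∀ {E : Type} [NormedAddCommGroup E] {u : Sphere d → E},
      Integrable (fun ζ => ‖u ζ‖ ^ 2) (surfaceMeasure d) →
      ∫⁻ ζ, ‖u ζ‖ₑ ^ 2 ∂(surfaceMeasure d) =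
        ENNReal.ofReal (∫ ζ, ‖u ζ‖ ^ 2 ∂(surfaceMeasure d)) := by
    intro E _ u hu
    rw [ofReal_integral_eq_lintegral_ofReal hu (.of_forall fun ζ => sq_nonneg _)]
    refine lintegral_congr fun ζ => ?_
    rw [ENNReal.ofReal_pow (norm_nonneg _), ofReal_norm]
  have e : ∀ ζ, ‖symmetrize f ζ‖ ^ 2 = (‖f ζ‖ ^ 2 + ‖f (antipode ζ)‖ ^ 2) / 2 := fun ζ => by
    rw [Real.norm_eq_abs, sq_abs, symmetrize_sq]
  have hi := integrable_norm_sq hf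
  have hi' := integrable_norm_sq (memLp_comp_antipode hf)
  rw [hc hi, hc (by simpa using integrable_symmetrize_sq hf)]
  congr 1
  simp_rw [e]
  rw [integral_div, integral_add hi hi',
    measurePreserving_antipode.integral_comp measurableEmbedding_antipode fun ζ => ‖f ζ‖ ^ 2]
  ring

theorem norm_reflect (f : Sphere d → ℂ) (ζ : Sphere d) : ‖reflect f ζ‖ = ‖f (antipode ζ)‖ :=
  RCLike.norm_conj _

theorem memLp_reflect {f : Sphere d → ℂ} (hf : MemLp f 2 (surfaceMeasure d)) :
    MemLp (reflect f) 2 (surfaceMeasure d) :=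
  (memLp_comp_antipode hf).of_le
    (Complex.continuous_conj.comp_aestronglyMeasurable (memLp_comp_antipode hf).1)
    (.of_forall fun ζ => (norm_reflect f ζ).le)

theorem extension_reflect (f : Sphere d → ℂ) (ξ : Space d) :
    extension d (reflect f) ξ = starRingEnd ℂ (extension d f ξ) := by
  have e : extension d (reflect f) ξ = ∫ ζ : Sphere d,
      wave (antipode ζ : Space d) ξ * reflect f (antipode ζ) ∂(surfaceMeasure d) :=
    (measurePreserving_antipode.integral_comp
      measurableEmbedding_antipode fun ζ : Sphere d => wave ζ ξ * reflect f ζ).symm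
  rw [e, extension, ← integral_conj]
  refine integral_congr_ae (.of_forall fun ζ => ?_)
  simp only [map_mul, reflect, antipode_antipode]
  congr 1
  rw [antipode, coe_sphereMap_neg, ← conj_wave]
  rfl

/-- The symmetrized tensor product of `f` and its reflection. -/
def symTensor (f : Sphere d → ℂ) (ζ : Fin 2 → Sphere d) : ℂ :=
  (f (ζ 0) * reflect f (ζ 1) + reflect f (ζ 0) * f (ζ 1)) / 2

theorem integrable_symTensor {f : Sphere d → ℂ} (hf : MemLp f 2 (surfaceMeasure d)) :
    Integrable (symTensor f) (sphPi d 2) := by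
  have h1 : Integrable f (surfaceMeasure d) := hf.integrable (by norm_num)
  have h2 : Integrable (reflect f) (surfaceMeasure d) := (memLp_reflect hf).integrable (by norm_num)
  exact ((integrable_mul_sphPi_two h1 h2).add (integrable_mul_sphPi_two h2 h1)).div_const 2

theorem fourierPush_symTensor {f : Sphere d → ℂ} (hf : MemLp f 2 (surfaceMeasure d))
    (ξ : Space d) : fourierPush (sphPi d 2) vsum (symTensor f) ξ =
      extension d f ξ * starRingEnd ℂ (extension d f ξ) := by
  have h1 := integrable_sphere_wave_mul (hf.integrable (by norm_num)) ξ
  have h2 := integrable_sphere_wave_mul ((memLp_reflect hf).integrable (by norm_num)) ξ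
  have e : (fun ζ : Fin 2 → Sphere d => wave (vsum ζ) ξ * symTensor f ζ) = fun ζ =>
      ((wave (ζ 0 : Space d) ξ * f (ζ 0)) * (wave (ζ 1 : Space d) ξ * reflect f (ζ 1)) +
      (wave (ζ 0 : Space d) ξ * reflect f (ζ 0)) * (wave (ζ 1 : Space d) ξ * f (ζ 1))) / 2 := by
    ext ζ
    simp only [vsum, Fin.sum_univ_two, wave_add, symTensor]
    ring
  rw [fourierPush, e, integral_div, integral_add (integrable_mul_sphPi_two h1 h2)
    (integrable_mul_sphPi_two h2 h1),
    integral_mul_sphPi_two (fun ζ : Sphere d => wave (ζ : Space d) ξ * f ζ)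
      (fun ζ : Sphere d => wave (ζ : Space d) ξ * reflect f ζ),
    integral_mul_sphPi_two (fun ζ : Sphere d => wave (ζ : Space d) ξ * reflect f ζ)
      (fun ζ : Sphere d => wave (ζ : Space d) ξ * f ζ)]
  change (extension d f ξ * extension d (reflect f) ξ +
    extension d (reflect f) ξ * extension d f ξ) / 2 = _
  rw [extension_reflect]
  ring

/-- As |u|⁴ = |u ū|² and ū is the transform of the reflection, f⊗f may be replaced by the
symmetrized product of f with its reflection. The domination argument then brings in both f(ζ) and
f(-ζ). -/
theorem lintegral_extension_four_eq {f : Sphere d → ℂ} (hf : MemLp f 2 (surfaceMeasure d)) :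
    ∫⁻ ξ, ‖extension d f ξ‖ₑ ^ 4 =
      ∫⁻ ξ, ‖fourierPush (sphPi d 2) vsum (symTensor f) ξ‖ₑ ^ 2 := by
  refine lintegral_congr fun ξ => ?_
  have : ‖starRingEnd ℂ (extension d f ξ)‖ₑ = ‖extension d f ξ‖ₑ := by
    rw [← ofReal_norm, ← ofReal_norm, RCLike.norm_conj]
  rw [fourierPush_symTensor hf, enorm_mul, this]
  ring

theorem norm_symTensor_le_half (f : Sphere d → ℂ) (ζ : Fin 2 → Sphere d) :
    ‖symTensor f ζ‖ ≤
      (‖f (ζ 0)‖ * ‖f (antipode (ζ 1))‖ + ‖f (antipode (ζ 0))‖ * ‖f (ζ 1)‖) / 2 := by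
  rw [symTensor, norm_div, Complex.norm_two]
  gcongr
  refine (norm_add_le _ _).trans_eq ?_
  rw [norm_mul, norm_mul, norm_reflect, norm_reflect]

/-- Cauchy-Schwarz for the vectors (|f(ζ₀)|, |f(-ζ₀)|) and (|f(-ζ₁)|, |f(ζ₁)|). -/
theorem norm_symTensor_le (f : Sphere d → ℂ) (ζ : Fin 2 → Sphere d) :
    ‖symTensor f ζ‖ ≤ symmetrize f (ζ 0) * symmetrize f (ζ 1) := by
  refine (norm_symTensor_le_half f ζ).trans (abs_le_of_sq_le_sq' ?_
    (mul_nonneg (symmetrize_nonneg f _) (symmetrize_nonneg f _))).2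
  rw [mul_pow, symmetrize_sq, symmetrize_sq]
  nlinarith [sq_nonneg (‖f (ζ 0)‖ * ‖f (ζ 1)‖ - ‖f (antipode (ζ 0))‖ * ‖f (antipode (ζ 1))‖)]

theorem integrable_symmetrize_mul {f : Sphere d → ℂ} (hf : MemLp f 2 (surfaceMeasure d)) :
    Integrable (fun ζ : Fin 2 → Sphere d => symmetrize f (ζ 0) * symmetrize f (ζ 1))
      (sphPi d 2) := by
  have hg := integrable_symmetrize hf
  have := (integrable_mul_sphPi_two hg.ofReal hg.ofReal).re (𝕜 := ℂ)
  simpa using this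

theorem lintegral_extension_four_le_symmetrize {f : Sphere d → ℂ}
    (hf : MemLp f 2 (surfaceMeasure d)) :
    ∫⁻ ξ, ‖extension d f ξ‖ₑ ^ 4 ≤
      ∫⁻ ξ, ‖extension d (fun ζ => (symmetrize f ζ : ℂ)) ξ‖ₑ ^ 4 := by
  rw [lintegral_extension_four_eq hf]
  refine (lintegral_fourierPush_sq_le_of_norm_le measurable_vsum (integrable_symTensor hf)
    (integrable_symmetrize_mul hf) (.of_forall (norm_symTensor_le f))).trans_eq ?_
  refine lintegral_congr fun ξ => ?_
  have := enorm_extension_pow (k := 2) (fun ζ => (symmetrize f ζ : ℂ)) ξ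
  simp only [Fin.prod_univ_two] at this
  simp only [Complex.ofReal_mul]
  exact this.symm

/-- The sharp inequality from `L²` to `L⁴`. -/
theorem lintegral_extension_four_le (hd : 3 ≤ d) (hd7 : d ≤ 7) {f : Sphere d → ℂ}
    (hf : MemLp f 2 (surfaceMeasure d)) :
    surfaceMeasure d Set.univ ^ 2 * ∫⁻ ξ, ‖extension d f ξ‖ₑ ^ 4 ≤
      (∫⁻ ζ, ‖f ζ‖ₑ ^ 2 ∂(surfaceMeasure d)) ^ 2 *
        ∫⁻ ξ, ‖extension d (fun _ => 1) ξ‖ₑ ^ 4 := by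
  refine (mul_le_mul' le_rfl (lintegral_extension_four_le_symmetrize hf)).trans ?_
  rw [← lintegral_symmetrize_sq hf]
  exact lintegral_extension_four_le_of_even hd hd7 (integrable_symmetrize hf)
    (integrable_symmetrize_sq hf) (symmetrize_nonneg f) (symmetrize_antipode f)

theorem exists_const_of_ae_eq (hd : d ≠ 0) {a b : Sphere d → ℝ}
    (h : ∀ᵐ ζ ∂(sphPi d 2), a (ζ 0) = b (ζ 1)) : ∃ r, ∀ᵐ ζ ∂(surfaceMeasure d), b ζ = r := by
  have : NeZero (surfaceMeasure d) :=
    ⟨fun h => surfaceMeasure_univ_ne_zero hd (by simp [h])⟩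
  have : NeZero (sphPi d 0) := ⟨fun h => by
    have h1 : sphPi d 0 Set.univ = 0 := by simp [h]
    rw [sphPi, Measure.pi_univ, Finset.prod_const] at h1
    exact surfaceMeasure_univ_ne_zero hd (eq_zero_of_pow_eq_zero h1)⟩
  obtain ⟨η, hη⟩ := (sphPi_ae_succ h).exists
  refine ⟨a η, (sphPi_ae_succ hη).mono fun θ hθ => ?_⟩
  obtain ⟨ζ, hζ⟩ := hθ.exists
  exact hζ.symm

/-- The maximizers have constant modulus. -/
theorem exists_norm_eq_of_extension_four_eq (hd : 3 ≤ d) (hd7 : d ≤ 7) {f : Sphere d → ℂ}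
    (hf : MemLp f 2 (surfaceMeasure d)) (h0 : ¬ f =ᵐ[surfaceMeasure d] 0)
    (heq : (∫⁻ ζ, ‖f ζ‖ₑ ^ 2 ∂(surfaceMeasure d)) ^ 2 *
        ∫⁻ ξ, ‖extension d (fun _ => 1) ξ‖ₑ ^ 4 ≤
      surfaceMeasure d Set.univ ^ 2 * ∫⁻ ξ, ‖extension d f ξ‖ₑ ^ 4) :
    ∃ r : ℝ, ∀ᵐ ζ ∂(surfaceMeasure d), ‖f ζ‖ = r := by
  have hd0 : d ≠ 0 := by omega
  have hσ0 : surfaceMeasure d Set.univ ^ 2 ≠ 0 :=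
    pow_ne_zero _ (surfaceMeasure_univ_ne_zero hd0)
  have hσt : surfaceMeasure d Set.univ ^ 2 ≠ ∞ := ENNReal.pow_ne_top (measure_ne_top _ _)
  have hg := integrable_symmetrize hf
  have hg2 := integrable_symmetrize_sq hf
  have hsq : ∀ {ζ : Sphere d} {r : ℝ}, symmetrize f ζ = r →
      ‖f ζ‖ ^ 2 + ‖f (antipode ζ)‖ ^ 2 = 2 * r ^ 2 := fun {ζ r} h => by
    have := symmetrize_sq f ζ
    rw [h] at this
    linarith
  -- The symmetrization has the same L² norm and at least as large an L⁴ norm on the Fourier side,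
  -- so it is itself a maximizer, hence constant.
  obtain ⟨r, hr0, hr⟩ := exists_const_of_even_eq hd hd7 hg hg2 (symmetrize_nonneg f)
    (symmetrize_antipode f) (fun h => h0 (by
      filter_upwards [h] with ζ hζ
      have h1 := hsq hζ
      simp only [Pi.zero_apply] at h1 ⊢
      have h2 : ‖f ζ‖ ^ 2 = 0 := by nlinarith [sq_nonneg ‖f ζ‖, sq_nonneg ‖f (antipode ζ)‖]
      simpa using h2)) (by
    rw [lintegral_symmetrize_sq hf]
    exact heq.trans (mul_le_mul' le_rfl (lintegral_extension_four_le_symmetrize hf)))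
  obtain ⟨w, hw, hmap, hw2⟩ := hasL2Density_two hd
  obtain ⟨hwfin, hone⟩ := lintegral_extension_one_pow hw hmap hw2
  have hp0 := two_pi_pow_ne_zero d
  have hpt := two_pi_pow_ne_top d
  obtain ⟨R, hR⟩ : ∃ R, R = ENNReal.ofReal r := ⟨_, rfl⟩
  have hf2 : ∫⁻ ζ, ‖f ζ‖ₑ ^ 2 ∂(surfaceMeasure d) = R ^ 2 * surfaceMeasure d Set.univ := by
    rw [← lintegral_symmetrize_sq hf, ← lintegral_const]
    refine lintegral_congr_ae ?_
    filter_upwards [hr] with ζ hζ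
    rw [hζ, hR, ← ofReal_norm, Real.norm_of_nonneg hr0]
  have hRt : R ≠ ∞ := hR ▸ ENNReal.ofReal_ne_top
  have hle : ∀ᵐ ζ ∂(sphPi d 2), symmetrize f (ζ 0) = r ∧ symmetrize f (ζ 1) = r := by
    have hq := fun i : Fin 2 =>
      (Measure.quasiMeasurePreserving_eval (fun _ : Fin 2 => surfaceMeasure d) i).ae hr
    filter_upwards [hq 0, hq 1] with ζ h1 h2 using ⟨h1, h2⟩
  have hptw : ∀ᵐ ζ ∂(sphPi d 2), ‖symTensor f ζ‖ₑ ^ 2 * w (vsum ζ) ≤ R ^ 4 * w (vsum ζ) := by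
    filter_upwards [hle] with ζ hζ
    have h1 := norm_symTensor_le f ζ
    rw [hζ.1, hζ.2] at h1
    have h2 : ‖symTensor f ζ‖ₑ ≤ R * R := by
      rw [← ofReal_norm, hR, ← ENNReal.ofReal_mul hr0]
      exact ENNReal.ofReal_le_ofReal h1
    calc ‖symTensor f ζ‖ₑ ^ 2 * w (vsum ζ) ≤ (R * R) ^ 2 * w (vsum ζ) := by gcongr
      _ = _ := by ring
  have hge : ∫⁻ ζ, R ^ 4 * w (vsum ζ) ∂(sphPi d 2) ≤
      ∫⁻ ζ, ‖symTensor f ζ‖ₑ ^ 2 * w (vsum ζ) ∂(sphPi d 2) := by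
    have h1 := lintegral_fourierPush_sq_le measurable_vsum hw hmap hw2 norm_vsum_le
      (integrable_symTensor hf).1
    rw [← lintegral_extension_four_eq hf] at h1
    rw [hf2, hone] at heq
    rw [lintegral_const_mul' _ _ (by finiteness), ← ENNReal.mul_le_mul_iff_right hp0 hpt,
      ← ENNReal.mul_le_mul_iff_right hσ0 hσt]
    refine (le_of_eq ?_).trans (heq.trans (mul_le_mul' le_rfl h1))
    ring
  have hae := ae_eq_of_ae_le_of_lintegral_le hptw
    (ne_top_of_le_ne_top (b := ∫⁻ ζ, R ^ 4 * w (vsum ζ) ∂(sphPi d 2)) (by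
      rw [lintegral_const_mul' _ _ (by finiteness)]
      finiteness) (lintegral_mono_ae hptw))
    ((hw.comp measurable_vsum).const_mul (R ^ 4)).aemeasurable hge
  -- Both vectors in the Cauchy-Schwarz bound have length √2 r and their inner product is at least
  -- 2r², so they coincide: |f(-ζ₀)| = |f(ζ₁)|. The two points vary independently, so |f| is
  -- constant.
  have hpair : ∀ᵐ ζ ∂(sphPi d 2), ‖f (antipode (ζ 0))‖ = ‖f (ζ 1)‖ := by
    filter_upwards [hae, hle, ae_density_comp_ne_zero measurable_vsum hw hmap,
      ae_comp_of_ae measurable_vsum hmap (ae_density_lt_top hw2 hw)] with ζ h1 h2 h3 h4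
    rw [ENNReal.mul_left_inj h3 h4.ne, hR, ← ofReal_norm, ← ENNReal.ofReal_pow (norm_nonneg _),
      ← ENNReal.ofReal_pow hr0, ENNReal.ofReal_eq_ofReal_iff (by positivity) (by positivity)] at h1
    have h5 : ‖symTensor f ζ‖ = r ^ 2 := by
      refine (sq_eq_sq₀ (norm_nonneg _) (by positivity)).1 ?_
      rw [h1]
      ring
    have h6 := norm_symTensor_le_half f ζ
    have h7 := hsq h2.1
    have h8 := hsq h2.2
    have h9 : (‖f (antipode (ζ 0))‖ - ‖f (ζ 1)‖) ^ 2 = 0 := by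
      refine le_antisymm ?_ (sq_nonneg _)
      nlinarith [sq_nonneg (‖f (ζ 0)‖ - ‖f (antipode (ζ 1))‖)]
    exact sub_eq_zero.1 (pow_eq_zero_iff two_ne_zero |>.1 h9)
  exact exists_const_of_ae_eq hd0 (a := fun ζ => ‖f (antipode ζ)‖) hpair

/-- In the equality case |f| is constant, so all normalized L^q norms of f agree. Then f is also
optimal from L⁴ to L⁴, where the equality cases are already known. -/
theorem sharpAt_four_two (hd : 3 ≤ d) (hd7 : d ≤ 7) :
    SharpAt d ((2 * 2 : ℕ) : ℝ≥0∞) 2 := by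
  have hd0 : d ≠ 0 := by omega
  obtain ⟨hE, h44⟩ := sharpAt_two_mul (d := d) (k := 2) (Or.inl ⟨hd, le_rfl⟩)
  have h4 : 2 * 2 ≠ 0 := by norm_num
  have hpow : (sphereArea d ^ ((2 : ℝ≥0∞)⁻¹).toReal) ^ (2 * 2) =
      surfaceMeasure d Set.univ ^ 2 := by
    rw [pow_mul, ← ENNReal.rpow_natCast (sphereArea d ^ _), ← ENNReal.rpow_mul, ENNReal.toReal_inv]
    norm_num
    rfl
  have h2pow : ∀ f : Sphere d → ℂ, eLpNorm f 2 (surfaceMeasure d) ^ (2 * 2) =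
      (∫⁻ ζ, ‖f ζ‖ₑ ^ 2 ∂(surfaceMeasure d)) ^ 2 := fun f => by
    rw [pow_mul, eLpNorm_two_sq]
  refine ⟨hE, fun f hf => ⟨?_, fun heq h0 => ?_⟩⟩
  · rw [← ENNReal.pow_le_pow_left_iff h4, mul_pow, mul_pow, hpow, eLpNorm_natCast_pow h4,
      eLpNorm_natCast_pow h4, h2pow, mul_comm (∫⁻ ξ, _)]
    exact lintegral_extension_four_le hd hd7 hf
  · have heq' := heq
    rw [← ENNReal.pow_le_pow_left_iff h4, mul_pow, mul_pow, hpow, eLpNorm_natCast_pow h4,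
      eLpNorm_natCast_pow h4, h2pow, mul_comm (∫⁻ ξ, _)] at heq'
    obtain ⟨r, hr⟩ := exists_norm_eq_of_extension_four_eq hd hd7 hf h0 heq'
    have hμ : surfaceMeasure d ≠ 0 := fun h => surfaceMeasure_univ_ne_zero hd0 (by simp [h])
    have hnorm : ∀ q : ℝ≥0∞, q ≠ 0 → eLpNorm f q (surfaceMeasure d) =
        ‖r‖ₑ * sphereArea d ^ (q⁻¹).toReal := fun q hq => by
      have e : eLpNorm f q (surfaceMeasure d) = eLpNorm (fun _ => r) q (surfaceMeasure d) := by
        refine eLpNorm_congr_norm_ae ?_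
        filter_upwards [hr] with ζ hζ
        rw [← hζ, norm_norm]
      rw [e, eLpNorm_const _ hq hμ, one_div, ENNReal.toReal_inv]
      rfl
    have hS : ∀ q : ℝ≥0∞, sphereArea d ^ (q⁻¹).toReal ≠ 0 ∧ sphereArea d ^ (q⁻¹).toReal ≠ ∞ :=
      fun q => ⟨by
        rw [Ne, ENNReal.rpow_eq_zero_iff]
        push Not
        exact ⟨fun h => absurd h (surfaceMeasure_univ_ne_zero hd0),
          fun h => absurd h (measure_ne_top _ _)⟩,
        ENNReal.rpow_ne_top_of_nonneg ENNReal.toReal_nonneg (measure_ne_top _ _)⟩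
    rw [hnorm 2 two_ne_zero, ← mul_assoc, mul_comm (sphereArea d ^ _),
      ENNReal.mul_le_mul_iff_left (hS 2).1 (hS 2).2] at heq
    refine (h44 f (MemLp.of_bound hf.1 r (hr.mono fun ζ hζ => hζ.le))).2 ?_ h0
    rw [hnorm _ (by norm_num), ← mul_assoc, mul_comm (sphereArea d ^ _)]
    gcongr

end Symmetrization

end SphereRestriction

end

theorem theorem1 (d k : ℕ) (q : ℝ≥0∞)
    (h : (k = 2 ∧ 2 ≤ q ∧ 3 ≤ d ∧ d ≤ 7) ∨
         (k = 2 ∧ 4 ≤ q ∧ 8 ≤ d) ∨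
         (3 ≤ k ∧ ((2 * k : ℕ) : ℝ≥0∞) ≤ q ∧ 2 ≤ d)) :
    SphereRestriction.sharpConst d ((2 * k : ℕ) : ℝ≥0∞) q ≠ ∞ ∧
    SphereRestriction.sharpConst d ((2 * k : ℕ) : ℝ≥0∞) q =
      SphereRestriction.sphereArea d ^ (-(q⁻¹).toReal) *
        eLpNorm (SphereRestriction.extension d (fun _ => 1)) ((2 * k : ℕ) : ℝ≥0∞) volume ∧
    ∀ f : SphereRestriction.Sphere d → ℂ,
      SphereRestriction.IsExtremizer d ((2 * k : ℕ) : ℝ≥0∞) q f ↔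
        ∃ (c : ℂ) (ξ : SphereRestriction.Space d), c ≠ 0 ∧
          f =ᵐ[SphereRestriction.surfaceMeasure d]
            fun ζ => c * Complex.exp
              (Complex.I * ((inner ℝ ξ (ζ : SphereRestriction.Space d) : ℝ) : ℂ)) := by
  rcases h with ⟨rfl, hq, hd, hd7⟩ | ⟨rfl, hq, hd⟩ | ⟨hk, hq, hd⟩
  · exact (SphereRestriction.sharpAt_four_two hd hd7).conclusion (by omega) two_ne_zero hq
  · exact (SphereRestriction.sharpAt_two_mul (k := 2) (Or.inl ⟨by omega, le_rfl⟩)).conclusion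
      (by omega) (by norm_num) (by exact_mod_cast hq)
  · refine (SphereRestriction.sharpAt_two_mul (k := k) ?_).conclusion (by omega)
      (by exact_mod_cast (show 2 * k ≠ 0 by omega)) hq
    omega
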